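/- For $u,v\in\mathscr S(\mathbb R)$ let $$\mathcal W(u,v)(x,\xi)=\int_{\mathbb R}e^{-2i\pi z\xi}\,u\bigl(x+\tfrac z2\bigr)\,\overline{v\bigl(x-\tfrac z2\bigr)}\,dz$$ be the joint Wigner distribution. Let $\sigma\ge 0$, let $\mathcal C_\sigma=\{(x,\xi)\in\mathbb R^2:\ x\ge 0,\ x\xi\ge\sigma\}$, and let $A_\sigma$ be the Weyl quantization of the indicator function $\mathbf 1_{\mathcal C_\sigma}$, i.e. the operator determined by $$\langle A_\sigma u,v\rangle=\iint_{\mathcal C_\sigma}\mathcal W(u,v)(x,\xi)\,dx\,d\xi\qquad(u,v\in\mathscr S(\mathbb R)).$$ Here the integrals converge absolutely. For $\tau\in\mathbb R$ put $$a_{11}(\tau)=\frac12+\frac1{2\pi}\int_0^{+\infty}\frac{\sin\bigl(2\pi t\tau-4\pi\sigma\tanh(t/2)\bigr)}{\sinh(t/2)}\,dt,\qquad a_{12}(\tau)=\frac{i}{4\pi}\int_0^{+\infty}\frac{e^{-2i\pi\left(t\tau-\frac{2\sigma}{\tanh(t/2)}\right)}}{\cosh(t/2)}\,dt,$$ $$\mathcal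 M_\sigma(\tau)=\begin{pmatrix}a_{11}(\tau)&a_{12}(\tau)\\ \overline{a_{12}(\tau)}&0\end{pmatrix}.$$ Then: (1) $A_\sigma$ extends uniquely to a bounded operator on $L^2(\mathbb R)$, and this operator is self-adjoint. (2) The formula $(\Psi u)(t)=\bigl(u(e^t)e^{t/2},\,u(-e^t)e^{t/2}\bigr)$ defines a unitary isomorphism $\Psi:L^2(\mathbb R)\to L^2(\mathbb R;\mathbb C^2)$, and $\Psi A_\sigma\Psi^{-1}$ is the Fourier multiplier by $\mathcal M_\sigma$: for every $\Phi\in L^2(\mathbb R;\mathbb C^2)$, $$\widehat{\Psi A_\sigma\Psi^{-1}\Phi}(\tau)=\mathcal M_\sigma(\tau)\,\hat\Phi(\tau)\quad\text{for almost every }\tau\in\mathbb R,$$ where $\hat f(\tau)=\int_{\mathbb R}e^{-2i\pi t\tau}f(t)\,dt$ (extended to $L^2$). (3) The spectrum of $A_\sigma$ is the closure of the set of the eigenvalues of the matrices $\mathcal M_\sigma(\tau)$, $\tau\in\mathbb R$. (4) $\inf\bigl(\operatorname{spectrum}(A_\sigma)\bigr)<0<1<\sup\bigl(\operatorname{spectrum}(A_\sigma)\bigr)$.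 -/

import Mathlib

open MeasureTheory Set
open scoped SchwartzMap ComplexConjugate ENNReal

/-- The complex Hilbert space `L²(ℝ)` (Lebesgue measure). -/
noncomputable abbrev L2Line : Type := Lp ℂ 2 (volume : Measure ℝ)

/-- The complex Hilbert space `L²(ℝ; ℂ²)` (Lebesgue measure). -/
noncomputable abbrev L2Pair : Type := Lp (EuclideanSpace ℂ (Fin 2)) 2 (volume : Measure ℝ)

/-- The joint Wigner distribution
`W(u,v)(x,ξ) = ∫ e^{-2iπ z ξ} u(x + z/2) conj (v(x - z/2)) dz`. -/
noncomputable def wigner (u v : ℝ → ℂ) (p : ℝ × ℝ) : ℂ :=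
  ∫ z : ℝ, Complex.exp (-2 * Real.pi * Complex.I * z * p.2) *
    u (p.1 + z / 2) * conj (v (p.1 - z / 2))

/-- `A` is the bounded operator on `L²(ℝ)` given by the Weyl quantization of the symbol `a`:
`⟨A u, v⟩ = ∬ a(x,ξ) W(u,v)(x,ξ) dx dξ` for all Schwartz functions `u, v`, the integrals being
absolutely convergent. (Mathlib's inner product is conjugate-linear in its first argument.) -/
def IsWeylQuantization (a : ℝ × ℝ → ℂ) (A : L2Line →L[ℂ] L2Line) : Prop :=
  ∀ u v : 𝓢(ℝ, ℂ),
    Integrable (fun p : ℝ × ℝ => a p * wigner u v p) volume ∧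
    inner ℂ (v.toLp 2 volume) (A (u.toLp 2 volume)) = ∫ p : ℝ × ℝ, a p * wigner u v p

/-- The hyperbolic region `{(x,ξ) : x ≥ 0, x ξ ≥ σ}` of the phase plane. -/
def hyperbolicRegion (σ : ℝ) : Set (ℝ × ℝ) :=
  {p | 0 ≤ p.1 ∧ σ ≤ p.1 * p.2}

/-- The diagonal coefficient
`a₁₁(τ,σ) = 1/2 + (1/2π) ∫_0^∞ sin(2π t τ - 4π σ tanh(t/2)) / sinh(t/2) dt`. -/
noncomputable def coeffDiag (σ τ : ℝ) : ℝ :=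
  1 / 2 + 1 / (2 * Real.pi) *
    ∫ t in Ioi (0 : ℝ),
      Real.sin (2 * Real.pi * t * τ - 4 * Real.pi * σ * Real.tanh (t / 2)) / Real.sinh (t / 2)

/-- The off-diagonal coefficient
`a₁₂(τ,σ) = (i/4π) ∫_0^∞ e^{-2iπ (t τ - 2σ / tanh(t/2))} / cosh(t/2) dt`. -/
noncomputable def coeffOffDiag (σ τ : ℝ) : ℂ :=
  Complex.I / (4 * Real.pi) *
    ∫ t in Ioi (0 : ℝ),
      Complex.exp (-2 * Real.pi * Complex.I *
        ((t * τ - 2 * σ / Real.tanh (t / 2) : ℝ) : ℂ)) / ((Real.cosh (t / 2) : ℝ) : ℂ)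

/-- The Hermitian matrix symbol `M_σ(τ)`. -/
noncomputable def multiplierMatrix (σ τ : ℝ) : Matrix (Fin 2) (Fin 2) ℂ :=
  !![(coeffDiag σ τ : ℂ), coeffOffDiag σ τ; conj (coeffOffDiag σ τ), 0]

/-- `Ψ` is the passage to logarithmic coordinates on each half-line:
`(Ψ u)(t) = (u(e^t) e^{t/2}, u(-e^t) e^{t/2})`. -/
def IsLogCoordinates (Ψ : L2Line ≃ₗᵢ[ℂ] L2Pair) : Prop :=
  ∀ u : L2Line, (Ψ u : ℝ → EuclideanSpace ℂ (Fin 2)) =ᵐ[volume] fun t : ℝ =>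
    !₂[u (Real.exp t) * (Real.exp (t / 2) : ℂ), u (-Real.exp t) * (Real.exp (t / 2) : ℂ)]

/-- `B` is the Fourier multiplier on `L²(ℝ; ℂ²)` by the matrix-valued function `M`:
`(B Φ)^(τ) = M(τ) Φ^(τ)` for almost every `τ`, where `^` is the Fourier transform on `L²`,
normalized by `f^(τ) = ∫ e^{-2iπ t τ} f(t) dt`. -/
def IsMatrixFourierMultiplier (M : ℝ → Matrix (Fin 2) (Fin 2) ℂ) (B : L2Pair → L2Pair) : Prop :=
  ∀ Φ : L2Pair,
    (Lp.fourierTransformₗᵢ ℝ (EuclideanSpace ℂ (Fin 2)) (B Φ) :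
        ℝ → EuclideanSpace ℂ (Fin 2)) =ᵐ[volume]
      fun τ : ℝ => Matrix.toEuclideanLin (M τ)
        (Lp.fourierTransformₗᵢ ℝ (EuclideanSpace ℂ (Fin 2)) Φ τ)

/-! The proof computes the Weyl form explicitly and recognises a matrix Fourier multiplier.

For fixed `x > 0` the inner integral runs over the half-line `ξ ≥ σ / x` of the Fourier transform of
`z ↦ u(x + z/2) conj(v(x - z/2))`. A half-line integral of a Fourier transform is half the value at
`0` plus a principal value in `z` (`integral_Ioi_fourier`). After the scaling `z = x w` the phase
depends on `w` only, and Fubini allows `x` to be integrated first. The arguments are then `x(1 ±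
w/2)`. For `w < 2` both are positive, and `w = 2 tanh(r/2)` gives the diagonal kernel; for `w > 2`
their signs differ, and `w = 2 / tanh(r/2)` gives the off-diagonal one. They are never both
negative, whence the zero entry of the matrix. In logarithmic coordinates the `x`-integrals are
correlations, and Parseval turns the form into an integral against the matrix symbol
(`integral_indicator_mul_wigner_eq_symbol`). The operator is therefore unitarily equivalent to
multiplication by a bounded continuous Hermitian matrix function; uniqueness follows from the
density of Schwartz functions, and the spectrum from `spectrum_mulOp_hermitianPair`.

The eigenvalues are the roots of `μ² - a₁₁ μ - |a₁₂|²`. One is negative wherever `a₁₂ ≠ 0`, and one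
exceeds `1` wherever `a₁₁ + |a₁₂|² > 1`. The second condition is the delicate one, and it is
obtained by comparing decay rates as `τ → +∞`. The derivative of `a₁₁` is the Fourier integral of a
function holomorphic in the strip `0 ≤ im z ≤ 1`; shifting the contour gives `1 - a₁₁ ≤ C e^{-2πτ}`
(`exists_one_sub_coeffDiag_le`). On the other hand `a₁₂` is, up to a constant, the Fourier transform
of a function supported on a half-line, hence the boundary value of a bounded holomorphic function
on a half-plane. By Phragmén–Lindelöf such a function cannot decay exponentially on half of the
boundary unless it vanishes (`eq_zero_of_exp_decay_half_imaginary_axis`). So `|a₁₂|² ≤ 1 - a₁₁` must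
fail somewhere. -/

open Filter Topology BoundedContinuousFunction

/-! ### Multiplication by operator-valued functions on `L²` and its spectrum -/

section MultiplicationOperator

variable {E : Type*} [NormedAddCommGroup E] [NormedSpace ℂ E]

theorem BoundedContinuousFunction.memLp_clm_apply (G : ℝ →ᵇ (E →L[ℂ] E))
    (Φ : Lp E 2 (volume : Measure ℝ)) :
    MemLp (fun τ => G τ (Φ τ)) 2 volume := by
  refine (Lp.memLp Φ).of_le_mul (c := ‖G‖) ?_ (ae_of_all _ fun τ => ?_)
  · exact (ContinuousLinearMap.id ℂ (E →L[ℂ] E)).aestronglyMeasurable_comp₂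
      G.continuous.aestronglyMeasurable (Lp.aestronglyMeasurable Φ)
  · exact ((G τ).le_opNorm _).trans (by gcongr; exact G.norm_coe_le_norm τ)

/-- Multiplication on `L²(ℝ; E)` by a bounded continuous operator-valued function. -/
noncomputable def mulOp (G : ℝ →ᵇ (E →L[ℂ] E)) :
    Lp E 2 (volume : Measure ℝ) →L[ℂ] Lp E 2 (volume : Measure ℝ) :=
  LinearMap.mkContinuous
    { toFun := fun Φ => (G.memLp_clm_apply Φ).toLp _
      map_add' := fun Φ Φ' => by
        ext1
        filter_upwards [MemLp.coeFn_toLp (G.memLp_clm_apply (Φ + Φ')),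
          MemLp.coeFn_toLp (G.memLp_clm_apply Φ), MemLp.coeFn_toLp (G.memLp_clm_apply Φ'),
          Lp.coeFn_add Φ Φ', Lp.coeFn_add ((G.memLp_clm_apply Φ).toLp _)
            ((G.memLp_clm_apply Φ').toLp _)] with τ h1 h2 h3 h4 h5
        rw [h1, h5, Pi.add_apply, h2, h3, h4, Pi.add_apply, map_add]
      map_smul' := fun c Φ => by
        ext1
        filter_upwards [MemLp.coeFn_toLp (G.memLp_clm_apply (c • Φ)),
          MemLp.coeFn_toLp (G.memLp_clm_apply Φ),
          Lp.coeFn_smul c Φ, Lp.coeFn_smul c ((G.memLp_clm_apply Φ).toLp _)] with τ h1 h2 h4 h5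
        rw [h1, RingHom.id_apply, h5, Pi.smul_apply, h2, h4, Pi.smul_apply, map_smul] }
    ‖G‖ fun Φ => by
      refine Lp.norm_le_mul_norm_of_ae_le_mul ?_
      filter_upwards [MemLp.coeFn_toLp (G.memLp_clm_apply Φ)] with τ h
      refine (congrArg norm h).le.trans (((G τ).le_opNorm _).trans ?_)
      gcongr
      exact G.norm_coe_le_norm τ

theorem mulOp_ae (G : ℝ →ᵇ (E →L[ℂ] E)) (Φ : Lp E 2 (volume : Measure ℝ)) :
    mulOp G Φ =ᵐ[volume] fun τ => G τ (Φ τ) :=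
  MemLp.coeFn_toLp (G.memLp_clm_apply Φ)

theorem mulOp_mul (G H : ℝ →ᵇ (E →L[ℂ] E)) : mulOp (G * H) = mulOp G * mulOp H := by
  ext1 Φ
  ext1
  filter_upwards [mulOp_ae (G * H) Φ, mulOp_ae G (mulOp H Φ), mulOp_ae H Φ] with τ h1 h2 h3
  rw [h1, mul_apply_eq_comp, h2, h3]
  simp

theorem mulOp_smul_one_sub (G : ℝ →ᵇ (E →L[ℂ] E)) (μ : ℂ) :
    mulOp (μ • 1 - G) = algebraMap ℂ _ μ - mulOp G := by
  ext1 Φ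
  ext1
  filter_upwards [mulOp_ae (μ • 1 - G) Φ, mulOp_ae G Φ, Lp.coeFn_smul μ Φ,
    Lp.coeFn_sub (μ • Φ) (mulOp G Φ)] with τ h1 h2 h3 h4
  rw [h1]
  have : (algebraMap ℂ (Lp E 2 (volume : Measure ℝ) →L[ℂ] Lp E 2 (volume : Measure ℝ)) μ
      - mulOp G) Φ = μ • Φ - mulOp G Φ := by
    simp [Algebra.algebraMap_eq_smul_one]
  rw [this, h4, Pi.sub_apply, h3, h2]
  simp

theorem mulOp_one : mulOp (1 : ℝ →ᵇ (E →L[ℂ] E)) = 1 := by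
  ext1 Φ
  ext1
  filter_upwards [mulOp_ae (1 : ℝ →ᵇ (E →L[ℂ] E)) Φ] with τ h1
  rw [h1]
  simp

theorem isUnit_mulOp {G : ℝ →ᵇ (E →L[ℂ] E)} (h : IsUnit G) : IsUnit (mulOp G) := by
  obtain ⟨u, rfl⟩ := h
  exact ⟨⟨mulOp u, mulOp ↑u⁻¹, by rw [← mulOp_mul, u.mul_inv, mulOp_one],
    by rw [← mulOp_mul, u.inv_mul, mulOp_one]⟩, rfl⟩

/-- `mulOp` is multiplicative and unital, so an inverse of `μ - G` among bounded continuous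
functions yields an inverse operator. -/
theorem spectrum_mulOp_subset (G : ℝ →ᵇ (E →L[ℂ] E)) :
    spectrum ℂ (mulOp G) ⊆ spectrum ℂ G := by
  intro μ hμ h
  apply hμ
  rw [spectrum.mem_resolventSet_iff, Algebra.algebraMap_eq_smul_one] at h
  rw [spectrum.mem_resolventSet_iff, ← mulOp_smul_one_sub]
  exact isUnit_mulOp h

theorem ContinuousLinearMap.exists_norm_le_of_isUnit {T : E →L[ℂ] E} (hT : IsUnit T) :
    ∃ K : ℝ, 0 ≤ K ∧ ∀ x, ‖x‖ ≤ K * ‖T x‖ := by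
  obtain ⟨u, rfl⟩ := hT
  refine ⟨‖(↑u⁻¹ : E →L[ℂ] E)‖, norm_nonneg _, fun x => ?_⟩
  have h1 : (↑u⁻¹ * (u : E →L[ℂ] E)) x = x := by
    rw [u.inv_mul]; rfl
  conv_lhs => rw [← h1]
  exact ContinuousLinearMap.le_opNorm (↑u⁻¹ : E →L[ℂ] E) _

/-- An eigenvector at one point gives approximate eigenvectors: `v` times the indicator of a small
ball around `τ₀`. By continuity `μ - G` is small on them, which contradicts the lower bound that
invertibility would give. -/
theorem mem_spectrum_mulOp (G : ℝ →ᵇ (E →L[ℂ] E)) {μ : ℂ} {τ₀ : ℝ} {v : E}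
    (hv : v ≠ 0) (h : G τ₀ v = μ • v) : μ ∈ spectrum ℂ (mulOp G) := by
  intro hμ
  rw [spectrum.mem_resolventSet_iff, ← mulOp_smul_one_sub] at hμ
  obtain ⟨K, hKn, hbound⟩ := ContinuousLinearMap.exists_norm_le_of_isUnit hμ
  have hvpos : 0 < ‖v‖ := norm_pos_iff.2 hv
  have hcont : ContinuousAt (fun τ => ‖μ • v - G τ v‖) τ₀ := by
    have := G.continuous
    fun_prop
  -- Chosen so that `K * ε < 1`; the `+ 1` covers `K = 0`.
  set ε : ℝ := 1 / (2 * (K + 1)) with hε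
  have hεpos : 0 < ε := by positivity
  have hev : ∀ᶠ τ in 𝓝 τ₀, ‖μ • v - G τ v‖ < ε * ‖v‖ := by
    apply hcont.eventually_lt_const
    simp only [h, sub_self, norm_zero]
    positivity
  obtain ⟨δ, hδ, hball⟩ := Metric.eventually_nhds_iff_ball.1 hev
  have hfin : volume (Metric.ball τ₀ δ) ≠ ∞ := measure_ball_lt_top.ne
  set Φ : Lp E 2 (volume : Measure ℝ) := indicatorConstLp 2 measurableSet_ball hfin v with hΦ
  have hΦpos : 0 < ‖Φ‖ := by
    rw [hΦ, norm_indicatorConstLp (by norm_num) (by norm_num)]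
    refine mul_pos hvpos (Real.rpow_pos_of_pos ?_ _)
    exact ENNReal.toReal_pos (Metric.measure_ball_pos volume τ₀ hδ).ne' hfin
  have hsmall : ‖mulOp (μ • 1 - G) Φ‖ ≤ ε * ‖Φ‖ := by
    refine Lp.norm_le_mul_norm_of_ae_le_mul ?_
    filter_upwards [mulOp_ae (μ • 1 - G) Φ,
      indicatorConstLp_coeFn (p := 2) (hs := measurableSet_ball (x := τ₀) (ε := δ))
        (hμs := hfin) (c := v)] with τ h1 h2
    rw [h1, hΦ, h2]
    by_cases hτ : τ ∈ Metric.ball τ₀ δ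
    · simp only [hτ, indicator_of_mem]
      have := (hball τ hτ).le
      simpa using this
    · simp [hτ]
  have := hbound Φ
  have h3 : K * ‖mulOp (μ • 1 - G) Φ‖ ≤ K * (ε * ‖Φ‖) := by gcongr
  have h4 : K * ε < 1 := by
    rw [hε, mul_one_div, div_lt_one (by positivity)]; linarith
  nlinarith

end MultiplicationOperator

/-! ### Two-by-two matrix symbols and the spectrum they generate -/

theorem Matrix.continuous_toEuclideanCLM :
    Continuous (Matrix.toEuclideanCLM (n := Fin 2) (𝕜 := ℂ)) :=
  LinearMap.continuous_of_finiteDimensional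
    (Matrix.toEuclideanCLM (n := Fin 2) (𝕜 := ℂ)).toAlgEquiv.toLinearMap

/-- Compactness of the set of matrices with bounded entries replaces an explicit comparison of
norms. -/
theorem Matrix.exists_norm_toEuclideanCLM_le (C : ℝ) : ∃ K : ℝ, ∀ M : Matrix (Fin 2) (Fin 2) ℂ,
    (∀ i j, ‖M i j‖ ≤ C) → ‖Matrix.toEuclideanCLM (n := Fin 2) (𝕜 := ℂ) M‖ ≤ K := by
  have hc : IsCompact {M : Matrix (Fin 2) (Fin 2) ℂ | ∀ i j, ‖M i j‖ ≤ C} := by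
    have h1 : IsCompact (Set.pi univ fun _ : Fin 2 => Set.pi univ fun _ : Fin 2 =>
      Metric.closedBall (0 : ℂ) C) :=
      isCompact_univ_pi fun _ => isCompact_univ_pi fun _ => isCompact_closedBall _ _
    have h2 : {M : Matrix (Fin 2) (Fin 2) ℂ | ∀ i j, ‖M i j‖ ≤ C} =
        (Set.pi univ fun _ : Fin 2 => Set.pi univ fun _ : Fin 2 =>
          Metric.closedBall (0 : ℂ) C) := by
      refine Set.ext fun M => ⟨fun h i _ j _ => ?_, fun h i j => ?_⟩
      · simpa using h i j
      · simpa using h i trivial j trivial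
    rw [h2]
    exact h1
  obtain ⟨K, hK⟩ := (hc.image Matrix.continuous_toEuclideanCLM).isBounded.exists_norm_le
  exact ⟨K, fun M hM => hK _ ⟨M, hM, rfl⟩⟩

/-- A bounded continuous matrix function as a bounded continuous operator-valued function. -/
noncomputable def bcfMatrix (M : ℝ → Matrix (Fin 2) (Fin 2) ℂ) (hM : Continuous M)
    (hb : ∃ C : ℝ, ∀ τ i j, ‖M τ i j‖ ≤ C) :
    ℝ →ᵇ (EuclideanSpace ℂ (Fin 2) →L[ℂ] EuclideanSpace ℂ (Fin 2)) :=
  BoundedContinuousFunction.ofNormedAddCommGroup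
    (fun τ => Matrix.toEuclideanCLM (n := Fin 2) (𝕜 := ℂ) (M τ))
    (Matrix.continuous_toEuclideanCLM.comp hM)
    (Matrix.exists_norm_toEuclideanCLM_le hb.choose).choose
    fun τ => (Matrix.exists_norm_toEuclideanCLM_le hb.choose).choose_spec _ (hb.choose_spec τ)

@[simp]
theorem bcfMatrix_apply (M : ℝ → Matrix (Fin 2) (Fin 2) ℂ) (hM : Continuous M)
    (hb : ∃ C : ℝ, ∀ τ i j, ‖M τ i j‖ ≤ C) (τ : ℝ) :
    bcfMatrix M hM hb τ = Matrix.toEuclideanCLM (n := Fin 2) (𝕜 := ℂ) (M τ) := rfl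

theorem isUnit_bcfMatrix {M N : ℝ → Matrix (Fin 2) (Fin 2) ℂ} (hM : Continuous M)
    (hb : ∃ C : ℝ, ∀ τ i j, ‖M τ i j‖ ≤ C) (hN : Continuous N)
    (hb' : ∃ C : ℝ, ∀ τ i j, ‖N τ i j‖ ≤ C) (h : ∀ τ, M τ * N τ = 1) :
    IsUnit (bcfMatrix M hM hb) := by
  refine ⟨⟨bcfMatrix M hM hb, bcfMatrix N hN hb', ?_, ?_⟩, rfl⟩
  · ext1 τ
    rw [BoundedContinuousFunction.mul_apply, bcfMatrix_apply, bcfMatrix_apply, ← map_mul, h,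
      map_one]
    rfl
  · ext1 τ
    rw [BoundedContinuousFunction.mul_apply, bcfMatrix_apply, bcfMatrix_apply, ← map_mul,
      mul_eq_one_comm.1 (h τ), map_one]
    rfl

theorem smul_one_sub_bcfMatrix {M : ℝ → Matrix (Fin 2) (Fin 2) ℂ} (hM : Continuous M)
    (hb : ∃ C : ℝ, ∀ τ i j, ‖M τ i j‖ ≤ C) (μ : ℂ) (hM' : Continuous fun τ => μ • 1 - M τ)
    (hb' : ∃ C : ℝ, ∀ τ i j, ‖(μ • 1 - M τ) i j‖ ≤ C) :
    μ • 1 - bcfMatrix M hM hb = bcfMatrix _ hM' hb' := by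
  ext1 τ
  rw [bcfMatrix_apply, map_sub, map_smul, map_one]
  rfl

theorem isSelfAdjoint_mulOp_bcfMatrix {M : ℝ → Matrix (Fin 2) (Fin 2) ℂ} (hM : Continuous M)
    (hb : ∃ C : ℝ, ∀ τ i j, ‖M τ i j‖ ≤ C) (hH : ∀ τ, (M τ).IsHermitian) :
    IsSelfAdjoint (mulOp (bcfMatrix M hM hb)) := by
  rw [ContinuousLinearMap.isSelfAdjoint_iff_isSymmetric]
  intro Φ Ψ
  simp only [ContinuousLinearMap.coe_coe, L2.inner_def]
  refine integral_congr_ae ?_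
  filter_upwards [mulOp_ae (bcfMatrix M hM hb) Φ, mulOp_ae (bcfMatrix M hM hb) Ψ] with τ h1 h2
  rw [h1, h2, bcfMatrix_apply, ← ContinuousLinearMap.adjoint_inner_right,
    ← ContinuousLinearMap.star_eq_adjoint, ← map_star]
  rw [Matrix.star_eq_conjTranspose, hH τ]

/-- An eigenvalue of `!![a, b; conj b, 0]` is a root of the characteristic polynomial. -/
theorem hasEigenvalue_hermitianPair_iff (a : ℝ) (b μ : ℂ) :
    Module.End.HasEigenvalue (Matrix.toLin' !![(a : ℂ), b; conj b, 0]) μ ↔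
      μ ^ 2 - a * μ - b * conj b = 0 := by
  rw [Module.End.hasEigenvalue_iff_isRoot_charpoly, Matrix.charpoly_toLin', Polynomial.IsRoot.def,
    Matrix.eval_charpoly, Matrix.det_fin_two]
  simp [Matrix.scalar_apply]
  constructor <;> intro h <;> linear_combination h

/-- The discriminant `a² + 4|b|²` is nonnegative. The factorisation serves to bound the
characteristic polynomial from below by distances to eigenvalues. -/
theorem exists_roots_hermitianPair (a : ℝ) (b : ℂ) : ∃ p q : ℝ, ∀ μ : ℂ,
    μ ^ 2 - a * μ - b * conj b = (μ - p) * (μ - q) := by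
  set s : ℝ := Real.sqrt (a ^ 2 + 4 * ‖b‖ ^ 2) with hs
  have hs2 : s ^ 2 = a ^ 2 + 4 * ‖b‖ ^ 2 := Real.sq_sqrt (by positivity)
  have hs3 : (s : ℂ) ^ 2 = a ^ 2 + 4 * (b * conj b) := by
    rw [Complex.mul_conj, Complex.normSq_eq_norm_sq]
    exact_mod_cast hs2
  refine ⟨(a + s) / 2, (a - s) / 2, fun μ => ?_⟩
  push_cast
  linear_combination (1 / 4 : ℂ) * hs3

/-- If `μ` is at distance at least `d` from every eigenvalue, the determinant of `μ - M(τ)` is at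
least `d²` in modulus, so the pointwise inverses form a bounded continuous function. Conversely each
pointwise eigenvalue lies in the spectrum, which is closed. -/
theorem spectrum_mulOp_hermitianPair {a : ℝ → ℝ} {b : ℝ → ℂ} (ha : Continuous a)
    (hb : Continuous b)
    (hM : Continuous fun τ => (!![(a τ : ℂ), b τ; conj (b τ), 0] : Matrix (Fin 2) (Fin 2) ℂ))
    (hbd : ∃ C : ℝ, ∀ τ i j, ‖(!![(a τ : ℂ), b τ; conj (b τ), 0] :
      Matrix (Fin 2) (Fin 2) ℂ) i j‖ ≤ C) :
    spectrum ℂ (mulOp (bcfMatrix _ hM hbd)) =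
      closure {μ : ℂ | ∃ τ : ℝ, Module.End.HasEigenvalue
        (Matrix.toLin' (!![(a τ : ℂ), b τ; conj (b τ), 0] : Matrix (Fin 2) (Fin 2) ℂ)) μ} := by
  set S := {μ : ℂ | ∃ τ : ℝ, Module.End.HasEigenvalue
        (Matrix.toLin' (!![(a τ : ℂ), b τ; conj (b τ), 0] : Matrix (Fin 2) (Fin 2) ℂ)) μ} with hS
  apply Subset.antisymm
  · refine (spectrum_mulOp_subset _).trans fun μ hμ => ?_
    by_contra hcl
    apply hμ
    rw [spectrum.mem_resolventSet_iff]
    have hopen : (closure S)ᶜ ∈ 𝓝 μ := isClosed_closure.isOpen_compl.mem_nhds hcl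
    obtain ⟨d, hd, hball⟩ := Metric.mem_nhds_iff.1 hopen
    set D : ℝ → ℂ := fun τ => μ ^ 2 - a τ * μ - b τ * conj (b τ) with hD
    have hDlow : ∀ τ, d ^ 2 ≤ ‖D τ‖ := fun τ => by
      obtain ⟨p, q, hpq⟩ := exists_roots_hermitianPair (a τ) (b τ)
      have key : ∀ r : ℝ, (r : ℂ) ^ 2 - a τ * r - b τ * conj (b τ) = 0 → d ≤ ‖μ - r‖ := by
        intro r hr
        by_contra! hlt
        refine hball (a := (r : ℂ)) ?_ (subset_closure
          ⟨τ, (hasEigenvalue_hermitianPair_iff _ _ _).2 hr⟩)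
        rwa [Metric.mem_ball', dist_eq_norm]
      have h1 := key p (by rw [hpq]; simp)
      have h2 := key q (by rw [hpq]; simp)
      rw [hD]
      simp only [hpq, norm_mul]
      nlinarith
    have hD0 : ∀ τ, D τ ≠ 0 := fun τ h => by
      have := hDlow τ
      rw [h, norm_zero] at this
      nlinarith
    have hDc : Continuous D := by fun_prop
    -- The adjugate of `μ - M(τ)` divided by its determinant.
    set N : ℝ → Matrix (Fin 2) (Fin 2) ℂ :=
      fun τ => (D τ)⁻¹ • !![μ, b τ; conj (b τ), μ - a τ] with hN
    have hNc : Continuous N := by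
      refine (hDc.inv₀ hD0).smul (continuous_matrix fun i j => ?_)
      fin_cases i <;> fin_cases j <;> simp <;> fun_prop
    obtain ⟨C, hC⟩ := hbd
    have hNb : ∃ C : ℝ, ∀ τ i j, ‖N τ i j‖ ≤ C := by
      refine ⟨(d ^ 2)⁻¹ * (‖μ‖ + C), fun τ i j => ?_⟩
      have h00 := hC τ 0 0
      have h01 := hC τ 0 1
      have h10 := hC τ 1 0
      simp at h00 h01 h10
      have hC0 : 0 ≤ C := (abs_nonneg _).trans h00
      simp only [hN, Matrix.smul_apply, smul_eq_mul, norm_mul, norm_inv]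
      refine mul_le_mul (inv_anti₀ (by positivity) (hDlow τ)) ?_ (norm_nonneg _) (by positivity)
      fin_cases i <;> fin_cases j <;> simp
      · linarith
      · linarith [norm_nonneg μ]
      · linarith [norm_nonneg μ]
      · refine (norm_sub_le _ _).trans ?_
        simpa using h00
    have hmul : ∀ τ, (μ • (1 : Matrix (Fin 2) (Fin 2) ℂ) -
        !![(a τ : ℂ), b τ; conj (b τ), 0]) * N τ = 1 := fun τ => by
      have hd := hD0 τ
      have hDe : D τ = μ ^ 2 - a τ * μ - b τ * conj (b τ) := rfl
      rw [hN]
      simp only [Matrix.mul_smul]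
      rw [inv_smul_eq_iff₀ hd, hDe]
      ext i j
      fin_cases i <;> fin_cases j <;>
        simp [Matrix.mul_apply] <;> ring
    rw [Algebra.algebraMap_eq_smul_one, smul_one_sub_bcfMatrix hM ⟨C, hC⟩ μ
      (continuous_const.sub hM) ⟨‖μ‖ + C, fun τ i j => ?_⟩]
    · exact isUnit_bcfMatrix _ _ hNc hNb hmul
    · rw [Matrix.sub_apply]
      refine (norm_sub_le _ _).trans (add_le_add ?_ (hC τ i j))
      rw [Matrix.smul_apply, smul_eq_mul, Matrix.one_apply]
      split_ifs <;> simp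
  · refine closure_minimal ?_ (spectrum.isClosed _)
    rintro μ ⟨τ, hμ⟩
    obtain ⟨v, hv⟩ := hμ.exists_hasEigenvector
    refine mem_spectrum_mulOp _ (τ₀ := τ) (v := WithLp.toLp 2 v) ?_ ?_
    · intro h
      exact hv.2 (by simpa using h)
    · have := hv.apply_eq_smul
      rw [bcfMatrix_apply, Matrix.toEuclideanCLM_toLp]
      rw [Matrix.toLin'_apply] at this
      rw [this]
      rfl

/-! ### Logarithmic coordinates on the two half-lines -/

section LogCoordinates

/-- Logarithmic coordinates on the half-line through `c`. -/
noncomputable def logPull (c : ℝ) (u : ℝ → ℂ) (t : ℝ) : ℂ :=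
  u (c * Real.exp t) * (Real.exp (t / 2) : ℂ)

theorem hasDerivAt_const_mul_exp (c t : ℝ) :
    HasDerivAt (fun t => c * Real.exp t) (c * Real.exp t) t :=
  (Real.hasDerivAt_exp t).const_mul c

theorem injective_const_mul_exp {c : ℝ} (hc : c ≠ 0) :
    Function.Injective fun t => c * Real.exp t := fun _ _ h =>
  Real.exp_injective (mul_left_cancel₀ hc h)

theorem lintegral_image_const_mul_exp {c : ℝ} (hc : c ≠ 0) (g : ℝ → ℝ≥0∞) :
    ∫⁻ x in (fun t => c * Real.exp t) '' univ, g x =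
      ∫⁻ t, ENNReal.ofReal (|c| * Real.exp t) * g (c * Real.exp t) := by
  rw [lintegral_image_eq_lintegral_abs_deriv_mul MeasurableSet.univ
    (fun t _ => (hasDerivAt_const_mul_exp c t).hasDerivWithinAt)
    (injective_const_mul_exp hc).injOn]
  simp [abs_mul]

theorem image_one_mul_exp : (fun t => (1 : ℝ) * Real.exp t) '' univ = Ioi 0 := by
  simp [Real.range_exp]

theorem image_neg_one_mul_exp : (fun t => (-1 : ℝ) * Real.exp t) '' univ = Iio 0 := by
  ext x
  simp only [image_univ, mem_range, mem_Iio]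
  constructor
  · rintro ⟨t, rfl⟩
    have := Real.exp_pos t
    linarith
  · intro hx
    exact ⟨Real.log (-x), by rw [Real.exp_log (by linarith)]; ring⟩

/-- The change of variables has a strictly positive Jacobian, so null sets pull back to null sets.
This makes `logPull` meaningful on almost-everywhere classes. -/
theorem quasiMeasurePreserving_const_mul_exp {c : ℝ} (hc : c ≠ 0) :
    Measure.QuasiMeasurePreserving (fun t => c * Real.exp t) volume volume := by
  refine ⟨by fun_prop, Measure.AbsolutelyContinuous.mk fun N hN h0 => ?_⟩
  have hm : Measurable fun t => c * Real.exp t := by fun_prop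
  have h1 := lintegral_image_const_mul_exp hc (N.indicator 1)
  have h2 : ∫⁻ x in (fun t => c * Real.exp t) '' univ, N.indicator (1 : ℝ → ℝ≥0∞) x = 0 := by
    rw [lintegral_indicator_one hN]
    exact Measure.absolutelyContinuous_of_le Measure.restrict_le_self h0
  rw [h2] at h1
  have h3 := (lintegral_eq_zero_iff (by
    have : Measurable (N.indicator (1 : ℝ → ℝ≥0∞)) := measurable_one.indicator hN
    fun_prop)).1 h1.symm
  rw [Measure.map_apply hm hN, measure_eq_zero_iff_ae_notMem]
  filter_upwards [h3] with t ht hN'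
  have hN'' : c * Real.exp t ∈ N := hN'
  simp [hN''] at ht
  exact absurd ht (not_or.2 ⟨hc, (Real.exp_pos t).not_ge⟩)

theorem logPull_congr_ae {c : ℝ} (hc : c ≠ 0) {u v : ℝ → ℂ} (h : u =ᵐ[volume] v) :
    logPull c u =ᵐ[volume] logPull c v := by
  filter_upwards [(quasiMeasurePreserving_const_mul_exp hc).ae h] with t ht
  simp only [logPull, ht]

theorem measurable_logPull (c : ℝ) {u : ℝ → ℂ} (h : Measurable u) : Measurable (logPull c u) := by
  unfold logPull
  fun_prop

/-- The weight `e^{t/2}` is the square root of the Jacobian. -/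
theorem lintegral_sq_logPull {c : ℝ} (hc : |c| = 1) (u : ℝ → ℂ) :
    ∫⁻ t, ‖logPull c u t‖ₑ ^ 2 =
      ∫⁻ x in (fun t => c * Real.exp t) '' univ, ‖u x‖ₑ ^ 2 := by
  rw [lintegral_image_const_mul_exp (by rintro rfl; simp at hc)]
  refine lintegral_congr fun t => ?_
  rw [hc, one_mul, logPull, enorm_mul, mul_pow, mul_comm]
  congr 1
  rw [← ofReal_norm, Complex.norm_real, Real.norm_of_nonneg (Real.exp_pos _).le,
    ← ENNReal.ofReal_pow (Real.exp_pos _).le, ← Real.exp_nat_mul]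
  congr 2
  push_cast
  ring

theorem lintegral_sq_logPull_add (u : ℝ → ℂ) :
    (∫⁻ t, ‖logPull 1 u t‖ₑ ^ 2) + ∫⁻ t, ‖logPull (-1) u t‖ₑ ^ 2 = ∫⁻ x, ‖u x‖ₑ ^ 2 := by
  rw [lintegral_sq_logPull (by simp), lintegral_sq_logPull (by simp), image_one_mul_exp,
    image_neg_one_mul_exp, ← lintegral_add_compl (fun x => ‖u x‖ₑ ^ 2) measurableSet_Ioi (μ := volume)
      (A := Ioi (0 : ℝ)), compl_Ioi, setLIntegral_congr Iio_ae_eq_Iic]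

/-- The pair of logarithmic coordinates on the two half-lines. -/
noncomputable def logPair (u : ℝ → ℂ) (t : ℝ) : EuclideanSpace ℂ (Fin 2) :=
  !₂[logPull 1 u t, logPull (-1) u t]

theorem enorm_sq_euclidean_pair (x : EuclideanSpace ℂ (Fin 2)) :
    ‖x‖ₑ ^ 2 = ‖x 0‖ₑ ^ 2 + ‖x 1‖ₑ ^ 2 := by
  simp only [← ofReal_norm]
  rw [← ENNReal.ofReal_pow (norm_nonneg _), ← ENNReal.ofReal_pow (norm_nonneg _),
    ← ENNReal.ofReal_pow (norm_nonneg _), ← ENNReal.ofReal_add (by positivity) (by positivity),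
    EuclideanSpace.norm_sq_eq, Fin.sum_univ_two]

theorem measurable_logPair {u : ℝ → ℂ} (hu : Measurable u) : Measurable (logPair u) := by
  refine (WithLp.measurable_toLp 2 (Fin 2 → ℂ)).comp (measurable_pi_iff.2 fun i => ?_)
  fin_cases i
  · exact measurable_logPull 1 hu
  · exact measurable_logPull (-1) hu

theorem logPair_congr_ae {u v : ℝ → ℂ} (h : u =ᵐ[volume] v) :
    logPair u =ᵐ[volume] logPair v := by
  filter_upwards [logPull_congr_ae one_ne_zero h,
    logPull_congr_ae (neg_ne_zero.2 one_ne_zero) h] with t h1 h2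
  rw [logPair, logPair, h1, h2]

theorem lintegral_sq_logPair {u : ℝ → ℂ} (hu : Measurable u) :
    ∫⁻ t, ‖logPair u t‖ₑ ^ 2 = ∫⁻ x, ‖u x‖ₑ ^ 2 := by
  rw [← lintegral_sq_logPull_add u, ← lintegral_add_left
    ((measurable_logPull 1 hu).enorm.pow_const 2)]
  exact lintegral_congr fun t => enorm_sq_euclidean_pair _

theorem eLpNorm_two_sq {F : Type*} [NormedAddCommGroup F] (f : ℝ → F) :
    eLpNorm f 2 volume ^ 2 = ∫⁻ x, ‖f x‖ₑ ^ 2 := by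
  have := eLpNorm_nnreal_pow_eq_lintegral (f := f) (p := 2) (μ := volume) (by norm_num)
  rw [← ENNReal.rpow_natCast]
  simpa using this

theorem eLpNorm_logPair {u : ℝ → ℂ} (hu : Measurable u) :
    eLpNorm (logPair u) 2 volume = eLpNorm u 2 volume := by
  have h := lintegral_sq_logPair hu
  rw [← eLpNorm_two_sq, ← eLpNorm_two_sq] at h
  exact (ENNReal.pow_right_strictMono two_ne_zero).injective h

theorem memLp_logPair (u : L2Line) : MemLp (logPair u) 2 volume :=
  have hu : Measurable u := (Lp.stronglyMeasurable u).measurable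
  ⟨(measurable_logPair hu).aestronglyMeasurable, by rw [eLpNorm_logPair hu]; exact Lp.eLpNorm_lt_top u⟩

/-- Passage to logarithmic coordinates as a linear isometry. -/
noncomputable def logIsometry : L2Line →ₗᵢ[ℂ] L2Pair where
  toFun u := (memLp_logPair u).toLp _
  map_add' u v := by
    ext1
    filter_upwards [MemLp.coeFn_toLp (memLp_logPair (u + v)), MemLp.coeFn_toLp (memLp_logPair u),
      MemLp.coeFn_toLp (memLp_logPair v), logPair_congr_ae (Lp.coeFn_add u v),
      Lp.coeFn_add ((memLp_logPair u).toLp _) ((memLp_logPair v).toLp _)] with t h1 h2 h3 h4 h5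
    rw [h1, h4, h5, Pi.add_apply, h2, h3]
    ext i
    fin_cases i <;> simp [logPair, logPull, add_mul]
  map_smul' c u := by
    ext1
    filter_upwards [MemLp.coeFn_toLp (memLp_logPair (c • u)), MemLp.coeFn_toLp (memLp_logPair u),
      logPair_congr_ae (Lp.coeFn_smul c u),
      Lp.coeFn_smul c ((memLp_logPair u).toLp _)] with t h1 h2 h4 h5
    rw [h1, h4, RingHom.id_apply, h5, Pi.smul_apply, h2]
    ext i
    fin_cases i <;> simp [logPair, logPull, mul_assoc]
  norm_map' u := by
    change ‖(memLp_logPair u).toLp _‖ = _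
    rw [Lp.norm_toLp, eLpNorm_logPair (Lp.stronglyMeasurable u).measurable]
    rfl

theorem logIsometry_ae (u : L2Line) : logIsometry u =ᵐ[volume] logPair u :=
  MemLp.coeFn_toLp (memLp_logPair u)

theorem logIsometry_toLp {u : ℝ → ℂ} (hu : MemLp u 2 volume) :
    logIsometry (hu.toLp u) =ᵐ[volume] logPair u :=
  (logIsometry_ae _).trans (logPair_congr_ae hu.coeFn_toLp)

theorem logIsometry_surjective : Function.Surjective logIsometry := by
  intro Φ
  have hΦm : Measurable Φ := (Lp.stronglyMeasurable Φ).measurable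
  have hΦi : ∀ i, Measurable fun t => Φ t i := fun i =>
    (EuclideanSpace.proj (𝕜 := ℂ) i).continuous.measurable.comp hΦm
  -- The explicit inverse `Φ(log|x|) |x|^{-1/2}`. The point `0` falls into the second branch, which
  -- is harmless because only the values at `±e^t` matter.
  set u : ℝ → ℂ := fun x => if 0 < x then Φ (Real.log x) 0 * (Real.exp (-(Real.log x / 2)) : ℂ)
    else Φ (Real.log (-x)) 1 * (Real.exp (-(Real.log (-x) / 2)) : ℂ) with hu
  have hum : Measurable u := by
    refine Measurable.ite measurableSet_Ioi ?_ ?_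
    · exact ((hΦi 0).comp Real.measurable_log).mul (by fun_prop)
    · exact ((hΦi 1).comp (by fun_prop)).mul (by fun_prop)
  have hpair : logPair u = Φ := by
    funext t
    ext i
    have hexp : (Real.exp (-(t / 2)) : ℂ) * (Real.exp (t / 2) : ℂ) = 1 := by
      rw [← Complex.ofReal_mul, ← Real.exp_add]; simp
    have hneg : ¬ 0 < -Real.exp t := by have := Real.exp_pos t; linarith
    fin_cases i
    · simp only [logPair, logPull, hu, one_mul, Real.exp_pos, if_true, Real.log_exp]
      simp only [Fin.zero_eta, Matrix.cons_val_zero]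
      rw [mul_assoc, hexp, mul_one]
    · simp only [logPair, logPull, hu, neg_one_mul, if_neg hneg, neg_neg, Real.log_exp]
      simp only [Fin.mk_one, Matrix.cons_val_one, Matrix.cons_val_fin_one]
      rw [mul_assoc, hexp, mul_one]
  have humem : MemLp u 2 volume := ⟨hum.aestronglyMeasurable, by
    rw [← eLpNorm_logPair hum, hpair]; exact Lp.eLpNorm_lt_top Φ⟩
  refine ⟨humem.toLp u, ?_⟩
  ext1
  exact (logIsometry_toLp humem).trans (by rw [hpair])

/-- Passage to logarithmic coordinates as a unitary isomorphism. -/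
noncomputable def logUnitary : L2Line ≃ₗᵢ[ℂ] L2Pair :=
  LinearIsometryEquiv.ofSurjective logIsometry logIsometry_surjective

theorem isLogCoordinates_logUnitary : IsLogCoordinates logUnitary := by
  intro u
  filter_upwards [logIsometry_ae u] with t ht
  change logIsometry u t = _
  rw [ht]
  simp [logPair, logPull]

end LogCoordinates

/-! ### The `L²` Fourier transform on `L¹ ∩ L²` -/

section FourierLp

open FourierTransform

/-- On `L¹ ∩ L²` the Fourier transform of `L²` is the Fourier integral. -/
theorem fourierTransform_toLp_ae {F : Type*} [NormedAddCommGroup F] [InnerProductSpace ℂ F]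
    [CompleteSpace F] {f : ℝ → F} (h1 : Integrable f) (h2 : MemLp f 2 volume) :
    (Lp.fourierTransformₗᵢ ℝ F (h2.toLp f) : ℝ → F) =ᵐ[volume] 𝓕 f := by
  set g : Lp F 2 (volume : Measure ℝ) := Lp.fourierTransformₗᵢ ℝ F (h2.toLp f) with hg
  have hcont : Continuous (𝓕 f) :=
    VectorFourier.fourierIntegral_continuous Real.continuous_fourierChar
      (by fun_prop) h1
  -- Both functions are tested against smooth compactly supported functions. On the `L²` side the
  -- transform is the distributional one; on the other side the multiplication formula moves the
  -- transform onto the test function.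
  refine ae_eq_of_integral_contDiff_smul_eq ?_ hcont.locallyIntegrable ?_
  · exact (Lp.memLp g).locallyIntegrable one_le_two
  intro φ hφ hφs
  set ψ : 𝓢(ℝ, ℂ) := HasCompactSupport.toSchwartzMap (f := fun x => (φ x : ℂ))
    (hφs.comp_left Complex.ofReal_zero) (Complex.ofRealCLM.contDiff.comp hφ) with hψ
  have e := congrArg (fun T : 𝓢'(ℝ, F) => T ψ) (Lp.fourier_toTemperedDistribution_eq (h2.toLp f))
  simp only [TemperedDistribution.fourier_apply, Lp.toTemperedDistribution_apply] at e
  have e1 : ∫ x, φ x • g x = ∫ x, ψ x • g x := by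
    refine integral_congr_ae (ae_of_all _ fun x => ?_)
    change φ x • g x = (φ x : ℂ) • g x
    simp
  have e2 : ∫ x, φ x • 𝓕 f x = ∫ x, ψ x • 𝓕 f x := by
    refine integral_congr_ae (ae_of_all _ fun x => ?_)
    change φ x • 𝓕 f x = (φ x : ℂ) • 𝓕 f x
    simp
  rw [e1, e2]
  refine e.symm.trans ?_
  have e3 := VectorFourier.integral_fourierIntegral_smul_eq_flip (𝕜 := ℝ) (L := innerₗ ℝ)
    (μ := volume) (ν := volume) (e := Real.fourierChar) (f := ψ) (g := f)
    Real.continuous_fourierChar (by fun_prop) ψ.integrable h1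
  have e4 : (innerₗ ℝ : ℝ →ₗ[ℝ] ℝ →ₗ[ℝ] ℝ).flip = innerₗ ℝ := flip_innerₗ ℝ
  rw [e4] at e3
  refine Eq.trans ?_ e3
  refine integral_congr_ae ?_
  filter_upwards [h2.coeFn_toLp] with x hx
  rw [hx]
  rfl

end FourierLp

/-! ### The Riemann–Lebesgue lemma on a half-line -/

section RiemannLebesgue

/-- For `f` not integrable on the half-line every integral here is `0` by convention, so the limit
holds for all `f`. -/
theorem tendsto_integral_Ioi_exp_mul_I_mul (f : ℝ → ℂ) :
    Tendsto (fun R : ℝ => ∫ t in Ioi (0 : ℝ), Complex.exp (2 * Real.pi * t * R * Complex.I) * f t)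
      (cocompact ℝ) (𝓝 0) := by
  have h := Real.tendsto_integral_exp_smul_cocompact ((Ioi (0 : ℝ)).indicator f)
  have h2 : Tendsto (fun R : ℝ => -R) (cocompact ℝ) (cocompact ℝ) :=
    (Homeomorph.neg ℝ).isClosedEmbedding.tendsto_cocompact
  refine (h.comp h2).congr fun R => ?_
  rw [← integral_indicator measurableSet_Ioi]
  refine integral_congr_ae (ae_of_all _ fun t => ?_)
  by_cases ht : t ∈ Ioi (0 : ℝ)
  · simp only [ht, indicator_of_mem, Circle.smul_def, Real.fourierChar_apply, smul_eq_mul]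
    congr 2
    push_cast
    ring
  · simp [ht]

theorem tendsto_integral_Ioi_cos_mul {f : ℝ → ℂ} (hf : IntegrableOn f (Ioi 0)) :
    Tendsto (fun R : ℝ => ∫ t in Ioi (0 : ℝ), (Real.cos (2 * Real.pi * t * R) : ℂ) * f t)
      atTop (𝓝 0) := by
  have h1 := (tendsto_integral_Ioi_exp_mul_I_mul f).mono_left atTop_le_cocompact
  have h2 := ((tendsto_integral_Ioi_exp_mul_I_mul f).mono_left atBot_le_cocompact).comp
    tendsto_neg_atTop_atBot
  have h3 := (h1.add h2).const_mul (1 / 2 : ℂ)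
  rw [add_zero, mul_zero] at h3
  refine h3.congr fun R => ?_
  have hi : ∀ R : ℝ, IntegrableOn
      (fun t : ℝ => Complex.exp (2 * Real.pi * t * R * Complex.I) * f t) (Ioi 0) := fun R => by
    refine hf.bdd_mul (c := 1) (by fun_prop) (ae_of_all _ fun t => ?_)
    have : (2 * Real.pi * t * R * Complex.I : ℂ) = ((2 * Real.pi * t * R : ℝ) : ℂ) * Complex.I := by
      push_cast; ring
    rw [this, Complex.norm_exp_ofReal_mul_I]
  rw [Function.comp_apply, ← integral_add (hi R) (hi (-R)), ← integral_const_mul]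
  refine integral_congr_ae (ae_of_all _ fun t => ?_)
  simp only [Complex.ofReal_cos, Complex.cos]
  push_cast
  ring_nf

theorem tendsto_integral_Ioi_sin_mul {f : ℝ → ℂ} (hf : IntegrableOn f (Ioi 0)) :
    Tendsto (fun R : ℝ => ∫ t in Ioi (0 : ℝ), (Real.sin (2 * Real.pi * t * R) : ℂ) * f t)
      atTop (𝓝 0) := by
  have h1 := (tendsto_integral_Ioi_exp_mul_I_mul f).mono_left atTop_le_cocompact
  have h2 := ((tendsto_integral_Ioi_exp_mul_I_mul f).mono_left atBot_le_cocompact).comp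
    tendsto_neg_atTop_atBot
  have h3 := (h2.sub h1).const_mul (Complex.I / 2 : ℂ)
  rw [sub_zero, mul_zero] at h3
  refine h3.congr fun R => ?_
  have hi : ∀ R : ℝ, IntegrableOn
      (fun t : ℝ => Complex.exp (2 * Real.pi * t * R * Complex.I) * f t) (Ioi 0) := fun R => by
    refine hf.bdd_mul (c := 1) (by fun_prop) (ae_of_all _ fun t => ?_)
    have : (2 * Real.pi * t * R * Complex.I : ℂ) = ((2 * Real.pi * t * R : ℝ) : ℂ) * Complex.I := by
      push_cast; ring
    rw [this, Complex.norm_exp_ofReal_mul_I]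
  rw [Function.comp_apply, ← integral_sub (hi (-R)) (hi R), ← integral_const_mul]
  refine integral_congr_ae (ae_of_all _ fun t => ?_)
  simp only [Complex.ofReal_sin, Complex.sin]
  push_cast
  ring_nf

end RiemannLebesgue

/-! ### Exponential bounds for hyperbolic kernels -/

section HyperbolicBounds

theorem one_div_cosh_half_le (t : ℝ) : 1 / Real.cosh (t / 2) ≤ 2 * Real.exp (-t / 2) := by
  rw [div_le_iff₀ (Real.cosh_pos _), Real.cosh_eq]
  have h1 : Real.exp (-t / 2) * Real.exp (t / 2) = 1 := by rw [← Real.exp_add]; simp; ring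
  have h2 := Real.exp_pos (-t / 2)
  have h3 := Real.exp_pos (-(t / 2))
  nlinarith [mul_pos h2 h3]

/-- Together with `two_exp_div_le_one_div_sinh_half` this puts `1 / sinh(t/2)` within `2 e^{-t/2}`
of the model `2 e^{-t/2} / t`, which carries the whole singularity at `0` and has an explicit sine
transform. -/
theorem one_div_sinh_half_le {t : ℝ} (ht : 0 < t) :
    1 / Real.sinh (t / 2) ≤ 2 * Real.exp (-t / 2) / t + 2 * Real.exp (-t / 2) := by
  have hs : 0 < Real.sinh (t / 2) := Real.sinh_pos_iff.2 (by linarith)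
  rw [div_le_iff₀ hs]
  have h1 : Real.exp (-t / 2) * Real.exp (t / 2) = 1 := by rw [← Real.exp_add]; simp; ring
  have h2 : Real.exp (-t / 2) * Real.exp (-(t / 2)) = Real.exp (-t) := by
    rw [← Real.exp_add]; ring_nf
  have h3 : Real.exp (-t) * (1 + t) ≤ 1 := by
    have := Real.add_one_le_exp t
    calc Real.exp (-t) * (1 + t) ≤ Real.exp (-t) * Real.exp t := by gcongr; linarith
      _ = 1 := by rw [← Real.exp_add]; simp
  have h4 : (2 * Real.exp (-t / 2) / t + 2 * Real.exp (-t / 2)) * Real.sinh (t / 2) =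
      (1 - Real.exp (-t)) * (1 + t) / t := by
    have h5 : Real.exp (-t / 2) * (Real.exp (t / 2) - Real.exp (-(t / 2))) = 1 - Real.exp (-t) := by
      rw [mul_sub, h1, h2]
    rw [Real.sinh_eq, ← h5]
    field_simp
  rw [h4, le_div_iff₀ ht]
  nlinarith

theorem two_exp_div_le_one_div_sinh_half {t : ℝ} (ht : 0 < t) :
    2 * Real.exp (-t / 2) / t ≤ 1 / Real.sinh (t / 2) := by
  have hs : 0 < Real.sinh (t / 2) := Real.sinh_pos_iff.2 (by linarith)
  rw [div_le_div_iff₀ ht hs]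
  have h1 : Real.exp (-t / 2) * Real.exp (t / 2) = 1 := by rw [← Real.exp_add]; simp; ring
  have h2 : Real.exp (-t / 2) * Real.exp (-(t / 2)) = Real.exp (-t) := by
    rw [← Real.exp_add]; ring_nf
  have h3 := Real.add_one_le_exp (-t)
  rw [Real.sinh_eq]
  nlinarith

theorem div_sinh_half_le {t : ℝ} (ht : 0 < t) :
    t / Real.sinh (t / 2) ≤ 2 * (1 + t) * Real.exp (-t / 2) := by
  have h := mul_le_mul_of_nonneg_left (one_div_sinh_half_le ht) ht.le
  calc t / Real.sinh (t / 2) = t * (1 / Real.sinh (t / 2)) := by ring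
    _ ≤ _ := h
    _ = _ := by field_simp

theorem integrableOn_exp_neg_half : IntegrableOn (fun t : ℝ => Real.exp (-t / 2)) (Ioi 0) := by
  have := integrableOn_exp_mul_Ioi (a := -1 / 2) (by norm_num) 0
  refine this.congr_fun (fun t _ => ?_) measurableSet_Ioi
  simp only
  ring_nf

theorem one_add_mul_exp_neg_half_le (t : ℝ) :
    (1 + t) * Real.exp (-t / 2) ≤ 4 * Real.exp (-t / 4) := by
  have h1 := Real.add_one_le_exp (t / 4)
  have h2 : Real.exp (-t / 2) = Real.exp (-t / 4) * Real.exp (-t / 4) := by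
    rw [← Real.exp_add]; ring_nf
  have h3 : Real.exp (t / 4) * Real.exp (-t / 4) = 1 := by
    rw [← Real.exp_add]; simp; ring
  have h4 := Real.exp_pos (-t / 4)
  by_cases ht : 0 ≤ t
  · calc (1 + t) * Real.exp (-t / 2) ≤ (4 * Real.exp (t / 4)) * Real.exp (-t / 2) := by
          gcongr; linarith
      _ = 4 * (Real.exp (t / 4) * Real.exp (-t / 4)) * Real.exp (-t / 4) := by rw [h2]; ring
      _ = _ := by rw [h3]; ring
  · push Not at ht
    calc (1 + t) * Real.exp (-t / 2) ≤ (4 * Real.exp (t / 4)) * Real.exp (-t / 2) := by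
          gcongr; linarith
      _ = 4 * (Real.exp (t / 4) * Real.exp (-t / 4)) * Real.exp (-t / 4) := by rw [h2]; ring
      _ = _ := by rw [h3]; ring

theorem integrableOn_exp_neg_quarter : IntegrableOn (fun t : ℝ => Real.exp (-t / 4)) (Ioi 0) := by
  have := integrableOn_exp_mul_Ioi (a := -1 / 4) (by norm_num) 0
  refine this.congr_fun (fun t _ => ?_) measurableSet_Ioi
  simp only
  ring_nf

theorem integrableOn_div_sinh_half :
    IntegrableOn (fun t : ℝ => t / Real.sinh (t / 2)) (Ioi 0) := by
  refine Integrable.mono' (integrableOn_exp_neg_quarter.const_mul 8)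
    (by
      have : Measurable fun t : ℝ => t / Real.sinh (t / 2) := by fun_prop
      exact this.aestronglyMeasurable) ?_
  filter_upwards [ae_restrict_mem measurableSet_Ioi] with t ht
  have hs : 0 < Real.sinh (t / 2) := Real.sinh_pos_iff.2 (half_pos ht)
  rw [Real.norm_of_nonneg (div_nonneg (le_of_lt ht) hs.le)]
  refine (div_sinh_half_le ht).trans ?_
  have := one_add_mul_exp_neg_half_le t
  linarith

theorem integrableOn_one_div_cosh_half :
    IntegrableOn (fun t : ℝ => 1 / Real.cosh (t / 2)) (Ioi 0) := by
  refine Integrable.mono' (integrableOn_exp_neg_half.const_mul 2)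
    (by
      have : Measurable fun t : ℝ => 1 / Real.cosh (t / 2) := by fun_prop
      exact this.aestronglyMeasurable) ?_
  filter_upwards [] with t
  rw [Real.norm_of_nonneg (by positivity)]
  exact one_div_cosh_half_le t

end HyperbolicBounds

/-! ### The diagonal coefficient: boundedness, limit at infinity and derivative -/

section DiagonalCoefficient

/-- The integral `∫₀^∞ sin(a t) e^{-t/2} / t dt`. -/
theorem hasDerivAt_integral_sin_mul_exp_div (a : ℝ) :
    HasDerivAt (fun a : ℝ => ∫ t in Ioi (0 : ℝ), Real.sin (a * t) * (Real.exp (-t / 2) / t))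
      (∫ t in Ioi (0 : ℝ), Real.cos (a * t) * Real.exp (-t / 2)) a := by
  have hm : ∀ a : ℝ, AEStronglyMeasurable
      (fun t : ℝ => Real.sin (a * t) * (Real.exp (-t / 2) / t)) (volume.restrict (Ioi 0)) :=
    fun a => by
      have : Measurable fun t : ℝ => Real.sin (a * t) * (Real.exp (-t / 2) / t) := by fun_prop
      exact this.aestronglyMeasurable
  refine (hasDerivAt_integral_of_dominated_loc_of_deriv_le (s := univ) univ_mem
    (Eventually.of_forall hm) ?_ ?_ (bound := fun t => Real.exp (-t / 2)) (x₀ := a)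
    (F' := fun a t => Real.cos (a * t) * Real.exp (-t / 2)) ?_
    integrableOn_exp_neg_half ?_).2
  · refine Integrable.mono' (integrableOn_exp_neg_half.const_mul |a|) (hm a) ?_
    filter_upwards [ae_restrict_mem measurableSet_Ioi] with t ht
    have ht' : (0 : ℝ) < t := ht
    rw [norm_mul, Real.norm_eq_abs, Real.norm_of_nonneg (by positivity)]
    calc |Real.sin (a * t)| * (Real.exp (-t / 2) / t) ≤ |a * t| * (Real.exp (-t / 2) / t) := by
          exact mul_le_mul_of_nonneg_right Real.abs_sin_le_abs (by positivity)
      _ = |a| * Real.exp (-t / 2) := by rw [abs_mul, abs_of_pos ht']; field_simp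
  · have : Measurable fun t : ℝ => Real.cos (a * t) * Real.exp (-t / 2) := by fun_prop
    exact this.aestronglyMeasurable
  · refine ae_of_all _ fun t x _ => ?_
    rw [norm_mul, Real.norm_eq_abs, Real.norm_of_nonneg (by positivity)]
    exact mul_le_of_le_one_left (Real.exp_pos _).le (Real.abs_cos_le_one _)
  · filter_upwards [ae_restrict_mem measurableSet_Ioi] with t ht x _
    have ht' : t ≠ 0 := (ne_of_gt ht)
    have h := (((hasDerivAt_id x).mul_const t).sin).mul_const (Real.exp (-t / 2) / t)
    convert! h using 1
    simp only [id_eq, one_mul]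
    field_simp

theorem integral_cos_mul_exp_neg_half (a : ℝ) :
    ∫ t in Ioi (0 : ℝ), Real.cos (a * t) * Real.exp (-t / 2) = 2 / (1 + (2 * a) ^ 2) := by
  have hre : ((-1 / 2 : ℂ) + a * Complex.I).re < 0 := by
    simp [Complex.add_re]
    norm_num
  have h := integral_exp_mul_complex_Ioi hre 0
  have h2 := congrArg Complex.re h
  rw [← RCLike.re_eq_complex_re, ← integral_re (integrableOn_exp_mul_complex_Ioi hre 0)] at h2
  have e1 : ∀ t : ℝ, RCLike.re (Complex.exp (((-1 / 2 : ℂ) + a * Complex.I) * t)) =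
      Real.cos (a * t) * Real.exp (-t / 2) := fun t => by
    rw [RCLike.re_eq_complex_re, Complex.exp_re]
    have r1 : (((-1 / 2 : ℂ) + a * Complex.I) * t).re = -t / 2 := by
      have : ((-1 / 2 : ℂ) + a * Complex.I) * t = ((-t / 2 : ℝ) : ℂ) + ((a * t : ℝ) : ℂ) * Complex.I := by
        push_cast; ring
      rw [this]; simp
    have r2 : (((-1 / 2 : ℂ) + a * Complex.I) * t).im = a * t := by
      have : ((-1 / 2 : ℂ) + a * Complex.I) * t = ((-t / 2 : ℝ) : ℂ) + ((a * t : ℝ) : ℂ) * Complex.I := by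
        push_cast; ring
      rw [this]; simp
    rw [r1, r2, mul_comm]
  simp_rw [e1] at h2
  rw [h2]
  have e2 : -Complex.exp (((-1 / 2 : ℂ) + a * Complex.I) * (0 : ℝ)) / ((-1 / 2 : ℂ) + a * Complex.I)
      = ((2 / (1 + (2 * a) ^ 2) : ℝ) : ℂ) + ((4 * a / (1 + (2 * a) ^ 2) : ℝ) : ℂ) * Complex.I := by
    have hne : ((-1 / 2 : ℂ) + a * Complex.I) ≠ 0 := fun h0 => by rw [h0] at hre; simp at hre
    have hne2 : (1 + (2 * (a : ℂ)) ^ 2) ≠ 0 := by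
      have : (0 : ℝ) < 1 + (2 * a) ^ 2 := by positivity
      exact_mod_cast this.ne'
    have hI : (-1 / 2 + (a : ℂ) * Complex.I) * (2 + 4 * a * Complex.I) = -(1 + (2 * (a : ℂ)) ^ 2) := by
      ring_nf
      rw [Complex.I_sq]
      ring
    rw [Complex.ofReal_zero, mul_zero, Complex.exp_zero, div_eq_iff hne]
    push_cast
    have hI2 : (2 / (1 + (2 * (a : ℂ)) ^ 2) + 4 * a / (1 + (2 * (a : ℂ)) ^ 2) * Complex.I) *
        (-1 / 2 + a * Complex.I) =
        (-1 / 2 + (a : ℂ) * Complex.I) * (2 + 4 * a * Complex.I) / (1 + (2 * (a : ℂ)) ^ 2) := by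
      ring
    rw [hI2, hI, neg_div, div_self hne2]
  rw [e2]
  simp [-Complex.ofReal_div, -Complex.ofReal_mul]

/-- Both sides vanish at `a = 0` and have the same derivative in `a`. -/
theorem integral_sin_mul_exp_div (a : ℝ) :
    ∫ t in Ioi (0 : ℝ), Real.sin (a * t) * (Real.exp (-t / 2) / t) = Real.arctan (2 * a) := by
  have h : ∀ x : ℝ, HasDerivAt (fun a : ℝ =>
      (∫ t in Ioi (0 : ℝ), Real.sin (a * t) * (Real.exp (-t / 2) / t)) - Real.arctan (2 * a)) 0 x := by
    intro x
    have h1 := hasDerivAt_integral_sin_mul_exp_div x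
    rw [integral_cos_mul_exp_neg_half] at h1
    have h2 := ((hasDerivAt_id x).const_mul 2).arctan
    convert! h1.sub h2 using 1
    simp
    ring
  have h3 := is_const_of_deriv_eq_zero (fun x => (h x).differentiableAt) (fun x => (h x).deriv) a 0
  simp at h3
  linarith

/-- The phase of the diagonal kernel. -/
noncomputable def diagPhase (σ t : ℝ) : ℝ := 4 * Real.pi * σ * Real.tanh (t / 2)

theorem measurable_diagPhase (σ : ℝ) : Measurable (diagPhase σ) := by
  have : diagPhase σ = fun t => 4 * Real.pi * σ * (Real.sinh (t / 2) / Real.cosh (t / 2)) := by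
    funext t; rw [diagPhase, Real.tanh_eq_sinh_div_cosh]
  rw [this]
  fun_prop

theorem abs_diagPhase_div_sinh {σ t : ℝ} (ht : 0 < t) :
    |diagPhase σ t| / Real.sinh (t / 2) = 4 * Real.pi * |σ| * (1 / Real.cosh (t / 2)) := by
  have hs : 0 < Real.sinh (t / 2) := Real.sinh_pos_iff.2 (by linarith)
  have hc := Real.cosh_pos (t / 2)
  rw [diagPhase, Real.tanh_eq_sinh_div_cosh, abs_mul, abs_mul, abs_of_pos (by positivity : (0:ℝ) < 4 * Real.pi),
    abs_of_pos (div_pos hs hc)]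
  field_simp

/-- The sine integral in the diagonal coefficient. -/
noncomputable def diagIntegral (σ τ : ℝ) : ℝ :=
  ∫ t in Ioi (0 : ℝ), Real.sin (2 * Real.pi * t * τ - diagPhase σ t) / Real.sinh (t / 2)

theorem coeffDiag_eq (σ τ : ℝ) :
    coeffDiag σ τ = 1 / 2 + 1 / (2 * Real.pi) * diagIntegral σ τ := rfl

/-- The non-oscillating amplitudes of the integrable part of the diagonal kernel. -/
noncomputable def diagAmpSin (σ t : ℝ) : ℝ :=
  Real.cos (diagPhase σ t) / Real.sinh (t / 2) - 2 * Real.exp (-t / 2) / t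

/-- The amplitude of the cosine part of the diagonal kernel. -/
noncomputable def diagAmpCos (σ t : ℝ) : ℝ := Real.sin (diagPhase σ t) / Real.sinh (t / 2)

theorem integrableOn_diagAmpCos (σ : ℝ) : IntegrableOn (diagAmpCos σ) (Ioi 0) := by
  refine Integrable.mono' (integrableOn_one_div_cosh_half.const_mul (4 * Real.pi * |σ|)) ?_ ?_
  · have := measurable_diagPhase σ
    have : Measurable (diagAmpCos σ) := by unfold diagAmpCos; fun_prop
    exact this.aestronglyMeasurable
  · filter_upwards [ae_restrict_mem measurableSet_Ioi] with t ht
    have hs : 0 < Real.sinh (t / 2) := Real.sinh_pos_iff.2 (half_pos ht)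
    rw [← abs_diagPhase_div_sinh ht, diagAmpCos, norm_div, Real.norm_eq_abs, Real.norm_of_nonneg hs.le]
    exact div_le_div_of_nonneg_right Real.abs_sin_le_abs hs.le

/-- Replacing `cos φ` by `1` costs at most `|φ| / sinh(t/2)`, a multiple of `1 / cosh(t/2)` because
the phase `φ` is a multiple of `tanh(t/2)`. What remains is the distance of `1 / sinh(t/2)` to its
model. -/
theorem integrableOn_diagAmpSin (σ : ℝ) : IntegrableOn (diagAmpSin σ) (Ioi 0) := by
  refine Integrable.mono' ((integrableOn_one_div_cosh_half.const_mul (4 * Real.pi * |σ|)).add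
    (integrableOn_exp_neg_half.const_mul 2)) ?_ ?_
  · have := measurable_diagPhase σ
    have : Measurable (diagAmpSin σ) := by unfold diagAmpSin; fun_prop
    exact this.aestronglyMeasurable
  · filter_upwards [ae_restrict_mem measurableSet_Ioi] with t ht
    have ht' : (0 : ℝ) < t := ht
    have hs : 0 < Real.sinh (t / 2) := Real.sinh_pos_iff.2 (half_pos ht)
    rw [Pi.add_apply, ← abs_diagPhase_div_sinh ht]
    have e : diagAmpSin σ t = (Real.cos (diagPhase σ t) - 1) / Real.sinh (t / 2) +
        (1 / Real.sinh (t / 2) - 2 * Real.exp (-t / 2) / t) := by rw [diagAmpSin]; ring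
    rw [e]
    refine (norm_add_le _ _).trans (add_le_add ?_ ?_)
    · rw [norm_div, Real.norm_eq_abs, Real.norm_of_nonneg hs.le]
      refine div_le_div_of_nonneg_right ?_ hs.le
      have := Real.abs_sin_le_abs (x := diagPhase σ t / 2)
      have h1 : Real.cos (diagPhase σ t) - 1 = -2 * Real.sin (diagPhase σ t / 2) ^ 2 := by
        have := Real.cos_sq (diagPhase σ t / 2)
        have h2 := Real.sin_sq_add_cos_sq (diagPhase σ t / 2)
        rw [mul_div_cancel₀ _ two_ne_zero] at this
        linarith
      rw [h1, abs_mul, abs_pow]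
      have h3 := Real.abs_sin_le_one (diagPhase σ t / 2)
      have h4 := abs_nonneg (Real.sin (diagPhase σ t / 2))
      rw [abs_div, abs_two] at this
      norm_num
      rw [← sq_abs]
      nlinarith
    · rw [Real.norm_of_nonneg (sub_nonneg.2 (two_exp_div_le_one_div_sinh_half ht'))]
      have := one_div_sinh_half_le ht'
      linarith

/-- The sine is expanded and the model kernel split off: its contribution is the arctangent, and the
remaining amplitudes are integrable independently of `τ`. Uniform boundedness and the limit `π` at
`+∞` both follow from this form. -/
theorem diagIntegral_eq (σ τ : ℝ) :
    diagIntegral σ τ = 2 * Real.arctan (4 * Real.pi * τ) +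
      (∫ t in Ioi (0 : ℝ), Real.sin (2 * Real.pi * t * τ) * diagAmpSin σ t) -
      ∫ t in Ioi (0 : ℝ), Real.cos (2 * Real.pi * t * τ) * diagAmpCos σ t := by
  have i1 : IntegrableOn (fun t => Real.sin (2 * Real.pi * t * τ) * diagAmpSin σ t) (Ioi 0) :=
    (integrableOn_diagAmpSin σ).bdd_mul (c := 1) (by fun_prop)
      (ae_of_all _ fun t => Real.abs_sin_le_one _)
  have i2 : IntegrableOn (fun t => Real.cos (2 * Real.pi * t * τ) * diagAmpCos σ t) (Ioi 0) :=
    (integrableOn_diagAmpCos σ).bdd_mul (c := 1) (by fun_prop)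
      (ae_of_all _ fun t => Real.abs_cos_le_one _)
  have i3 : IntegrableOn (fun t => 2 * (Real.sin (2 * Real.pi * τ * t) * (Real.exp (-t / 2) / t)))
      (Ioi 0) := by
    refine Integrable.mono' (integrableOn_exp_neg_half.const_mul (2 * |2 * Real.pi * τ|)) ?_ ?_
    · have : Measurable fun t : ℝ =>
        2 * (Real.sin (2 * Real.pi * τ * t) * (Real.exp (-t / 2) / t)) := by fun_prop
      exact this.aestronglyMeasurable
    filter_upwards [ae_restrict_mem measurableSet_Ioi] with t ht
    have ht' : (0 : ℝ) < t := ht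
    rw [norm_mul, norm_mul, Real.norm_of_nonneg zero_le_two, Real.norm_eq_abs,
      Real.norm_of_nonneg (by positivity), mul_assoc (2 : ℝ) |2 * Real.pi * τ|]
    refine mul_le_mul_of_nonneg_left (a := (2:ℝ)) ?_ zero_le_two
    calc |Real.sin (2 * Real.pi * τ * t)| * (Real.exp (-t / 2) / t)
        ≤ |2 * Real.pi * τ * t| * (Real.exp (-t / 2) / t) := by
          exact mul_le_mul_of_nonneg_right Real.abs_sin_le_abs (by positivity)
      _ = |2 * Real.pi * τ| * Real.exp (-t / 2) := by rw [abs_mul, abs_of_pos ht']; field_simp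
  have e := integral_sin_mul_exp_div (2 * Real.pi * τ)
  rw [show 2 * (2 * Real.pi * τ) = 4 * Real.pi * τ by ring] at e
  rw [← e, ← integral_const_mul, ← integral_add i3 i1]
  refine Eq.trans ?_ (integral_sub (i3.add i1) i2)
  refine setIntegral_congr_fun measurableSet_Ioi fun t _ => ?_
  simp only [diagAmpSin, diagAmpCos, Real.sin_sub]
  rw [show 2 * Real.pi * τ * t = 2 * Real.pi * t * τ by ring]
  ring

theorem exists_abs_diagIntegral_le (σ : ℝ) : ∃ C, ∀ τ, |diagIntegral σ τ| ≤ C := by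
  refine ⟨Real.pi + (∫ t in Ioi (0 : ℝ), ‖diagAmpSin σ t‖) + ∫ t in Ioi (0 : ℝ), ‖diagAmpCos σ t‖,
    fun τ => ?_⟩
  rw [diagIntegral_eq]
  refine (norm_sub_le (E := ℝ) _ _).trans (add_le_add ((abs_add_le _ _).trans (add_le_add ?_ ?_)) ?_)
  · have h1 := Real.arctan_lt_pi_div_two (4 * Real.pi * τ)
    have h2 := Real.neg_pi_div_two_lt_arctan (4 * Real.pi * τ)
    rw [abs_le]
    constructor <;> linarith
  · refine norm_integral_le_of_norm_le (G := ℝ) (integrableOn_diagAmpSin σ).norm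
      (ae_of_all _ fun t => ?_)
    rw [norm_mul]
    exact mul_le_of_le_one_left (norm_nonneg _) (Real.abs_sin_le_one _)
  · refine norm_integral_le_of_norm_le (G := ℝ) (integrableOn_diagAmpCos σ).norm
      (ae_of_all _ fun t => ?_)
    rw [norm_mul]
    exact mul_le_of_le_one_left (norm_nonneg _) (Real.abs_cos_le_one _)

theorem tendsto_diagIntegral (σ : ℝ) : Tendsto (diagIntegral σ) atTop (𝓝 Real.pi) := by
  have h1 : Tendsto (fun τ => 2 * Real.arctan (4 * Real.pi * τ)) atTop (𝓝 (2 * (Real.pi / 2))) :=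
    ((Real.tendsto_arctan_atTop.mono_right nhdsWithin_le_nhds).comp
      (tendsto_id.const_mul_atTop (by positivity))).const_mul 2
  have hs := tendsto_integral_Ioi_sin_mul (f := fun t => (diagAmpSin σ t : ℂ))
    (integrableOn_diagAmpSin σ).ofReal
  have hc := tendsto_integral_Ioi_cos_mul (f := fun t => (diagAmpCos σ t : ℂ))
    (integrableOn_diagAmpCos σ).ofReal
  have hs' : Tendsto (fun τ => ∫ t in Ioi (0 : ℝ), Real.sin (2 * Real.pi * t * τ) * diagAmpSin σ t)
      atTop (𝓝 0) := by
    refine ((Complex.continuous_re.tendsto 0).comp hs).congr fun R => ?_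
    simp only [Function.comp_apply, ← Complex.ofReal_mul]
    rw [integral_complex_ofReal, Complex.ofReal_re]
  have hc' : Tendsto (fun τ => ∫ t in Ioi (0 : ℝ), Real.cos (2 * Real.pi * t * τ) * diagAmpCos σ t)
      atTop (𝓝 0) := by
    refine ((Complex.continuous_re.tendsto 0).comp hc).congr fun R => ?_
    simp only [Function.comp_apply, ← Complex.ofReal_mul]
    rw [integral_complex_ofReal, Complex.ofReal_re]
  have := (h1.add hs').sub hc'
  rw [add_zero, sub_zero, mul_div_cancel₀ _ two_ne_zero] at this
  exact this.congr fun τ => (diagIntegral_eq σ τ).symm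

/-- The derivative of `diagIntegral`, up to the factor `2π`. -/
noncomputable def diagDeriv (σ τ : ℝ) : ℝ :=
  ∫ t in Ioi (0 : ℝ), t * Real.cos (2 * Real.pi * t * τ - diagPhase σ t) / Real.sinh (t / 2)

/-- Differentiation in `τ` brings out a factor `t`, which removes the singularity of `1 / sinh(t/2)`
at `0` and supplies the integrable dominating function. -/
theorem hasDerivAt_diagIntegral (σ τ : ℝ) :
    HasDerivAt (diagIntegral σ) (2 * Real.pi * diagDeriv σ τ) τ := by
  have hφ := measurable_diagPhase σ
  have hm : ∀ τ : ℝ, AEStronglyMeasurable (fun t : ℝ =>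
      Real.sin (2 * Real.pi * t * τ - diagPhase σ t) / Real.sinh (t / 2))
      (volume.restrict (Ioi 0)) := fun τ => by
    have : Measurable fun t : ℝ =>
      Real.sin (2 * Real.pi * t * τ - diagPhase σ t) / Real.sinh (t / 2) := by fun_prop
    exact this.aestronglyMeasurable
  rw [diagDeriv, ← integral_const_mul]
  refine (hasDerivAt_integral_of_dominated_loc_of_deriv_le (s := univ) univ_mem
    (Eventually.of_forall hm) ?_ ?_ (x₀ := τ)
    (bound := fun t => 2 * Real.pi * (t / Real.sinh (t / 2)))
    (F' := fun τ t =>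
      2 * Real.pi * (t * Real.cos (2 * Real.pi * t * τ - diagPhase σ t) / Real.sinh (t / 2))) ?_
    (integrableOn_div_sinh_half.const_mul _) ?_).2
  · refine Integrable.mono' ((integrableOn_div_sinh_half.const_mul (2 * Real.pi * |τ|)).add
      (integrableOn_one_div_cosh_half.const_mul (4 * Real.pi * |σ|))) (hm τ) ?_
    filter_upwards [ae_restrict_mem measurableSet_Ioi] with t ht
    have ht' : (0 : ℝ) < t := ht
    have hs : 0 < Real.sinh (t / 2) := Real.sinh_pos_iff.2 (half_pos ht)
    rw [Pi.add_apply, ← abs_diagPhase_div_sinh ht, norm_div, Real.norm_eq_abs,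
      Real.norm_of_nonneg hs.le, ← mul_div_assoc, ← add_div]
    gcongr
    refine Real.abs_sin_le_abs.trans ((norm_sub_le (E := ℝ) _ _).trans (le_of_eq ?_))
    rw [Real.norm_eq_abs, Real.norm_eq_abs, abs_mul, abs_mul, abs_of_pos Real.two_pi_pos,
      abs_of_pos ht']
    ring
  · have : Measurable fun t : ℝ =>
      2 * Real.pi * (t * Real.cos (2 * Real.pi * t * τ - diagPhase σ t) / Real.sinh (t / 2)) := by
      fun_prop
    exact this.aestronglyMeasurable
  · filter_upwards [ae_restrict_mem measurableSet_Ioi] with t ht x _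
    have ht' : (0 : ℝ) < t := ht
    have hs : 0 < Real.sinh (t / 2) := Real.sinh_pos_iff.2 (half_pos ht)
    rw [norm_mul, norm_div, norm_mul (t : ℝ), Real.norm_of_nonneg Real.two_pi_pos.le,
      Real.norm_of_nonneg ht'.le, Real.norm_of_nonneg hs.le]
    gcongr
    exact mul_le_of_le_one_right ht'.le (Real.abs_cos_le_one _)
  · refine ae_of_all _ fun t x _ => ?_
    have h := ((((hasDerivAt_id x).const_mul (2 * Real.pi * t)).sub_const (diagPhase σ t)).sin).div_const
      (Real.sinh (t / 2))
    convert! h using 1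
    simp only [id_eq, mul_one]
    ring

end DiagonalCoefficient

/-! ### Shifting a contour by `I` -/

section ContourShift

/-- Shifting the contour of integration from the real line to the line `im z = 1`. -/
theorem integral_eq_integral_add_I {f : ℂ → ℂ} {g : ℝ → ℝ}
    (hd : ∀ z : ℂ, 0 ≤ z.im → z.im ≤ 1 → DifferentiableAt ℂ f z)
    (h0 : Integrable fun x : ℝ => f x) (h1 : Integrable fun x : ℝ => f (x + Complex.I))
    (hg : Tendsto g atTop (𝓝 0))
    (hfg : ∀ T : ℝ, 0 < T → ∀ y ∈ Icc (0 : ℝ) 1, ‖f (T + y * Complex.I)‖ ≤ g T ∧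
      ‖f (-T + y * Complex.I)‖ ≤ g T) :
    ∫ x : ℝ, f x = ∫ x : ℝ, f (x + Complex.I) := by
  -- Cauchy's theorem on the rectangle `[-T, T] × [0, 1]`: the two horizontal integrals differ by
  -- the vertical sides, each bounded by `g T`.
  have key : ∀ T : ℝ, 0 < T →
      ‖(∫ x in (-T)..T, f x) - ∫ x in (-T)..T, f (x + Complex.I)‖ ≤ 2 * g T := by
    intro T hT
    have hrect := Complex.integral_boundary_rect_eq_zero_of_differentiableOn f (-T : ℂ)
      (T + Complex.I) (fun z hz => by
        rw [Complex.mem_reProdIm] at hz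
        have h2 := hz.2
        simp at h2
        exact (hd z h2.1 h2.2).differentiableWithinAt)
    simp only [Complex.neg_re, Complex.ofReal_re, Complex.neg_im, Complex.ofReal_im, neg_zero,
      Complex.add_re, Complex.I_re, add_zero, Complex.add_im, Complex.I_im, zero_add,
      Complex.ofReal_zero, zero_mul, Complex.ofReal_one, one_mul, Complex.ofReal_neg] at hrect
    have e : (∫ x in (-T)..T, f x) - ∫ x in (-T)..T, f (x + Complex.I) =
        Complex.I • (∫ y in (0 : ℝ)..1, f (-T + y * Complex.I)) -
        Complex.I • (∫ y in (0 : ℝ)..1, f (T + y * Complex.I)) := by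
      linear_combination hrect
    have b1 : ‖∫ y in (0 : ℝ)..1, f (-T + y * Complex.I)‖ ≤ g T * |1 - 0| :=
      intervalIntegral.norm_integral_le_of_norm_le_const fun y hy => by
        rw [uIoc_of_le zero_le_one] at hy
        exact (hfg T hT y ⟨hy.1.le, hy.2⟩).2
    have b2 : ‖∫ y in (0 : ℝ)..1, f (T + y * Complex.I)‖ ≤ g T * |1 - 0| :=
      intervalIntegral.norm_integral_le_of_norm_le_const fun y hy => by
        rw [uIoc_of_le zero_le_one] at hy
        exact (hfg T hT y ⟨hy.1.le, hy.2⟩).1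
    rw [e]
    refine (norm_sub_le _ _).trans ?_
    rw [norm_smul, norm_smul, Complex.norm_I, one_mul, one_mul]
    simp only [sub_zero, abs_one, mul_one] at b1 b2
    linarith
  have t0 := intervalIntegral_tendsto_integral h0 tendsto_neg_atTop_atBot tendsto_id
  have t1 := intervalIntegral_tendsto_integral h1 tendsto_neg_atTop_atBot tendsto_id
  have t2 : Tendsto (fun T : ℝ => (∫ x in (-T)..T, f x) - ∫ x in (-T)..T, f (x + Complex.I))
      atTop (𝓝 0) := by
    have hg2 := hg.const_mul 2
    rw [mul_zero] at hg2
    refine squeeze_zero_norm' ?_ hg2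
    filter_upwards [eventually_gt_atTop 0] with T hT using key T hT
  exact sub_eq_zero.1 (tendsto_nhds_unique (t0.sub t1) t2)

end ContourShift

/-! ### Holomorphy in the strip and exponential convergence of the diagonal coefficient -/

section Strip

theorem normSq_sinh_add_mul_I (x y : ℝ) :
    ‖Complex.sinh (x + y * Complex.I)‖ ^ 2 = Real.sinh x ^ 2 + Real.sin y ^ 2 := by
  rw [← Complex.normSq_eq_norm_sq, Complex.sinh_add, Complex.cosh_mul_I, Complex.sinh_mul_I]
  have : Complex.sinh x * Complex.cos y + Complex.cosh x * (Complex.sin y * Complex.I) =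
      ((Real.sinh x * Real.cos y : ℝ) : ℂ) + ((Real.cosh x * Real.sin y : ℝ) : ℂ) * Complex.I := by
    push_cast; ring
  rw [this, Complex.normSq_add_mul_I]
  have h1 := Real.cosh_sq x
  have h2 := Real.sin_sq_add_cos_sq y
  rw [mul_pow, mul_pow, h1]
  linear_combination Real.sinh x ^ 2 * h2

theorem normSq_cosh_add_mul_I (x y : ℝ) :
    ‖Complex.cosh (x + y * Complex.I)‖ ^ 2 = Real.sinh x ^ 2 + Real.cos y ^ 2 := by
  rw [← Complex.normSq_eq_norm_sq, Complex.cosh_add, Complex.cosh_mul_I, Complex.sinh_mul_I]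
  have : Complex.cosh x * Complex.cos y + Complex.sinh x * (Complex.sin y * Complex.I) =
      ((Real.cosh x * Real.cos y : ℝ) : ℂ) + ((Real.sinh x * Real.sin y : ℝ) : ℂ) * Complex.I := by
    push_cast; ring
  rw [this, Complex.normSq_add_mul_I]
  have h1 := Real.cosh_sq x
  have h2 := Real.sin_sq_add_cos_sq y
  rw [mul_pow, mul_pow, h1]
  linear_combination Real.sinh x ^ 2 * h2

/-- The entire function `sinh z / z`. -/
noncomputable def sinhc : ℂ → ℂ := dslope Complex.sinh 0

theorem differentiable_sinhc : Differentiable ℂ sinhc := by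
  rw [← differentiableOn_univ]
  exact (Complex.differentiableOn_dslope univ_mem).2 Complex.differentiable_sinh.differentiableOn

theorem sinhc_zero : sinhc 0 = 1 := by
  rw [sinhc, dslope_same, (Complex.hasDerivAt_sinh 0).deriv, Complex.cosh_zero]

theorem sinhc_of_ne {z : ℂ} (hz : z ≠ 0) : sinhc z = Complex.sinh z / z := by
  rw [sinhc, dslope_of_ne _ hz, slope_def_field]
  simp

/-- The half-angle stays below `π/4`. This keeps `cosh(z/2)` away from zero and `tanh(z/2)` in the
unit disc throughout the strip. -/
theorem cos_half_sq_ge {y : ℝ} (h0 : 0 ≤ y) (h1 : y ≤ 1) :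
    Real.sin (y / 2) ^ 2 ≤ Real.cos (y / 2) ^ 2 ∧ 0 < Real.cos (y / 2) ^ 2 := by
  have hs : Real.sin (y / 2) ≤ y / 2 := Real.sin_le (by linarith)
  have hs0 : 0 ≤ Real.sin (y / 2) :=
    Real.sin_nonneg_of_nonneg_of_le_pi (by linarith) (by linarith [Real.pi_gt_three])
  have := Real.sin_sq_add_cos_sq (y / 2)
  constructor <;> nlinarith

theorem half_decomp (z : ℂ) : z / 2 = ((z.re / 2 : ℝ) : ℂ) + ((z.im / 2 : ℝ) : ℂ) * Complex.I := by
  conv_lhs => rw [← Complex.re_add_im z]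
  push_cast
  ring

theorem cosh_half_ne_zero {z : ℂ} (h0 : 0 ≤ z.im) (h1 : z.im ≤ 1) : Complex.cosh (z / 2) ≠ 0 := by
  intro h
  have h2 := normSq_cosh_add_mul_I (z.re / 2) (z.im / 2)
  rw [← half_decomp, h, norm_zero] at h2
  have := (cos_half_sq_ge h0 h1).2
  nlinarith [sq_nonneg (Real.sinh (z.re / 2))]

/-- Needed to bound the factor `exp(-4πiσ tanh(z/2))` off the real axis by a constant depending only
on `σ`. -/
theorem norm_tanh_half_le {z : ℂ} (h0 : 0 ≤ z.im) (h1 : z.im ≤ 1) :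
    ‖Complex.tanh (z / 2)‖ ≤ 1 := by
  rw [Complex.tanh_eq_sinh_div_cosh, norm_div,
    div_le_one (norm_pos_iff.2 (cosh_half_ne_zero h0 h1))]
  rw [← sq_le_sq₀ (norm_nonneg _) (norm_nonneg _), half_decomp, normSq_sinh_add_mul_I,
    normSq_cosh_add_mul_I]
  linarith [(cos_half_sq_ge h0 h1).1]

theorem sinhc_half_ne_zero {z : ℂ} (h0 : 0 ≤ z.im) (h1 : z.im ≤ 1) : sinhc (z / 2) ≠ 0 := by
  by_cases hz : z = 0
  · rw [hz, zero_div, sinhc_zero]; exact one_ne_zero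
  have hz2 : z / 2 ≠ 0 := div_ne_zero hz two_ne_zero
  rw [sinhc_of_ne hz2]
  refine div_ne_zero (fun h => ?_) hz2
  have h2 := normSq_sinh_add_mul_I (z.re / 2) (z.im / 2)
  rw [← half_decomp, h, norm_zero] at h2
  have e1 : Real.sinh (z.re / 2) = 0 := by
    nlinarith [sq_nonneg (Real.sinh (z.re / 2)), sq_nonneg (Real.sin (z.im / 2))]
  have e2 : Real.sin (z.im / 2) = 0 := by
    nlinarith [sq_nonneg (Real.sinh (z.re / 2)), sq_nonneg (Real.sin (z.im / 2))]
  rw [Real.sinh_eq_zero] at e1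
  rw [Real.sin_eq_zero_iff_of_lt_of_lt (by linarith [Real.pi_gt_three])
    (by linarith [Real.pi_gt_three])] at e2
  apply hz
  apply Complex.ext
  · simpa using e1
  · simpa using e2

/-- The holomorphic amplitude in the derivative of the diagonal coefficient. -/
noncomputable def stripAmp (σ : ℝ) (z : ℂ) : ℂ :=
  Complex.exp (-(4 * Real.pi * σ * Complex.I) * Complex.tanh (z / 2)) * (2 / sinhc (z / 2))

theorem differentiableAt_stripAmp (σ : ℝ) {z : ℂ} (h0 : 0 ≤ z.im) (h1 : z.im ≤ 1) :
    DifferentiableAt ℂ (stripAmp σ) z := by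
  have e : stripAmp σ = fun z => Complex.exp (-(4 * Real.pi * σ * Complex.I) *
      (Complex.sinh (z / 2) / Complex.cosh (z / 2))) * (2 / sinhc (z / 2)) := by
    funext z
    rw [stripAmp, Complex.tanh_eq_sinh_div_cosh]
  rw [e]
  have hc := cosh_half_ne_zero h0 h1
  have hs := sinhc_half_ne_zero h0 h1
  have hd : DifferentiableAt ℂ (fun z : ℂ => sinhc (z / 2)) z :=
    (differentiable_sinhc (z / 2)).comp z (by fun_prop)
  have h2 : DifferentiableAt ℂ (fun z : ℂ => Complex.sinh (z / 2) / Complex.cosh (z / 2)) z :=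
    DifferentiableAt.div (by fun_prop) (by fun_prop) hc
  exact ((h2.const_mul _).cexp).mul ((differentiableAt_const _).div hd hs)

theorem norm_stripAmp_le (σ : ℝ) {z : ℂ} (h0 : 0 ≤ z.im) (h1 : z.im ≤ 1) (hz : z ≠ 0) :
    ‖stripAmp σ z‖ ≤ Real.exp (4 * Real.pi * |σ|) * (‖z‖ / ‖Complex.sinh (z / 2)‖) := by
  have hz2 : z / 2 ≠ 0 := div_ne_zero hz two_ne_zero
  have e : (2 : ℂ) / (Complex.sinh (z / 2) / (z / 2)) = z / Complex.sinh (z / 2) := by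
    have := sinhc_half_ne_zero h0 h1
    rw [sinhc_of_ne hz2] at this
    have : Complex.sinh (z / 2) ≠ 0 := fun h => this (by rw [h, zero_div])
    field_simp
  rw [stripAmp, sinhc_of_ne hz2, norm_mul, e, norm_div]
  gcongr
  refine (Complex.norm_exp_le_exp_norm _).trans (Real.exp_le_exp.2 ?_)
  rw [norm_mul, norm_neg, norm_mul, Complex.norm_I, mul_one]
  have : ‖(4 * Real.pi * σ : ℂ)‖ = 4 * Real.pi * |σ| := by
    rw [norm_mul, norm_mul, Complex.norm_real, Complex.norm_real, Real.norm_of_nonneg Real.pi_pos.le]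
    simp
  rw [this]
  exact mul_le_of_le_one_right (by positivity) (norm_tanh_half_le h0 h1)

theorem stripAmp_ofReal {σ t : ℝ} (ht : t ≠ 0) :
    stripAmp σ t = Complex.exp (-(diagPhase σ t * Complex.I)) * ((t / Real.sinh (t / 2) : ℝ) : ℂ) := by
  have hz2 : (t : ℂ) / 2 ≠ 0 := div_ne_zero (by exact_mod_cast ht) two_ne_zero
  have hs : Complex.sinh ((t : ℂ) / 2) ≠ 0 := by
    have : Real.sinh (t / 2) ≠ 0 := by rw [Ne, Real.sinh_eq_zero]; simpa using ht
    have h2 : ((Real.sinh (t / 2) : ℝ) : ℂ) ≠ 0 := by exact_mod_cast this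
    push_cast at h2
    exact h2
  rw [stripAmp, sinhc_of_ne hz2, diagPhase]
  push_cast
  congr 1
  · congr 1; ring
  · field_simp

/-- This symmetry lets the half-line cosine integral `diagDeriv` be written as half of an integral
over the whole line, to which the contour shift applies. -/
theorem stripAmp_neg (σ t : ℝ) : stripAmp σ ((-t : ℝ) : ℂ) = conj (stripAmp σ t) := by
  by_cases ht : t = 0
  · simp [ht, stripAmp, sinhc_zero, map_ofNat]
  rw [stripAmp_ofReal (neg_ne_zero.2 ht), stripAmp_ofReal ht, map_mul, ← Complex.exp_conj,
    Complex.conj_ofReal]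
  have e1 : diagPhase σ (-t) = -diagPhase σ t := by
    rw [diagPhase, diagPhase, neg_div, Real.tanh_neg]; ring
  rw [e1, neg_div 2 t, Real.sinh_neg, neg_div_neg_eq]
  simp

theorem integrable_exp_neg_abs_quarter : Integrable fun t : ℝ => Real.exp (-|t| / 4) := by
  rw [← integrableOn_univ, ← Iic_union_Ioi (a := (0 : ℝ)), integrableOn_union]
  constructor
  · have := integrableOn_exp_mul_Iic (a := 1 / 4) (by norm_num) 0
    refine this.congr_fun (fun t ht => ?_) measurableSet_Iic
    simp only [abs_of_nonpos (mem_Iic.1 ht)]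
    ring_nf
  · refine integrableOn_exp_neg_quarter.congr_fun (fun t ht => ?_) measurableSet_Ioi
    simp only [abs_of_pos (mem_Ioi.1 ht)]

theorem abs_div_sinh_half_le {t : ℝ} (ht : t ≠ 0) :
    |t| / |Real.sinh (t / 2)| ≤ 8 * Real.exp (-|t| / 4) := by
  have h := abs_pos.2 ht
  have e : |Real.sinh (t / 2)| = Real.sinh (|t| / 2) := by
    rw [Real.abs_sinh, abs_div, abs_two]
  rw [e]
  refine (div_sinh_half_le h).trans ?_
  have := one_add_mul_exp_neg_half_le |t|
  linarith

theorem continuous_stripAmp_line (σ y : ℝ) (h0 : 0 ≤ y) (h1 : y ≤ 1) :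
    Continuous fun x : ℝ => stripAmp σ (x + y * Complex.I) := by
  refine continuous_iff_continuousAt.2 fun x => ?_
  have h := (differentiableAt_stripAmp σ (z := x + y * Complex.I) (by simpa using h0)
    (by simpa using h1)).continuousAt
  exact ContinuousAt.comp (f := fun x : ℝ => (x + y * Complex.I : ℂ)) h (by fun_prop)

theorem integrable_stripAmp (σ : ℝ) : Integrable fun t : ℝ => stripAmp σ t := by
  have hc := continuous_stripAmp_line σ 0 le_rfl zero_le_one
  simp only [Complex.ofReal_zero, zero_mul, add_zero] at hc
  refine Integrable.mono' (integrable_exp_neg_abs_quarter.const_mul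
    (Real.exp (4 * Real.pi * |σ|) * 8)) hc.aestronglyMeasurable ?_
  filter_upwards [compl_mem_ae_iff.2 (measure_singleton (0 : ℝ))] with t ht
  have ht : t ≠ 0 := ht
  refine (norm_stripAmp_le σ (by simp) (by simp) (by exact_mod_cast ht)).trans ?_
  rw [mul_assoc (Real.exp _) 8]
  gcongr
  refine le_trans (le_of_eq ?_) (abs_div_sinh_half_le ht)
  rw [Complex.norm_real, Real.norm_eq_abs]
  congr 1
  have : Complex.sinh ((t : ℂ) / 2) = ((Real.sinh (t / 2) : ℝ) : ℂ) := by push_cast; rfl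
  rw [this, Complex.norm_real, Real.norm_eq_abs]

theorem integrable_stripAmp_add_I (σ : ℝ) : Integrable fun t : ℝ => stripAmp σ (t + Complex.I) := by
  have hc := continuous_stripAmp_line σ 1 zero_le_one le_rfl
  simp only [Complex.ofReal_one, one_mul] at hc
  have hsin : 0 < Real.sin (1 / 2) :=
    Real.sin_pos_of_pos_of_lt_pi (by norm_num) (by linarith [Real.pi_gt_three])
  refine Integrable.mono' (integrable_exp_neg_abs_quarter.const_mul
    (Real.exp (4 * Real.pi * |σ|) * (8 / Real.sin (1 / 2)))) hc.aestronglyMeasurable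
    (ae_of_all _ fun t => ?_)
  refine (norm_stripAmp_le σ (by simp) (by simp) (fun h => ?_)).trans ?_
  · have := congrArg Complex.im h
    simp at this
  rw [mul_assoc (Real.exp _) (8 / _)]
  refine mul_le_mul_of_nonneg_left ?_ (Real.exp_pos _).le
  have h1 : ‖(t : ℂ) + Complex.I‖ ≤ 1 + |t| := by
    refine (norm_add_le _ _).trans ?_
    rw [Complex.norm_real, Complex.norm_I, Real.norm_eq_abs, add_comm]
  -- The squared modulus is `sinh²(t/2) + sin²(1/2)`, and `sin²(1/2) ≤ 1` while `cosh² = sinh² + 1`.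
  have h2 : Real.sin (1 / 2) * Real.cosh (t / 2) ≤ ‖Complex.sinh ((t + Complex.I) / 2)‖ := by
    rw [← sq_le_sq₀ (by positivity) (norm_nonneg _), half_decomp, normSq_sinh_add_mul_I]
    simp only [Complex.add_re, Complex.ofReal_re, Complex.I_re, add_zero, Complex.add_im,
      Complex.ofReal_im, Complex.I_im, zero_add, mul_pow]
    rw [Real.cosh_sq]
    nlinarith [Real.sin_sq_le_one (1 / 2), sq_nonneg (Real.sinh (t / 2))]
  have h3 : 0 < Real.sin (1 / 2) * Real.cosh (t / 2) := by positivity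
  calc _ ≤ (1 + |t|) / (Real.sin (1 / 2) * Real.cosh (t / 2)) :=
        div_le_div₀ (by positivity) h1 h3 h2
    _ = (1 + |t|) / Real.sin (1 / 2) * (1 / Real.cosh (|t| / 2)) := by
        have : Real.cosh (|t| / 2) = Real.cosh (t / 2) := by
          rw [← Real.cosh_abs (t / 2), abs_div, abs_two]
        rw [this]
        field_simp
    _ ≤ (1 + |t|) / Real.sin (1 / 2) * (2 * Real.exp (-|t| / 2)) := by
        gcongr
        exact one_div_cosh_half_le _
    _ = 2 / Real.sin (1 / 2) * ((1 + |t|) * Real.exp (-|t| / 2)) := by ring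
    _ ≤ 2 / Real.sin (1 / 2) * (4 * Real.exp (-|t| / 4)) := by
        exact mul_le_mul_of_nonneg_left (one_add_mul_exp_neg_half_le _) (by positivity)
    _ = _ := by ring

theorem norm_stripAmp_side_le (σ : ℝ) {T : ℝ} (hT : T ≠ 0) {y : ℝ} (h0 : 0 ≤ y) (h1 : y ≤ 1) :
    ‖stripAmp σ (T + y * Complex.I)‖ ≤
      Real.exp (4 * Real.pi * |σ|) * ((|T| + 1) / Real.sinh (|T| / 2)) := by
  have hTp := abs_pos.2 hT
  refine (norm_stripAmp_le σ (by simpa using h0) (by simpa using h1) (fun h => ?_)).trans ?_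
  · have := congrArg Complex.re h
    simp at this
    exact hT this
  have hs : 0 < Real.sinh (|T| / 2) := Real.sinh_pos_iff.2 (half_pos hTp)
  gcongr
  · refine (norm_add_le _ _).trans ?_
    rw [norm_mul, Complex.norm_I, Complex.norm_real, Complex.norm_real, Real.norm_eq_abs,
      Real.norm_of_nonneg h0]
    linarith
  · rw [← sq_le_sq₀ hs.le (norm_nonneg _), half_decomp, normSq_sinh_add_mul_I]
    simp
    have : Real.sinh (|T| / 2) ^ 2 = Real.sinh (T / 2) ^ 2 := by
      rw [← sq_abs (Real.sinh (T / 2)), Real.abs_sinh, abs_div, abs_two]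
    rw [this]
    nlinarith [sq_nonneg (Real.sin (y / 2))]

theorem tendsto_add_one_div_sinh_half :
    Tendsto (fun T : ℝ => (|T| + 1) / Real.sinh (|T| / 2)) atTop (𝓝 0) := by
  have h1 : Tendsto (fun T : ℝ => 16 * Real.exp (-T / 4)) atTop (𝓝 0) := by
    have h3 : Tendsto (fun T : ℝ => -T / 4) atTop atBot := by
      refine (tendsto_neg_atTop_atBot.atBot_div_const (by norm_num : (0:ℝ) < 4)).congr fun T => rfl
    have := (Real.tendsto_exp_atBot.comp h3).const_mul 16
    rw [mul_zero] at this
    exact this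
  refine squeeze_zero' ?_ ?_ h1
  · exact Eventually.of_forall fun T => div_nonneg (by positivity)
      (Real.sinh_nonneg_iff.2 (by positivity))
  · filter_upwards [eventually_ge_atTop 1] with T hT
    have hT0 : 0 < T := by linarith
    have hs : 0 < Real.sinh (T / 2) := Real.sinh_pos_iff.2 (half_pos hT0)
    rw [abs_of_pos hT0]
    have h2 := div_sinh_half_le hT0
    have h3 := one_add_mul_exp_neg_half_le T
    calc (T + 1) / Real.sinh (T / 2) ≤ (2 * T) / Real.sinh (T / 2) := by
          gcongr; linarith
      _ = 2 * (T / Real.sinh (T / 2)) := by ring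
      _ ≤ _ := by linarith

/-- Moving from `t` to `t + I` multiplies the character by `e^{-2πτ}`; this factor is the source of
the exponential decay. The vertical sides vanish in the limit because `1 / sinh` beats the linear
growth of the amplitude. -/
theorem integral_exp_mul_stripAmp (σ τ : ℝ) :
    ∫ t : ℝ, Complex.exp (2 * Real.pi * t * τ * Complex.I) * stripAmp σ t =
      Real.exp (-(2 * Real.pi * τ)) *
        ∫ t : ℝ, Complex.exp (2 * Real.pi * t * τ * Complex.I) * stripAmp σ (t + Complex.I) := by
  have hn : ∀ z : ℂ, ‖Complex.exp (2 * Real.pi * z * τ * Complex.I)‖ =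
      Real.exp (-(2 * Real.pi * z.im * τ)) := fun z => by
    rw [Complex.norm_exp]
    congr 1
    have : 2 * Real.pi * z * τ * Complex.I = ((-(2 * Real.pi * z.im * τ) : ℝ) : ℂ) +
        ((2 * Real.pi * z.re * τ : ℝ) : ℂ) * Complex.I := by
      conv_lhs => rw [← Complex.re_add_im z]
      push_cast
      ring_nf
      rw [Complex.I_sq]
      ring
    rw [this]
    simp
  have hshift : ∀ t : ℝ, Complex.exp (2 * Real.pi * (t + Complex.I) * τ * Complex.I) =
      Real.exp (-(2 * Real.pi * τ)) * Complex.exp (2 * Real.pi * t * τ * Complex.I) := fun t => by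
    rw [Complex.ofReal_exp, ← Complex.exp_add]
    congr 1
    push_cast
    ring_nf
    rw [Complex.I_sq]
    ring
  have h := integral_eq_integral_add_I
    (f := fun z => Complex.exp (2 * Real.pi * z * τ * Complex.I) * stripAmp σ z)
    (g := fun T => Real.exp (2 * Real.pi * |τ|) * (Real.exp (4 * Real.pi * |σ|) *
      ((|T| + 1) / Real.sinh (|T| / 2)))) ?_ ?_ ?_ ?_ ?_
  · rw [h, ← integral_const_mul]
    simp only [hshift]
    simp only [mul_assoc]
  · intro z h0 h1
    exact DifferentiableAt.mul (by fun_prop) (differentiableAt_stripAmp σ h0 h1)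
  · refine (integrable_stripAmp σ).bdd_mul (c := 1) (by fun_prop) (ae_of_all _ fun t => ?_)
    rw [hn]
    simp
  · refine (integrable_stripAmp_add_I σ).bdd_mul (c := Real.exp (-(2 * Real.pi * τ))) (by fun_prop)
      (ae_of_all _ fun t => ?_)
    rw [hn]
    simp
  · have := (tendsto_add_one_div_sinh_half.const_mul (Real.exp (4 * Real.pi * |σ|))).const_mul
      (Real.exp (2 * Real.pi * |τ|))
    simpa using this
  · have hb : ∀ T : ℝ, T ≠ 0 → ∀ y ∈ Icc (0 : ℝ) 1,
        ‖Complex.exp (2 * Real.pi * (T + y * Complex.I) * τ * Complex.I) *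
          stripAmp σ (T + y * Complex.I)‖ ≤ Real.exp (2 * Real.pi * |τ|) *
          (Real.exp (4 * Real.pi * |σ|) * ((|T| + 1) / Real.sinh (|T| / 2))) := by
      intro T hT y hy
      rw [norm_mul, hn]
      have hs := norm_stripAmp_side_le σ hT hy.1 hy.2
      gcongr
      simp
      have h3 : -(Real.pi * y * τ) ≤ Real.pi * |τ| := by
        have h4 : -(y * τ) ≤ |τ| := by
          calc -(y * τ) ≤ |y * τ| := neg_le_abs _
            _ = y * |τ| := by rw [abs_mul, abs_of_nonneg hy.1]
            _ ≤ |τ| := mul_le_of_le_one_left (abs_nonneg _) hy.2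
        nlinarith [Real.pi_pos]
      linarith
    intro T hT y hy
    refine ⟨hb T hT.ne' y hy, ?_⟩
    have := hb (-T) (neg_ne_zero.2 hT.ne') y hy
    simpa only [Complex.ofReal_neg, abs_neg] using this

theorem diagDeriv_eq (σ τ : ℝ) : (diagDeriv σ τ : ℂ) =
    (1 / 2) * ∫ t : ℝ, Complex.exp (2 * Real.pi * t * τ * Complex.I) * stripAmp σ t := by
  set f : ℝ → ℂ := fun t => Complex.exp (2 * Real.pi * t * τ * Complex.I) * stripAmp σ t with hf
  have he : ∀ t : ℝ, (2 * Real.pi * t * τ * Complex.I : ℂ) =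
      ((2 * Real.pi * t * τ : ℝ) : ℂ) * Complex.I := fun t => by push_cast; ring
  have hfi : Integrable f := by
    refine (integrable_stripAmp σ).bdd_mul (c := 1) (by fun_prop) (ae_of_all _ fun t => ?_)
    rw [he, Complex.norm_exp_ofReal_mul_I]
  have hneg : ∀ t, f (-t) = conj (f t) := fun t => by
    rw [hf]
    simp only [map_mul, ← Complex.exp_conj]
    rw [stripAmp_neg]
    simp [map_ofNat]
  have h1 : ∫ t, f t = (∫ t in Ioi 0, conj (f t)) + ∫ t in Ioi 0, f t := by
    rw [← integral_add_compl measurableSet_Iic hfi (s := Iic 0), compl_Iic]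
    congr 1
    rw [← neg_zero, ← integral_comp_neg_Ioi (c := 0), neg_zero]
    simp only [hneg]
  have hconj : Integrable (fun t => conj (f t)) := by
    exact (Complex.conjCLE : ℂ →L[ℝ] ℂ).integrable_comp hfi
  rw [h1, ← integral_add hconj.integrableOn hfi.integrableOn, diagDeriv, ← integral_complex_ofReal,
    ← integral_const_mul]
  refine setIntegral_congr_fun measurableSet_Ioi fun t ht => ?_
  have ht' : t ≠ 0 := ne_of_gt ht
  rw [add_comm (conj (f t)), Complex.add_conj, hf]
  simp only
  rw [stripAmp_ofReal ht', ← mul_assoc, ← Complex.exp_add, he, ← sub_eq_add_neg, ← sub_mul,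
    ← Complex.ofReal_sub, Complex.re_mul_ofReal, Complex.exp_ofReal_mul_I_re]
  push_cast
  ring

theorem exists_abs_diagDeriv_le (σ : ℝ) :
    ∃ C, ∀ τ, |diagDeriv σ τ| ≤ C * Real.exp (-(2 * Real.pi * τ)) := by
  refine ⟨1 / 2 * ∫ t : ℝ, ‖stripAmp σ (t + Complex.I)‖, fun τ => ?_⟩
  have h := congrArg norm (diagDeriv_eq σ τ)
  rw [Complex.norm_real, Real.norm_eq_abs, integral_exp_mul_stripAmp, norm_mul, norm_mul,
    Complex.norm_real, Real.norm_of_nonneg (Real.exp_pos _).le] at h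
  rw [h]
  have h2 : ‖∫ t : ℝ, Complex.exp (2 * Real.pi * t * τ * Complex.I) * stripAmp σ (t + Complex.I)‖ ≤
      ∫ t : ℝ, ‖stripAmp σ (t + Complex.I)‖ := by
    refine norm_integral_le_of_norm_le (integrable_stripAmp_add_I σ).norm (ae_of_all _ fun t => ?_)
    have : (2 * Real.pi * t * τ * Complex.I : ℂ) =
      ((2 * Real.pi * t * τ : ℝ) : ℂ) * Complex.I := by push_cast; ring
    rw [norm_mul, this, Complex.norm_exp_ofReal_mul_I, one_mul]
  have h3 : ‖(1 / 2 : ℂ)‖ = 1 / 2 := by simp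
  rw [h3]
  calc _ ≤ 1 / 2 * (Real.exp (-(2 * Real.pi * τ)) * ∫ t : ℝ, ‖stripAmp σ (t + Complex.I)‖) := by
        gcongr
    _ = _ := by ring

theorem hasDerivAt_coeffDiag (σ τ : ℝ) : HasDerivAt (coeffDiag σ) (diagDeriv σ τ) τ := by
  have h := ((hasDerivAt_diagIntegral σ τ).const_mul (1 / (2 * Real.pi))).const_add (1 / 2)
  have e : 1 / (2 * Real.pi) * (2 * Real.pi * diagDeriv σ τ) = diagDeriv σ τ := by
    field_simp
  rw [e] at h
  exact h

theorem tendsto_coeffDiag (σ : ℝ) : Tendsto (coeffDiag σ) atTop (𝓝 1) := by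
  have h := ((tendsto_diagIntegral σ).const_mul (1 / (2 * Real.pi))).const_add (1 / 2)
  have e : 1 / 2 + 1 / (2 * Real.pi) * Real.pi = 1 := by field_simp; norm_num
  rw [e] at h
  exact h

/-- The diagonal coefficient tends to `1` exponentially fast. -/
theorem exists_one_sub_coeffDiag_le (σ : ℝ) :
    ∃ C, ∀ τ, 1 - coeffDiag σ τ ≤ C * Real.exp (-(2 * Real.pi * τ)) := by
  obtain ⟨C, hC⟩ := exists_abs_diagDeriv_le σ
  refine ⟨C / (2 * Real.pi), fun τ => ?_⟩
  -- The added term has derivative `-C e^{-2πτ}`, which dominates `diagDeriv`. So `ψ` is antitone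
  -- with limit `1`, hence at least `1` everywhere.
  set ψ : ℝ → ℝ := fun τ => coeffDiag σ τ + C / (2 * Real.pi) * Real.exp (-(2 * Real.pi * τ)) with hψ
  have hd : ∀ τ, HasDerivAt ψ (diagDeriv σ τ - C * Real.exp (-(2 * Real.pi * τ))) τ := fun τ => by
    have h1 := (((hasDerivAt_id τ).const_mul (2 * Real.pi)).neg.exp).const_mul (C / (2 * Real.pi))
    convert! (hasDerivAt_coeffDiag σ τ).add h1 using 1
    simp
    field_simp
    ring
  have hanti : Antitone ψ := antitone_of_hasDerivAt_nonpos hd fun τ => by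
    have := (le_abs_self _).trans (hC τ)
    simp only [Pi.zero_apply]
    linarith
  have hlim : Tendsto ψ atTop (𝓝 1) := by
    have h3 : Tendsto (fun τ : ℝ => -(2 * Real.pi * τ)) atTop atBot :=
      tendsto_neg_atTop_atBot.comp (tendsto_id.const_mul_atTop Real.two_pi_pos)
    have h4 := (Real.tendsto_exp_atBot.comp h3).const_mul (C / (2 * Real.pi))
    have := (tendsto_coeffDiag σ).add h4
    rw [mul_zero, add_zero] at this
    exact this
  have := hanti.le_of_tendsto hlim τ
  simp only [hψ] at this
  linarith

theorem continuous_coeffDiag (σ : ℝ) : Continuous (coeffDiag σ) :=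
  continuous_iff_continuousAt.2 fun τ => (hasDerivAt_coeffDiag σ τ).continuousAt

theorem exists_abs_coeffDiag_le (σ : ℝ) : ∃ C, ∀ τ, |coeffDiag σ τ| ≤ C := by
  obtain ⟨C, hC⟩ := exists_abs_diagIntegral_le σ
  refine ⟨1 / 2 + 1 / (2 * Real.pi) * C, fun τ => ?_⟩
  rw [coeffDiag_eq]
  refine (abs_add_le _ _).trans (add_le_add (by norm_num) ?_)
  rw [abs_mul, abs_of_pos (by positivity : 0 < 1 / (2 * Real.pi))]
  gcongr
  exact hC τ

end Strip

/-! ### A Phragmén–Lindelöf uniqueness theorem in the right half-plane -/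

section HalfPlane

theorem Complex.norm_log_add_one_le_of_re_nonneg {w : ℂ} (hw : 0 ≤ w.re) :
    ‖Complex.log (w + 1)‖ ≤ Real.log (1 + ‖w‖) + Real.pi := by
  have h1 : 1 ≤ ‖w + 1‖ := by
    refine le_trans ?_ (Complex.re_le_norm _)
    simp [hw]
  refine (Complex.norm_le_abs_re_add_abs_im _).trans (add_le_add ?_ ?_)
  · rw [Complex.log_re, abs_of_nonneg (Real.log_nonneg h1)]
    refine Real.log_le_log (by linarith) ?_
    refine (norm_add_le _ _).trans ?_
    rw [norm_one, add_comm]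
  · rw [Complex.log_im]
    exact Complex.abs_arg_le_pi _

/-- A bounded holomorphic function on the right half-plane that decays exponentially on half of the
imaginary axis vanishes. -/
theorem eq_zero_of_exp_decay_half_imaginary_axis {F : ℂ → ℂ} {K C c : ℝ} (hc : 0 < c)
    (hd : DiffContOnCl ℂ F {w | 0 < w.re}) (hK : ∀ w : ℂ, 0 ≤ w.re → ‖F w‖ ≤ K)
    (hdec : ∀ τ : ℝ, 0 < τ → ‖F (τ * Complex.I)‖ ≤ C * Real.exp (-(c * τ))) :
    EqOn F 0 {w : ℂ | 0 ≤ w.re} := by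
  set b : ℝ := c / Real.pi with hb
  have hbpos : 0 < b := div_pos hc Real.pi_pos
  have hK0 : 0 ≤ K := (norm_nonneg _).trans (hK 0 le_rfl)
  -- The linear term shares the decay `e^{-cτ}` evenly between the two halves of the imaginary axis.
  -- The term with `w log(w + 1)` spends it: since `b π/2 = c/2`, it costs at most `e^{c|y|/2}` on
  -- each half, and in return it gives decay like `e^{-b x log(1 + x)}` on the positive real axis.
  set L : ℂ → ℂ := fun w => -(c / 2 * Complex.I) * w - b * (w * Complex.log (w + 1)) with hL
  set H : ℂ → ℂ := fun w => Complex.exp (L w) * F w with hH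
  have hslit : ∀ w : ℂ, 0 ≤ w.re → w + 1 ∈ Complex.slitPlane := fun w hw => by
    left
    simp
    linarith
  have hLd : ∀ w : ℂ, 0 ≤ w.re → DifferentiableAt ℂ L w := fun w hw => by
    have : DifferentiableAt ℂ (fun w : ℂ => Complex.log (w + 1)) w :=
      (by fun_prop : DifferentiableAt ℂ (fun w : ℂ => w + 1) w).clog (hslit w hw)
    fun_prop
  have hcl : closure {w : ℂ | 0 < w.re} = {w : ℂ | 0 ≤ w.re} := Complex.closure_setOfPred_lt_re 0
  have hEd : DiffContOnCl ℂ (fun w => Complex.exp (L w)) {w | 0 < w.re} := by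
    refine DifferentiableOn.diffContOnCl fun w hw => ?_
    rw [hcl] at hw
    exact (hLd w hw).cexp.differentiableWithinAt
  have hHd : DiffContOnCl ℂ H {w | 0 < w.re} := hEd.smul hd
  have hLre : ∀ w : ℂ, (L w).re = c / 2 * w.im - b * (w.re * Real.log ‖w + 1‖ -
      w.im * (w + 1).arg) := fun w => by
    simp only [hL, Complex.sub_re, Complex.mul_re, Complex.neg_re, Complex.neg_im, Complex.mul_im,
      Complex.log_re, Complex.log_im, Complex.ofReal_re, Complex.ofReal_im, Complex.I_re,
      Complex.I_im]
    simp
  have hHn : ∀ w, ‖H w‖ = Real.exp (L w).re * ‖F w‖ := fun w => by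
    rw [hH]
    simp only [norm_mul, Complex.norm_exp]
  have hHzero : EqOn H 0 {w : ℂ | 0 ≤ w.re} := by
    -- Any growth order below `2` is admissible. Here the exponent grows like `r log(1 + r)`, which
    -- `r^{3/2}` dominates.
    refine PhragmenLindelof.eq_zero_on_right_half_plane_of_superexponential_decay hHd
      ⟨3 / 2, by norm_num, c / 2 + b * (2 + Real.pi), ?_⟩ ?_ ⟨max C K, fun y => ?_⟩
    · refine Asymptotics.IsBigO.of_bound K ?_
      rw [eventually_inf_principal]
      filter_upwards [(tendsto_norm_cobounded_atTop (E := ℂ)).eventually_ge_atTop 1] with w hw hre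
      have hre' : 0 ≤ w.re := le_of_lt hre
      rw [hHn, mul_comm K, Real.norm_of_nonneg (Real.exp_pos _).le]
      refine mul_le_mul (Real.exp_le_exp.2 ?_) (hK w hre') (norm_nonneg _) (Real.exp_pos _).le
      set r := ‖w‖ with hr
      have hr0 : 0 < r := by linarith
      have hs : r ^ (3 / 2 : ℝ) = r * Real.sqrt r := by
        rw [Real.sqrt_eq_rpow, ← Real.rpow_one_add' hr0.le (by norm_num)]
        norm_num
      have hsq : 1 ≤ Real.sqrt r := Real.one_le_sqrt.2 hw
      have hlog : Real.log (1 + r) ≤ 2 * Real.sqrt r := by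
        have h1 : 1 + r ≤ (1 + Real.sqrt r) ^ 2 := by
          have := Real.sq_sqrt hr0.le
          nlinarith
        calc Real.log (1 + r) ≤ Real.log ((1 + Real.sqrt r) ^ 2) :=
              Real.log_le_log (by linarith) h1
          _ = 2 * Real.log (1 + Real.sqrt r) := by rw [Real.log_pow]; norm_num
          _ ≤ 2 * Real.sqrt r := by
              have := Real.log_le_sub_one_of_pos (by linarith : 0 < 1 + Real.sqrt r)
              linarith
      have h2 : (L w).re ≤ c / 2 * r + b * (r * (Real.log (1 + r) + Real.pi)) := by
        refine (Complex.re_le_norm _).trans ((norm_sub_le _ _).trans ?_)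
        have e1 : ‖-((c : ℂ) / 2 * Complex.I) * w‖ = c / 2 * r := by
          rw [norm_mul, norm_neg, norm_mul, Complex.norm_I, norm_div, Complex.norm_real,
            Real.norm_of_nonneg hc.le]
          simp [hr]
        rw [e1, norm_mul, norm_mul, Complex.norm_real, Real.norm_of_nonneg hbpos.le]
        have := Complex.norm_log_add_one_le_of_re_nonneg hre'
        gcongr
      refine h2.trans ?_
      rw [hs]
      have h3 : r ≤ r * Real.sqrt r := le_mul_of_one_le_right hr0.le hsq
      have h4 : Real.log (1 + r) + Real.pi ≤ (2 + Real.pi) * Real.sqrt r := by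
        nlinarith [Real.pi_pos]
      calc c / 2 * r + b * (r * (Real.log (1 + r) + Real.pi))
          ≤ c / 2 * (r * Real.sqrt r) + b * (r * ((2 + Real.pi) * Real.sqrt r)) := by gcongr
        _ = _ := by ring
    · intro n
      have hlim : Tendsto (fun x : ℝ => (n - b * Real.log (1 + x)) * x) atTop atBot := by
        refine Tendsto.atBot_mul_atTop₀ ?_ tendsto_id
        refine tendsto_atBot_add_const_left _ _ (tendsto_neg_atTop_atBot.comp
          ((Real.tendsto_log_atTop.comp (tendsto_atTop_add_const_left _ 1 tendsto_id)).const_mul_atTop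
            hbpos))
      have h1 := (Real.tendsto_exp_atBot.comp hlim).mul_const K
      rw [zero_mul] at h1
      refine squeeze_zero' (Eventually.of_forall fun x => by positivity) ?_ h1
      filter_upwards [eventually_ge_atTop 0] with x hx
      rw [hHn, hLre, ← mul_assoc, ← Real.exp_nat_mul, ← Real.exp_add]
      have hn : ‖(x : ℂ) + 1‖ = 1 + x := by
        rw [← Complex.ofReal_one, ← Complex.ofReal_add, Complex.norm_real,
          Real.norm_of_nonneg (by linarith), add_comm]
      refine mul_le_mul (Real.exp_le_exp.2 (le_of_eq ?_)) (hK _ (by simpa using hx)) (norm_nonneg _)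
        (Real.exp_pos _).le
      rw [hn]
      simp
      ring
    · rw [hHn, hLre]
      have harg : |((y * Complex.I : ℂ) + 1).arg| ≤ Real.pi / 2 :=
        Complex.abs_arg_le_pi_div_two_iff.2 (by simp)
      have h1 : y * ((y * Complex.I : ℂ) + 1).arg ≤ |y| * (Real.pi / 2) := by
        refine (le_abs_self _).trans ?_
        rw [abs_mul]
        gcongr
      have h2 : c / 2 * ((y : ℂ) * Complex.I).im - b * (((y : ℂ) * Complex.I).re *
          Real.log ‖(y : ℂ) * Complex.I + 1‖ - ((y : ℂ) * Complex.I).im *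
          ((y * Complex.I : ℂ) + 1).arg) ≤ c / 2 * y + c / 2 * |y| := by
        simp
        have h3 := mul_le_mul_of_nonneg_left h1 hbpos.le
        have h4 : b * (|y| * (Real.pi / 2)) = c / 2 * |y| := by
          rw [hb]; field_simp
        linarith
      rcases le_or_gt y 0 with hy | hy
      · rw [abs_of_nonpos hy] at h2
        refine le_trans ?_ (le_max_right _ _)
        have := mul_le_mul (Real.exp_le_one_iff.2 (h2.trans (by linarith)))
          (hK (y * Complex.I) (by simp)) (norm_nonneg _) zero_le_one
        rwa [one_mul] at this
      · rw [abs_of_pos hy] at h2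
        refine le_trans ?_ (le_max_left _ _)
        have := mul_le_mul (Real.exp_le_exp.2 h2) (hdec y hy) (norm_nonneg _) (Real.exp_pos _).le
        refine this.trans (le_of_eq ?_)
        rw [mul_left_comm, ← Real.exp_add]
        ring_nf
        simp
  intro w hw
  have := hHzero hw
  simp only [hH, Pi.zero_apply, mul_eq_zero, Complex.exp_ne_zero, false_or] at this
  exact this

end HalfPlane

/-! ### The off-diagonal coefficient as a boundary value of a Laplace transform -/

section OffDiagonal

/-- The off-diagonal convolution kernel. -/
noncomputable def offKernel (σ t : ℝ) : ℂ :=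
  Complex.exp ((4 * Real.pi * σ / Real.tanh (t / 2) : ℝ) * Complex.I) / (Real.cosh (t / 2) : ℂ)

theorem measurable_offKernel (σ : ℝ) : Measurable (offKernel σ) := by
  have h : Measurable Real.tanh := by
    have : Real.tanh = fun t => Real.sinh t / Real.cosh t := by
      funext t; rw [Real.tanh_eq_sinh_div_cosh]
    rw [this]
    fun_prop
  unfold offKernel
  fun_prop

theorem norm_offKernel (σ t : ℝ) : ‖offKernel σ t‖ = 1 / Real.cosh (t / 2) := by
  rw [offKernel, norm_div, Complex.norm_exp_ofReal_mul_I, Complex.norm_real,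
    Real.norm_of_nonneg (Real.cosh_pos _).le]

theorem integrableOn_offKernel (σ : ℝ) : IntegrableOn (offKernel σ) (Ioi 0) := by
  refine Integrable.mono' integrableOn_one_div_cosh_half
    (measurable_offKernel σ).aestronglyMeasurable (ae_of_all _ fun t => (norm_offKernel σ t).le)

/-- The Laplace transform of the off-diagonal kernel. -/
noncomputable def offLaplace (σ : ℝ) (w : ℂ) : ℂ :=
  ∫ t in Ioi (0 : ℝ), Complex.exp (-(2 * Real.pi * t * w)) * offKernel σ t

theorem norm_exp_neg_two_pi_mul (t : ℝ) (w : ℂ) :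
    ‖Complex.exp (-(2 * Real.pi * t * w))‖ = Real.exp (-(2 * Real.pi * t * w.re)) := by
  rw [Complex.norm_exp]
  congr 1
  have : (2 * Real.pi * t * w : ℂ) = ((2 * Real.pi * t : ℝ) : ℂ) * w := by push_cast; ring
  rw [this, Complex.neg_re, Complex.re_ofReal_mul]

theorem norm_offLaplace_le (σ : ℝ) {w : ℂ} (hw : 0 ≤ w.re) :
    ‖offLaplace σ w‖ ≤ ∫ t in Ioi (0 : ℝ), 1 / Real.cosh (t / 2) := by
  refine norm_integral_le_of_norm_le integrableOn_one_div_cosh_half ?_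
  filter_upwards [ae_restrict_mem measurableSet_Ioi] with t ht
  rw [norm_mul, norm_offKernel, norm_exp_neg_two_pi_mul]
  refine mul_le_of_le_one_left (by positivity) (Real.exp_le_one_iff.2 ?_)
  have ht' : (0 : ℝ) < t := ht
  have : 0 ≤ 2 * Real.pi * t * w.re := by positivity
  linarith

/-- The kernel decays like `e^{-t/2}`, so the integral still converges slightly to the left of the
imaginary axis, and the boundary points are interior to the domain of holomorphy. -/
theorem differentiableAt_offLaplace (σ : ℝ) {w : ℂ} (hw : 0 ≤ w.re) :
    DifferentiableAt ℂ (offLaplace σ) w := by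
  have hk := measurable_offKernel σ
  have hm : ∀ w : ℂ, AEStronglyMeasurable
      (fun t : ℝ => Complex.exp (-(2 * Real.pi * t * w)) * offKernel σ t)
      (volume.restrict (Ioi 0)) := fun w => by
    have : Measurable (fun t : ℝ => Complex.exp (-(2 * Real.pi * t * w)) * offKernel σ t) := by
      fun_prop
    exact this.aestronglyMeasurable
  -- This radius costs a factor `e^{t/8}`, and the factor `t` from differentiation costs another;
  -- `e^{-t/4}` remains of the decay `e^{-t/2}`.
  have hδ : 0 < 1 / (16 * Real.pi) := by positivity
  have hball : ∀ z ∈ Metric.ball w (1 / (16 * Real.pi)), -(1 / (16 * Real.pi)) ≤ z.re := by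
    intro z hz
    rw [mem_ball_iff_norm] at hz
    have := (Complex.abs_re_le_norm (z - w)).trans hz.le
    rw [Complex.sub_re] at this
    linarith [(abs_le.1 this).1]
  have hint : IntegrableOn (fun t : ℝ => 2 * Real.pi * (16 * Real.exp (-t / 4))) (Ioi 0) :=
    (integrableOn_exp_neg_quarter.const_mul 16).const_mul _
  refine (hasDerivAt_integral_of_dominated_loc_of_deriv_le (x₀ := w)
    (Metric.ball_mem_nhds w hδ) (Eventually.of_forall hm)
    (F' := fun w t => Complex.exp (-(2 * Real.pi * t * w)) * -(2 * Real.pi * t) * offKernel σ t)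
    ?_ ?_ (bound := fun t => 2 * Real.pi * (16 * Real.exp (-t / 4))) ?_
    hint ?_).2.differentiableAt
  · refine Integrable.mono' integrableOn_one_div_cosh_half (hm w) ?_
    filter_upwards [ae_restrict_mem measurableSet_Ioi] with t ht
    rw [norm_mul, norm_offKernel, norm_exp_neg_two_pi_mul]
    refine mul_le_of_le_one_left (by positivity) (Real.exp_le_one_iff.2 ?_)
    have ht' : (0 : ℝ) < t := ht
    have : 0 ≤ 2 * Real.pi * t * w.re := by positivity
    linarith
  · have : Measurable (fun t : ℝ => Complex.exp (-(2 * Real.pi * t * w)) * -(2 * Real.pi * t) *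
      offKernel σ t) := by fun_prop
    exact this.aestronglyMeasurable
  · filter_upwards [ae_restrict_mem measurableSet_Ioi] with t ht z hz
    have ht' : (0 : ℝ) < t := ht
    rw [norm_mul, norm_mul, norm_offKernel, norm_exp_neg_two_pi_mul, norm_neg]
    have e : ‖(2 * Real.pi * t : ℂ)‖ = 2 * Real.pi * t := by
      rw [← Complex.ofReal_ofNat, ← Complex.ofReal_mul, ← Complex.ofReal_mul, Complex.norm_real,
        Real.norm_of_nonneg (by positivity)]
    rw [e]
    have h1 : Real.exp (-(2 * Real.pi * t * z.re)) ≤ Real.exp (t / 8) := by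
      refine Real.exp_le_exp.2 ?_
      have := mul_le_mul_of_nonneg_left (hball z hz) (by positivity : 0 ≤ 2 * Real.pi * t)
      have e2 : 2 * Real.pi * t * -(1 / (16 * Real.pi)) = -(t / 8) := by field_simp; norm_num
      linarith
    have h2 : t ≤ 8 * Real.exp (t / 8) := by
      have := Real.add_one_le_exp (t / 8)
      linarith
    calc Real.exp (-(2 * Real.pi * t * z.re)) * (2 * Real.pi * t) * (1 / Real.cosh (t / 2))
        ≤ Real.exp (t / 8) * (2 * Real.pi * (8 * Real.exp (t / 8))) * (2 * Real.exp (-t / 2)) := by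
          gcongr
          exact one_div_cosh_half_le t
      _ = 2 * Real.pi * (16 * (Real.exp (t / 8) * Real.exp (t / 8) * Real.exp (-t / 2))) := by ring
      _ = _ := by
          rw [← Real.exp_add, ← Real.exp_add]
          ring_nf
  · refine ae_of_all _ fun t z _ => ?_
    have h := (((hasDerivAt_id z).const_mul (2 * Real.pi * t : ℂ)).neg.cexp).mul_const (offKernel σ t)
    convert! h using 1
    simp

/-- The off-diagonal kernel extended by zero. -/
noncomputable def offKernelExt (σ : ℝ) : ℝ → ℂ := (Ioi (0 : ℝ)).indicator (offKernel σ)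

theorem integrable_offKernelExt (σ : ℝ) : Integrable (offKernelExt σ) :=
  (integrable_indicator_iff measurableSet_Ioi).2 (integrableOn_offKernel σ)

open FourierTransform in
theorem fourier_offKernelExt (σ τ : ℝ) :
    𝓕 (offKernelExt σ) τ = offLaplace σ (τ * Complex.I) := by
  rw [Real.fourier_real_eq_integral_exp_smul, offLaplace, ← integral_indicator measurableSet_Ioi]
  refine integral_congr_ae (ae_of_all _ fun t => ?_)
  simp only [offKernelExt]
  by_cases ht : t ∈ Ioi (0 : ℝ)
  · simp only [ht, indicator_of_mem, smul_eq_mul]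
    congr 2
    push_cast
    ring
  · simp [ht]

open FourierTransform in
theorem coeffOffDiag_eq (σ τ : ℝ) :
    coeffOffDiag σ τ = Complex.I / (4 * Real.pi) * 𝓕 (offKernelExt σ) τ := by
  rw [fourier_offKernelExt, coeffOffDiag, offLaplace]
  congr 1
  refine integral_congr_ae (ae_of_all _ fun t => ?_)
  simp only [offKernel]
  rw [← mul_div_assoc, ← Complex.exp_add]
  congr 2
  push_cast
  ring

theorem norm_I_div_four_pi : ‖Complex.I / (4 * Real.pi)‖ = 1 / (4 * Real.pi) := by
  rw [norm_div, Complex.norm_I, norm_mul, Complex.norm_real, Real.norm_of_nonneg Real.pi_pos.le]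
  simp

open FourierTransform in
/-- The off-diagonal coefficient does not decay exponentially. -/
theorem not_exp_decay_coeffOffDiag (σ : ℝ) {C c : ℝ} (hc : 0 < c) :
    ¬ ∀ τ : ℝ, 0 < τ → ‖coeffOffDiag σ τ‖ ≤ C * Real.exp (-(c * τ)) := by
  intro h
  have hzero : EqOn (offLaplace σ) 0 {w : ℂ | 0 ≤ w.re} := by
    refine eq_zero_of_exp_decay_half_imaginary_axis (C := 4 * Real.pi * C) hc ?_
      (fun w hw => norm_offLaplace_le σ hw) fun τ hτ => ?_
    · refine DifferentiableOn.diffContOnCl fun w hw => ?_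
      rw [Complex.closure_setOfPred_lt_re 0] at hw
      exact (differentiableAt_offLaplace σ hw).differentiableWithinAt
    · have h1 := h τ hτ
      rw [coeffOffDiag_eq, fourier_offKernelExt, norm_mul, norm_I_div_four_pi, one_div,
        inv_mul_le_iff₀ (by positivity)] at h1
      rw [mul_assoc (4 * Real.pi)]
      exact h1
  have hF : 𝓕 (offKernelExt σ) = 0 := by
    funext τ
    rw [fourier_offKernelExt]
    exact hzero (by simp)
  -- Fourier inversion at `1`, away from the discontinuity at `0`, would give the value `0` there,
  -- whereas the kernel has modulus `1 / cosh(1/2)`.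
  have hcont : ContinuousAt (offKernelExt σ) 1 := by
    have h1 : offKernelExt σ =ᶠ[𝓝 1] offKernel σ := by
      filter_upwards [Ioi_mem_nhds zero_lt_one] with t ht
      exact indicator_of_mem ht _
    refine ContinuousAt.congr ?_ h1.symm
    have h2 : offKernel σ = fun t : ℝ => Complex.exp ((4 * Real.pi * σ / (Real.sinh (t / 2) /
      Real.cosh (t / 2)) : ℝ) * Complex.I) / (Real.cosh (t / 2) : ℂ) := by
      funext t
      rw [offKernel, Real.tanh_eq_sinh_div_cosh]
    rw [h2]
    have h3 : Real.sinh (1 / 2) / Real.cosh (1 / 2) ≠ 0 :=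
      (div_pos (Real.sinh_pos_iff.2 (by norm_num)) (Real.cosh_pos _)).ne'
    have h4 : Real.cosh (1 / 2) ≠ 0 := (Real.cosh_pos _).ne'
    have h5 : (Real.cosh (1 / 2) : ℂ) ≠ 0 := by exact_mod_cast h4
    fun_prop (disch := assumption)
  have hinv := (integrable_offKernelExt σ).fourierInv_fourier_eq
    (by rw [hF]; exact integrable_zero _ _ _) hcont
  rw [hF] at hinv
  have h6 : offKernelExt σ 1 = offKernel σ 1 := indicator_of_mem (mem_Ioi.2 zero_lt_one) _
  have h7 := norm_offKernel σ 1
  rw [← h6, ← hinv, Real.fourierInv_eq] at h7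
  simp at h7
  exact (Real.cosh_pos _).ne h7

/-- The characteristic polynomial at `1` equals `1 - a₁₁ - |a₁₂|²`, so this forces an eigenvalue
above `1`. Otherwise `|a₁₂|² ≤ 1 - a₁₁` decays like `e^{-2πτ}`, and `a₁₂` would decay like
`e^{-πτ}`. -/
theorem exists_one_lt_coeffDiag_add (σ : ℝ) :
    ∃ τ, 1 < coeffDiag σ τ + ‖coeffOffDiag σ τ‖ ^ 2 := by
  by_contra! h
  obtain ⟨C, hC⟩ := exists_one_sub_coeffDiag_le σ
  refine not_exp_decay_coeffOffDiag σ (C := Real.sqrt C) Real.pi_pos fun τ _ => ?_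
  have h1 : ‖coeffOffDiag σ τ‖ ^ 2 ≤ C * Real.exp (-(2 * Real.pi * τ)) := by
    linarith [h τ, hC τ]
  have h2 : Real.exp (-(2 * Real.pi * τ)) = Real.exp (-(Real.pi * τ)) ^ 2 := by
    rw [← Real.exp_nat_mul]
    push_cast
    ring_nf
  have hC0 : 0 ≤ C := by
    by_contra! hneg
    nlinarith [sq_nonneg ‖coeffOffDiag σ τ‖, Real.exp_pos (-(2 * Real.pi * τ))]
  rw [← sq_le_sq₀ (norm_nonneg _) (by positivity), mul_pow, Real.sq_sqrt hC0, ← h2]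
  exact h1

theorem exists_coeffOffDiag_ne_zero (σ : ℝ) : ∃ τ, coeffOffDiag σ τ ≠ 0 := by
  by_contra! h
  refine not_exp_decay_coeffOffDiag σ (C := 0) one_pos fun τ _ => ?_
  rw [h τ]
  simp

open FourierTransform in
theorem continuous_coeffOffDiag (σ : ℝ) : Continuous (coeffOffDiag σ) := by
  have hcont : Continuous (𝓕 (offKernelExt σ)) :=
    VectorFourier.fourierIntegral_continuous Real.continuous_fourierChar
      (by fun_prop) (integrable_offKernelExt σ)
  have : coeffOffDiag σ = fun τ => Complex.I / (4 * Real.pi) * 𝓕 (offKernelExt σ) τ :=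
    funext (coeffOffDiag_eq σ)
  rw [this]
  exact continuous_const.mul hcont

theorem exists_norm_coeffOffDiag_le (σ : ℝ) : ∃ C, ∀ τ, ‖coeffOffDiag σ τ‖ ≤ C := by
  refine ⟨1 / (4 * Real.pi) * ∫ t in Ioi (0 : ℝ), 1 / Real.cosh (t / 2), fun τ => ?_⟩
  rw [coeffOffDiag_eq, norm_mul, norm_I_div_four_pi, fourier_offKernelExt]
  gcongr
  exact norm_offLaplace_le σ (by simp)

end OffDiagonal

/-! ### Decay of Fourier transforms from two derivatives -/

section FourierDecay

open FourierTransform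

/-- Quadratic decay of the Fourier transform of a twice differentiable function. -/
theorem norm_fourier_mul_le {f f' f'' : ℝ → ℂ} (hf : ∀ x, HasDerivAt f (f' x) x)
    (hf' : ∀ x, HasDerivAt f' (f'' x) x) (i0 : Integrable f) (i1 : Integrable f')
    (i2 : Integrable f'') (ξ : ℝ) :
    (1 + ξ ^ 2) * ‖𝓕 f ξ‖ ≤ (∫ x, ‖f x‖) + ∫ x, ‖f'' x‖ := by
  have e1 : deriv f = f' := funext fun x => (hf x).deriv
  have e2 : deriv f' = f'' := funext fun x => (hf' x).deriv
  have h1 := congrFun (Real.fourier_deriv i0 (fun x => (hf x).differentiableAt) (by rwa [e1])) ξ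
  have h2 := congrFun (Real.fourier_deriv i1 (fun x => (hf' x).differentiableAt) (by rwa [e2])) ξ
  rw [e1] at h1
  rw [e2, h1, smul_smul] at h2
  have hb0 : ‖𝓕 f ξ‖ ≤ ∫ x, ‖f x‖ := VectorFourier.norm_fourierIntegral_le_integral_norm _ _ _ _ _
  have hb2 : ‖𝓕 f'' ξ‖ ≤ ∫ x, ‖f'' x‖ :=
    VectorFourier.norm_fourierIntegral_le_integral_norm _ _ _ _ _
  have h3 : ‖𝓕 f'' ξ‖ = (2 * Real.pi * |ξ|) ^ 2 * ‖𝓕 f ξ‖ := by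
    rw [h2, norm_smul, norm_mul]
    have : ‖(2 * Real.pi * Complex.I * ξ : ℂ)‖ = 2 * Real.pi * |ξ| := by
      rw [norm_mul, norm_mul, norm_mul, Complex.norm_I, Complex.norm_real, Complex.norm_real,
        Real.norm_of_nonneg Real.pi_pos.le]
      simp
    rw [this]
    ring
  have h4 : ξ ^ 2 ≤ (2 * Real.pi * |ξ|) ^ 2 := by
    rw [mul_pow, sq_abs]
    have : 1 ≤ (2 * Real.pi) ^ 2 := by nlinarith [Real.pi_gt_three]
    nlinarith [sq_nonneg ξ]
  have h5 : ξ ^ 2 * ‖𝓕 f ξ‖ ≤ ‖𝓕 f'' ξ‖ := by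
    rw [h3]
    gcongr
  linarith

end FourierDecay

/-! ### Schwartz estimates for the products `f(x + z/2) g(x - z/2)` -/

section SchwartzBounds

theorem SchwartzMap.exists_norm_le_inv_sq (f : 𝓢(ℝ, ℂ)) :
    ∃ C, 0 ≤ C ∧ ∀ x : ℝ, ‖f x‖ ≤ C * ((1 + x ^ 2) ^ 2)⁻¹ := by
  obtain ⟨C, hC⟩ : ∃ C, ∀ x : ℝ, (1 + ‖x‖) ^ 4 * ‖f x‖ ≤ C := ⟨_, fun x => by
    simpa using SchwartzMap.one_add_le_sup_seminorm_apply (𝕜 := ℝ) (m := (4, 0)) (k := 4) (n := 0)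
      le_rfl le_rfl f x⟩
  refine ⟨C, (by positivity : (0 : ℝ) ≤ (1 + ‖(0 : ℝ)‖) ^ 4 * ‖f 0‖).trans (hC 0), fun x => ?_⟩
  rw [← div_eq_mul_inv, le_div_iff₀ (by positivity), mul_comm]
  refine le_trans ?_ (hC x)
  gcongr
  have h1 : 1 + x ^ 2 ≤ (1 + ‖x‖) ^ 2 := by
    rw [Real.norm_eq_abs, ← sq_abs x]
    nlinarith [abs_nonneg x]
  calc (1 + x ^ 2) ^ 2 ≤ ((1 + ‖x‖) ^ 2) ^ 2 := by gcongr
    _ = _ := by ring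

/-- The complex conjugate of a Schwartz function. -/
noncomputable def SchwartzMap.star' (f : 𝓢(ℝ, ℂ)) : 𝓢(ℝ, ℂ) :=
  f.postcompCLM (𝕜 := ℝ) (Complex.conjCLE : ℂ →L[ℝ] ℂ)

theorem SchwartzMap.star'_apply (f : 𝓢(ℝ, ℂ)) (x : ℝ) : f.star' x = conj (f x) := rfl

/-- The derivative of a Schwartz function, as a Schwartz function. -/
noncomputable abbrev SchwartzMap.der (f : 𝓢(ℝ, ℂ)) : 𝓢(ℝ, ℂ) := SchwartzMap.derivCLM ℝ ℂ f

theorem SchwartzMap.hasDerivAt_der (f : 𝓢(ℝ, ℂ)) (x : ℝ) : HasDerivAt f (f.der x) x :=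
  f.hasDerivAt x

/-- The product `f(x + z/2) g(x - z/2)`. -/
noncomputable def cross (f g : 𝓢(ℝ, ℂ)) (x z : ℝ) : ℂ := f (x + z / 2) * g (x - z / 2)

theorem continuous_cross (f g : 𝓢(ℝ, ℂ)) : Continuous fun p : ℝ × ℝ => cross f g p.1 p.2 := by
  have hf := f.continuous
  have hg := g.continuous
  unfold cross
  fun_prop

theorem hasDerivAt_cross (f g : 𝓢(ℝ, ℂ)) (x z : ℝ) :
    HasDerivAt (cross f g x) ((1 / 2 : ℂ) * cross f.der g x z - (1 / 2 : ℂ) * cross f g.der x z)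
      z := by
  have h1 : HasDerivAt (fun z : ℝ => x + z / 2) (1 / 2) z :=
    ((hasDerivAt_id z).div_const 2).const_add x
  have h2 : HasDerivAt (fun z : ℝ => x - z / 2) (-(1 / 2)) z :=
    ((hasDerivAt_id z).div_const 2).const_sub x
  have h := ((f.hasDerivAt_der (x + z / 2)).scomp z h1).mul
    ((g.hasDerivAt_der (x - z / 2)).scomp z h2)
  convert! h using 1
  simp only [cross, Complex.real_smul, Function.comp_apply]
  push_cast
  ring

/-- For `a = x + z/2` and `b = x - z/2` the product `(1 + a²)(1 + b²)` dominates both `1 + x²` and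
`(1 + z²)/2`. Having its square available, one may spend both factors on `x`, or one on each
variable. -/
theorem exists_norm_cross_le (f g : 𝓢(ℝ, ℂ)) : ∃ C, 0 ≤ C ∧ ∀ x z : ℝ,
    ‖cross f g x z‖ ≤ C * ((1 + x ^ 2) ^ 2)⁻¹ ∧
    ‖cross f g x z‖ ≤ C * ((1 + x ^ 2)⁻¹ * (1 + z ^ 2)⁻¹) := by
  obtain ⟨A, hA, hf⟩ := f.exists_norm_le_inv_sq
  obtain ⟨B, hB, hg⟩ := g.exists_norm_le_inv_sq
  refine ⟨2 * (A * B), by positivity, fun x z => ?_⟩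
  set a := x + z / 2 with ha
  set b := x - z / 2 with hb
  have h1 : ‖cross f g x z‖ ≤ A * B * (((1 + a ^ 2) * (1 + b ^ 2)) ^ 2)⁻¹ := by
    rw [cross, norm_mul, mul_pow, mul_inv]
    calc _ ≤ (A * ((1 + a ^ 2) ^ 2)⁻¹) * (B * ((1 + b ^ 2) ^ 2)⁻¹) :=
          mul_le_mul (hf a) (hg b) (norm_nonneg _) (by positivity)
      _ = _ := by ring
  have e : (1 + a ^ 2) * (1 + b ^ 2) = 1 + 2 * x ^ 2 + z ^ 2 / 2 + (x ^ 2 - z ^ 2 / 4) ^ 2 := by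
    rw [ha, hb]; ring
  have l1 : 1 + x ^ 2 ≤ (1 + a ^ 2) * (1 + b ^ 2) := by
    rw [e]; nlinarith [sq_nonneg x, sq_nonneg z, sq_nonneg (x ^ 2 - z ^ 2 / 4)]
  have l2 : (1 + z ^ 2) / 2 ≤ (1 + a ^ 2) * (1 + b ^ 2) := by
    rw [e]; nlinarith [sq_nonneg x, sq_nonneg z, sq_nonneg (x ^ 2 - z ^ 2 / 4)]
  constructor
  · refine h1.trans ?_
    have : (((1 + a ^ 2) * (1 + b ^ 2)) ^ 2)⁻¹ ≤ ((1 + x ^ 2) ^ 2)⁻¹ := by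
      gcongr
    have h3 : 0 ≤ ((1 + x ^ 2) ^ 2)⁻¹ := by positivity
    have h4 : 0 ≤ A * B := by positivity
    nlinarith
  · refine h1.trans ?_
    have h5 : (((1 + a ^ 2) * (1 + b ^ 2)) ^ 2)⁻¹ ≤ ((1 + x ^ 2) * ((1 + z ^ 2) / 2))⁻¹ := by
      refine inv_anti₀ (by positivity) ?_
      rw [sq ((1 + a ^ 2) * (1 + b ^ 2))]
      exact mul_le_mul l1 l2 (by positivity) (by positivity)
    calc _ ≤ A * B * ((1 + x ^ 2) * ((1 + z ^ 2) / 2))⁻¹ := by gcongr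
      _ = _ := by rw [mul_inv, inv_div]; ring

theorem integrable_const_mul_inv_one_add_sq (C : ℝ) :
    Integrable fun z : ℝ => C * (1 + z ^ 2)⁻¹ := integrable_inv_one_add_sq.const_mul C

theorem inv_one_add_sq_le_one (x : ℝ) : (1 + x ^ 2)⁻¹ ≤ 1 :=
  inv_le_one_of_one_le₀ (by nlinarith [sq_nonneg x])

theorem integrable_cross (f g : 𝓢(ℝ, ℂ)) (x : ℝ) : Integrable (cross f g x) := by
  obtain ⟨C, hC, h⟩ := exists_norm_cross_le f g
  have hc : Continuous (cross f g x) := (continuous_cross f g).comp (by fun_prop : Continuous fun z : ℝ => (x, z))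
  refine Integrable.mono' (integrable_const_mul_inv_one_add_sq (C * (1 + x ^ 2)⁻¹))
    hc.aestronglyMeasurable (ae_of_all _ fun z => ((h x z).2).trans_eq (by ring))

theorem integral_norm_cross_le (f g : 𝓢(ℝ, ℂ)) : ∃ C, 0 ≤ C ∧ ∀ x : ℝ,
    ∫ z, ‖cross f g x z‖ ≤ C * (1 + x ^ 2)⁻¹ := by
  obtain ⟨C, hC, h⟩ := exists_norm_cross_le f g
  refine ⟨C * Real.pi, by positivity, fun x => ?_⟩
  calc _ ≤ ∫ z, (C * (1 + x ^ 2)⁻¹) * (1 + z ^ 2)⁻¹ :=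
        integral_mono (integrable_cross f g x).norm (integrable_const_mul_inv_one_add_sq _)
          fun z => ((h x z).2).trans_eq (by ring)
    _ = _ := by rw [integral_const_mul, integral_univ_inv_one_add_sq]; ring

end SchwartzBounds

/-! ### Integrability of the Wigner distribution and slicing of the region -/

section Wigner

open FourierTransform

theorem wigner_eq_fourier (u v : 𝓢(ℝ, ℂ)) (p : ℝ × ℝ) :
    wigner u v p = 𝓕 (cross u v.star' p.1) p.2 := by
  rw [Real.fourier_real_eq_integral_exp_smul, wigner]
  refine integral_congr_ae (ae_of_all _ fun z => ?_)
  simp only [cross, SchwartzMap.star'_apply, smul_eq_mul]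
  rw [mul_assoc]
  congr 2
  push_cast
  ring

/-- Derivatives in `z` of a cross product are combinations of cross products of derivatives, so two
of them buy decay in `ξ` without losing the decay in `x`. Absolute integrability on the plane
follows. -/
theorem exists_norm_fourier_cross_le (f g : 𝓢(ℝ, ℂ)) : ∃ C, 0 ≤ C ∧ ∀ x ξ : ℝ,
    ‖𝓕 (cross f g x) ξ‖ ≤ C * ((1 + x ^ 2)⁻¹ * (1 + ξ ^ 2)⁻¹) := by
  obtain ⟨C0, hC0, h0⟩ := integral_norm_cross_le f g
  obtain ⟨C1, hC1, h1⟩ := integral_norm_cross_le f.der.der g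
  obtain ⟨C2, hC2, h2⟩ := integral_norm_cross_le f.der g.der
  obtain ⟨C3, hC3, h3⟩ := integral_norm_cross_le f g.der.der
  refine ⟨C0 + (C1 + C2 + C3), by positivity, fun x ξ => ?_⟩
  have d1 := fun z => hasDerivAt_cross f g x z
  have d2 : ∀ z, HasDerivAt (fun z => (1 / 2 : ℂ) * cross f.der g x z - (1 / 2 : ℂ) * cross f g.der x z)
      ((1 / 4 : ℂ) * cross f.der.der g x z - (1 / 2 : ℂ) * cross f.der g.der x z +
        (1 / 4 : ℂ) * cross f g.der.der x z) z := fun z => by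
    have := ((hasDerivAt_cross f.der g x z).const_mul (1 / 2 : ℂ)).sub
      ((hasDerivAt_cross f g.der x z).const_mul (1 / 2 : ℂ))
    convert! this using 1
    ring
  have i1 := integrable_cross f.der.der g x
  have i2 := integrable_cross f.der g.der x
  have i3 := integrable_cross f g.der.der x
  have key := norm_fourier_mul_le d1 d2 (integrable_cross f g x)
    (((integrable_cross f.der g x).const_mul _).sub ((integrable_cross f g.der x).const_mul _))
    (((i1.const_mul _).sub (i2.const_mul _)).add (i3.const_mul _)) ξ
  have hb : ∫ z, ‖(1 / 4 : ℂ) * cross f.der.der g x z - (1 / 2 : ℂ) * cross f.der g.der x z +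
        (1 / 4 : ℂ) * cross f g.der.der x z‖ ≤ (C1 + C2 + C3) * (1 + x ^ 2)⁻¹ := by
    calc _ ≤ ∫ z, (‖cross f.der.der g x z‖ + ‖cross f.der g.der x z‖ + ‖cross f g.der.der x z‖) := by
          refine integral_mono_of_nonneg (ae_of_all _ fun z => norm_nonneg _)
            ((i1.norm.add i2.norm).add i3.norm) (ae_of_all _ fun z => ?_)
          refine (norm_add_le _ _).trans (add_le_add ((norm_sub_le _ _).trans (add_le_add ?_ ?_)) ?_)
          all_goals
            rw [norm_mul]
            refine mul_le_of_le_one_left (norm_nonneg _) ?_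
            norm_num
      _ = (∫ z, ‖cross f.der.der g x z‖) + (∫ z, ‖cross f.der g.der x z‖) +
            ∫ z, ‖cross f g.der.der x z‖ := by
          rw [← integral_add i1.norm i2.norm]
          exact integral_add (i1.norm.add i2.norm) i3.norm
      _ ≤ _ := by linarith [h1 x, h2 x, h3 x]
  have : (1 + ξ ^ 2) * ‖𝓕 (cross f g x) ξ‖ ≤ (C0 + (C1 + C2 + C3)) * (1 + x ^ 2)⁻¹ := by
    linarith [h0 x]
  rw [← mul_assoc, ← div_eq_mul_inv _ (1 + ξ ^ 2), le_div_iff₀ (by positivity), mul_comm]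
  exact this

theorem continuous_wigner (u v : 𝓢(ℝ, ℂ)) : Continuous (wigner u v) := by
  obtain ⟨C, hC, h⟩ := exists_norm_cross_le u v.star'
  have hc := continuous_cross u v.star'
  have e : wigner u v = fun p : ℝ × ℝ =>
      ∫ z, Complex.exp (↑(-2 * Real.pi * z * p.2) * Complex.I) • cross u v.star' p.1 z := by
    funext p
    rw [wigner_eq_fourier, Real.fourier_real_eq_integral_exp_smul]
  rw [e]
  refine continuous_of_dominated (bound := fun z => C * (1 + z ^ 2)⁻¹) (fun p => ?_)
    (fun p => ae_of_all _ fun z => ?_) (integrable_const_mul_inv_one_add_sq C)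
    (ae_of_all _ fun z => ?_)
  · have h2 : Continuous (cross u v.star' p.1) :=
      hc.comp (by fun_prop : Continuous fun z : ℝ => (p.1, z))
    have : Continuous fun z : ℝ => Complex.exp (↑(-2 * Real.pi * z * p.2) * Complex.I) •
      cross u v.star' p.1 z := by fun_prop
    exact this.aestronglyMeasurable
  · rw [norm_smul, Complex.norm_exp_ofReal_mul_I, one_mul]
    refine (h p.1 z).2.trans ?_
    gcongr
    exact mul_le_of_le_one_left (by positivity) (inv_one_add_sq_le_one _)
  · have h2 : Continuous fun p : ℝ × ℝ => cross u v.star' p.1 z :=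
      hc.comp (by fun_prop : Continuous fun p : ℝ × ℝ => (p.1, z))
    fun_prop

theorem integrable_wigner (u v : 𝓢(ℝ, ℂ)) : Integrable (wigner u v) := by
  obtain ⟨C, hC, h⟩ := exists_norm_fourier_cross_le u v.star'
  refine Integrable.mono' ((integrable_inv_one_add_sq.mul_prod integrable_inv_one_add_sq).const_mul C)
    (continuous_wigner u v).aestronglyMeasurable (ae_of_all _ fun p => ?_)
  rw [wigner_eq_fourier]
  exact h p.1 p.2

theorem measurableSet_hyperbolicRegion (σ : ℝ) : MeasurableSet (hyperbolicRegion σ) :=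
  (measurableSet_le measurable_const measurable_fst).inter
    (measurableSet_le measurable_const (measurable_fst.mul measurable_snd))

theorem indicator_mul_wigner (σ : ℝ) (u v : 𝓢(ℝ, ℂ)) :
    (fun p => (hyperbolicRegion σ).indicator (fun _ => (1 : ℂ)) p * wigner u v p) =
      (hyperbolicRegion σ).indicator (wigner u v) := by
  funext p
  by_cases hp : p ∈ hyperbolicRegion σ <;> simp [hp]

theorem integrable_indicator_mul_wigner (σ : ℝ) (u v : 𝓢(ℝ, ℂ)) :
    Integrable fun p => (hyperbolicRegion σ).indicator (fun _ => (1 : ℂ)) p * wigner u v p := by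
  rw [indicator_mul_wigner]
  exact (integrable_wigner u v).indicator (measurableSet_hyperbolicRegion σ)

/-- Fubini: the slice of the region is `ξ ≥ σ / x` for `x > 0` and empty for `x < 0`; the line `x =
0` is null. -/
theorem integral_indicator_mul_wigner (σ : ℝ) (u v : 𝓢(ℝ, ℂ)) :
    ∫ p, (hyperbolicRegion σ).indicator (fun _ => (1 : ℂ)) p * wigner u v p =
      ∫ x in Ioi (0 : ℝ), ∫ ξ in Ioi (σ / x), 𝓕 (cross u v.star' x) ξ := by
  have hi := integrable_indicator_mul_wigner σ u v
  rw [indicator_mul_wigner] at hi ⊢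
  rw [Measure.volume_eq_prod, integral_prod _ hi, ← integral_indicator measurableSet_Ioi]
  refine integral_congr_ae ?_
  filter_upwards [compl_mem_ae_iff.2 (measure_singleton (0 : ℝ))] with x hx
  have hx : x ≠ 0 := hx
  rcases lt_or_gt_of_ne hx with hx | hx
  · have h1 : ∀ y, (x, y) ∉ hyperbolicRegion σ := fun y h => not_le.2 hx h.1
    simp only [indicator_of_notMem (h1 _), integral_zero]
    rw [indicator_of_notMem]
    exact fun h => lt_asymm hx h
  · rw [indicator_of_mem (mem_Ioi.2 hx), ← integral_Ici_eq_integral_Ioi,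
      ← integral_indicator measurableSet_Ici]
    refine integral_congr_ae (ae_of_all _ fun y => ?_)
    have h1 : (x, y) ∈ hyperbolicRegion σ ↔ y ∈ Ici (σ / x) := by
      simp only [hyperbolicRegion, Set.mem_ofPred_eq, mem_Ici, div_le_iff₀ hx, mul_comm y x]
      exact ⟨fun h => h.2, fun h => ⟨hx.le, h⟩⟩
    by_cases hy : y ∈ Ici (σ / x)
    · simp only [indicator_of_mem hy, indicator_of_mem (h1.2 hy), wigner_eq_fourier]
    · simp only [indicator_of_notMem hy, indicator_of_notMem (mt h1.1 hy)]

end Wigner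

/-! ### Half-line integrals of Fourier transforms -/

section HalfLine

open FourierTransform

theorem integral_eq_integral_Ioi_add_neg {f : ℝ → ℂ} (hf : Integrable f) :
    ∫ x, f x = ∫ x in Ioi (0 : ℝ), (f x + f (-x)) := by
  rw [integral_add hf.integrableOn hf.comp_neg.integrableOn, integral_comp_neg_Ioi, neg_zero,
    add_comm, ← setIntegral_union (Iic_disjoint_Ioi le_rfl) measurableSet_Ioi
      hf.integrableOn hf.integrableOn, Iic_union_Ioi, setIntegral_univ]

theorem fourier_sub_fourier_neg {g : ℝ → ℂ} (hg : Integrable g) (ξ : ℝ) :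
    𝓕 g ξ - 𝓕 g (-ξ) = -2 * Complex.I *
      ∫ z in Ioi (0 : ℝ), (Real.sin (2 * Real.pi * z * ξ) : ℂ) * (g z - g (-z)) := by
  have hint : ∀ η : ℝ, Integrable fun z : ℝ =>
      Complex.exp (↑(-2 * Real.pi * z * η) * Complex.I) • g z := fun η => by
    refine hg.norm.mono' ?_ (ae_of_all _ fun z => ?_)
    · have : Continuous fun z : ℝ => Complex.exp (↑(-2 * Real.pi * z * η) * Complex.I) := by
        fun_prop
      exact this.aestronglyMeasurable.smul hg.aestronglyMeasurable
    · rw [norm_smul, Complex.norm_exp_ofReal_mul_I, one_mul]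
  rw [Real.fourier_real_eq_integral_exp_smul, Real.fourier_real_eq_integral_exp_smul,
    ← integral_sub (hint ξ) (hint (-ξ)), ← integral_const_mul]
  refine (integral_eq_integral_Ioi_add_neg ((hint ξ).sub (hint (-ξ)))).trans ?_
  refine integral_congr_ae (ae_of_all _ fun z => ?_)
  have h : ∀ x : ℝ, Complex.exp (x * Complex.I) = Real.cos x + Real.sin x * Complex.I := fun x => by
    rw [Complex.exp_mul_I, Complex.ofReal_cos, Complex.ofReal_sin]
  simp only [Pi.sub_apply, h, smul_eq_mul]
  have e1 : -2 * Real.pi * z * ξ = -(2 * Real.pi * z * ξ) := by ring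
  have e2 : -2 * Real.pi * z * -ξ = 2 * Real.pi * z * ξ := by ring
  have e3 : -2 * Real.pi * -z * ξ = 2 * Real.pi * z * ξ := by ring
  have e4 : -2 * Real.pi * -z * -ξ = -(2 * Real.pi * z * ξ) := by ring
  rw [e1, e2, e3, e4, Real.sin_neg, Real.cos_neg]
  push_cast
  ring

theorem integral_sin_mul_right {z : ℝ} (hz : z ≠ 0) (R : ℝ) :
    ∫ ξ in (0 : ℝ)..R, Real.sin (2 * Real.pi * z * ξ) =
      (1 - Real.cos (2 * Real.pi * z * R)) / (2 * Real.pi * z) := by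
  have h : (2 * Real.pi * z) ≠ 0 := by have := Real.pi_pos; positivity
  rw [intervalIntegral.integral_comp_mul_left (fun x => Real.sin x) h, integral_sin]
  simp
  ring

/-- Cutting at `R` makes Fubini available for the sine transform; integrating the sine in `ξ`
produces `(1 - cos) / z`. -/
theorem integral_fourier_sub_fourier_neg {g : ℝ → ℂ} (hg : Integrable g)
    (hq : IntegrableOn (fun z => (g z - g (-z)) / z) (Ioi 0)) {R : ℝ} (hR : 0 ≤ R) :
    ∫ ξ in (0 : ℝ)..R, (𝓕 g ξ - 𝓕 g (-ξ)) = -Complex.I / Real.pi *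
      ((∫ z in Ioi (0 : ℝ), (g z - g (-z)) / z) -
        ∫ z in Ioi (0 : ℝ), (Real.cos (2 * Real.pi * z * R) : ℂ) * ((g z - g (-z)) / z)) := by
  have hd : IntegrableOn (fun z => g z - g (-z)) (Ioi 0) := (hg.sub hg.comp_neg).integrableOn
  have hc : IntegrableOn (fun z : ℝ => (Real.cos (2 * Real.pi * z * R) : ℂ) *
      ((g z - g (-z)) / z)) (Ioi 0) := by
    refine hq.norm.mono' ?_ (ae_of_all _ fun z => ?_)
    · exact (Continuous.aestronglyMeasurable (by fun_prop)).mul hq.aestronglyMeasurable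
    · rw [norm_mul, Complex.norm_real]
      exact mul_le_of_le_one_left (norm_nonneg _) (Real.abs_cos_le_one _)
  simp_rw [fourier_sub_fourier_neg hg]
  rw [intervalIntegral.integral_const_mul, ← integral_sub hq hc,
    intervalIntegral_integral_swap]
  · rw [← integral_const_mul, ← integral_const_mul]
    refine setIntegral_congr_fun measurableSet_Ioi fun z hz => ?_
    have hz : z ≠ 0 := (mem_Ioi.1 hz).ne'
    have hz' : (z : ℂ) ≠ 0 := by exact_mod_cast hz
    have hp : (Real.pi : ℂ) ≠ 0 := by exact_mod_cast Real.pi_ne_zero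
    rw [intervalIntegral.integral_mul_const, intervalIntegral.integral_ofReal,
      integral_sin_mul_right hz]
    push_cast
    field_simp
  · rw [uIoc_of_le hR]
    have h1 : Integrable (fun p : ℝ × ℝ => (1 : ℂ) * (g p.2 - g (-p.2)))
        ((volume.restrict (Ioc 0 R)).prod (volume.restrict (Ioi 0))) :=
      (integrable_const (1 : ℂ)).mul_prod hd
    refine h1.norm.mono' ?_ (ae_of_all _ fun p => ?_)
    · have := h1.aestronglyMeasurable
      simp only [one_mul] at this
      exact (Continuous.aestronglyMeasurable (by fun_prop)).mul this
    · simp only [Function.uncurry, norm_mul, Complex.norm_real, norm_one]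
      exact mul_le_mul_of_nonneg_right (Real.abs_sin_le_one _) (norm_nonneg _)

/-- The integral of a Fourier transform over a half-line, as a principal value. -/
theorem integral_Ioi_fourier {g : ℝ → ℂ} (hc : Continuous g) (hg : Integrable g)
    (hF : Integrable (𝓕 g)) (hq : IntegrableOn (fun z => (g z - g (-z)) / z) (Ioi 0)) :
    ∫ ξ in Ioi (0 : ℝ), 𝓕 g ξ = 1 / 2 * g 0 +
      1 / (2 * Real.pi * Complex.I) * ∫ z in Ioi (0 : ℝ), (g z - g (-z)) / z := by
  -- The half-line integral is half the sum of an even and an odd contribution. The even one is `g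
  -- 0` by inversion; the odd one is a limit of cut-off integrals whose cosine term dies by
  -- Riemann–Lebesgue.
  have h1 : Tendsto (fun R => ∫ ξ in (0 : ℝ)..R, (𝓕 g ξ - 𝓕 g (-ξ))) atTop
      (𝓝 (∫ ξ in Ioi (0 : ℝ), (𝓕 g ξ - 𝓕 g (-ξ)))) :=
    intervalIntegral_tendsto_integral_Ioi 0 (hF.sub hF.comp_neg).integrableOn tendsto_id
  have h2 : Tendsto (fun R => ∫ ξ in (0 : ℝ)..R, (𝓕 g ξ - 𝓕 g (-ξ))) atTop
      (𝓝 (-Complex.I / Real.pi * ((∫ z in Ioi (0 : ℝ), (g z - g (-z)) / z) - 0))) := by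
    refine ((tendsto_const_nhds.sub (tendsto_integral_Ioi_cos_mul hq)).const_mul _).congr' ?_
    filter_upwards [eventually_ge_atTop 0] with R hR
    exact (integral_fourier_sub_fourier_neg hg hq hR).symm
  have h3 := tendsto_nhds_unique h1 h2
  rw [sub_zero, integral_sub hF.integrableOn hF.comp_neg.integrableOn] at h3
  have h4 : ∫ ξ, 𝓕 g ξ = g 0 := by
    have := congrFun (hc.fourierInv_fourier_eq hg hF) 0
    rw [← this, Real.fourierInv_eq]
    simp
  rw [integral_eq_integral_Ioi_add_neg hF,
    integral_add hF.integrableOn hF.comp_neg.integrableOn] at h4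
  have h5 : 1 / (2 * Real.pi * Complex.I) = -Complex.I / (2 * Real.pi) := by
    have hp : (Real.pi : ℂ) ≠ 0 := by exact_mod_cast Real.pi_ne_zero
    field_simp
    simp
  rw [h5, ← h4]
  linear_combination (1 / 2 : ℂ) * h3

end HalfLine

/-! ### Joint integrability of the scaled difference quotient -/

section CrossQuotient

theorem norm_exp_neg_sub_exp_le (θ : ℝ) :
    ‖Complex.exp (-(θ * Complex.I)) - Complex.exp (θ * Complex.I)‖ ≤ 2 * |θ| := by
  have h : Complex.exp (-(θ * Complex.I)) - Complex.exp (θ * Complex.I) =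
      -(2 * Complex.I * (Real.sin θ : ℂ)) := by
    rw [← neg_mul, Complex.exp_mul_I, Complex.exp_mul_I, Complex.ofReal_sin, Complex.cos_neg,
      Complex.sin_neg]
    ring
  rw [h, norm_neg, norm_mul, norm_mul, Complex.norm_I, Complex.norm_real, Complex.norm_ofNat,
    mul_one]
  exact mul_le_mul_of_nonneg_left Real.abs_sin_le_abs (by norm_num)

theorem exists_norm_cross_sub_le (f g : 𝓢(ℝ, ℂ)) : ∃ C, 0 ≤ C ∧ ∀ x z : ℝ,
    ‖cross f g x z - cross f g x (-z)‖ ≤ C * ((1 + x ^ 2) ^ 2)⁻¹ * |z| := by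
  obtain ⟨A, hA, h1⟩ := exists_norm_cross_le f.der g
  obtain ⟨B, hB, h2⟩ := exists_norm_cross_le f g.der
  refine ⟨A + B, by positivity, fun x z => ?_⟩
  have h := convex_univ.norm_image_sub_le_of_norm_hasDerivWithin_le (𝕜 := ℝ)
    (C := (1 / 2) * ((A + B) * ((1 + x ^ 2) ^ 2)⁻¹))
    (fun y _ => (hasDerivAt_cross f g x y).hasDerivWithinAt) (fun y _ => ?_)
    (mem_univ (-z)) (mem_univ z)
  · refine h.trans_eq ?_
    have : ‖z - -z‖ = 2 * |z| := by
      rw [sub_neg_eq_add, ← two_mul, norm_mul, Real.norm_two, Real.norm_eq_abs]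
    rw [this]
    ring
  · refine (norm_sub_le _ _).trans ?_
    rw [norm_mul, norm_mul]
    have e : ‖(1 / 2 : ℂ)‖ = 1 / 2 := by norm_num
    rw [e]
    linarith [(h1 x y).1, (h2 x y).1]

/-- The difference quotient of the modulated cross function, in the scaled variable. -/
noncomputable def crossQuot (σ : ℝ) (f g : 𝓢(ℝ, ℂ)) (x w : ℝ) : ℂ :=
  (Complex.exp (-((2 * Real.pi * σ * w : ℝ) * Complex.I)) * cross f g x (x * w) -
    Complex.exp ((2 * Real.pi * σ * w : ℝ) * Complex.I) * cross f g x (x * -w)) / w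

theorem measurable_crossQuot (σ : ℝ) (f g : 𝓢(ℝ, ℂ)) :
    Measurable fun p : ℝ × ℝ => crossQuot σ f g p.1 p.2 := by
  have h1 : Continuous fun p : ℝ × ℝ => cross f g p.1 (p.1 * p.2) :=
    (continuous_cross f g).comp (by fun_prop : Continuous fun p : ℝ × ℝ => (p.1, p.1 * p.2))
  have h2 : Continuous fun p : ℝ × ℝ => cross f g p.1 (p.1 * -p.2) :=
    (continuous_cross f g).comp (by fun_prop : Continuous fun p : ℝ × ℝ => (p.1, p.1 * -p.2))
  unfold crossQuot
  refine Measurable.div (Continuous.measurable ?_) (by fun_prop)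
  fun_prop

/-- The bound to be used near `w = 0`: the increment of the cross function is `O(x w)` and that of
the exponential `O(w)`, which cancels the denominator. The stray factor `x` is absorbed by the extra
decay in `x`. -/
theorem exists_norm_crossQuot_le_of_le_one (σ : ℝ) (f g : 𝓢(ℝ, ℂ)) : ∃ C, 0 ≤ C ∧
    ∀ x w : ℝ, 0 < x → 0 < w → ‖crossQuot σ f g x w‖ ≤ C * (1 + x ^ 2)⁻¹ := by
  obtain ⟨A, hA, h1⟩ := exists_norm_cross_sub_le f g
  obtain ⟨B, hB, h2⟩ := exists_norm_cross_le f g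
  refine ⟨A + 4 * Real.pi * |σ| * B, by positivity, fun x w hx hw => ?_⟩
  have hd : ∀ a b c d : ℂ, a * c - b * d = a * (c - d) + (a - b) * d := fun a b c d => by ring
  rw [crossQuot, norm_div, Complex.norm_real, Real.norm_of_nonneg hw.le, div_le_iff₀ hw, hd]
  refine (norm_add_le _ _).trans ?_
  rw [norm_mul, norm_mul, ← neg_mul, ← Complex.ofReal_neg, Complex.norm_exp_ofReal_mul_I, one_mul]
  have e1 := h1 x (x * w)
  rw [← mul_neg, abs_of_pos (mul_pos hx hw)] at e1
  have e2 := norm_exp_neg_sub_exp_le (2 * Real.pi * σ * w)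
  rw [← neg_mul, ← Complex.ofReal_neg] at e2
  have e3 : |2 * Real.pi * σ * w| = 2 * Real.pi * |σ| * w := by
    rw [abs_mul, abs_mul, abs_mul, abs_of_pos hw, abs_of_pos Real.pi_pos, abs_two]
  rw [e3] at e2
  have e4 := (h2 x (x * -w)).1
  have e5 : ((1 + x ^ 2) ^ 2)⁻¹ ≤ (1 + x ^ 2)⁻¹ :=
    inv_anti₀ (by positivity) (by nlinarith [sq_nonneg x])
  have e6 : ((1 + x ^ 2) ^ 2)⁻¹ * x ≤ (1 + x ^ 2)⁻¹ := by
    rw [sq, mul_inv, mul_assoc]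
    refine mul_le_of_le_one_right (by positivity) ?_
    rw [inv_mul_le_iff₀ (by positivity)]
    nlinarith [sq_nonneg (x - 1)]
  calc _ ≤ A * ((1 + x ^ 2) ^ 2)⁻¹ * (x * w) +
        2 * (2 * Real.pi * |σ| * w) * (B * ((1 + x ^ 2) ^ 2)⁻¹) :=
        add_le_add e1 (mul_le_mul e2 e4 (norm_nonneg _) (by positivity))
    _ = (A * (((1 + x ^ 2) ^ 2)⁻¹ * x) + 4 * Real.pi * |σ| * B * ((1 + x ^ 2) ^ 2)⁻¹) * w := by ring
    _ ≤ (A * (1 + x ^ 2)⁻¹ + 4 * Real.pi * |σ| * B * (1 + x ^ 2)⁻¹) * w := by gcongr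
    _ = _ := by ring

/-- An integrable majorant on the half-line. -/
noncomputable def sqrtMajorant (x : ℝ) : ℝ :=
  (Ioc (0 : ℝ) 1).indicator (fun x => x ^ (-1 / 2 : ℝ)) x + (1 + x ^ 2)⁻¹

theorem integrable_sqrtMajorant : Integrable sqrtMajorant := by
  refine Integrable.add ?_ integrable_inv_one_add_sq
  rw [integrable_indicator_iff measurableSet_Ioc, ← intervalIntegrable_iff_integrableOn_Ioc_of_le
    zero_le_one]
  exact intervalIntegral.intervalIntegrable_rpow' (by norm_num)

theorem inv_one_add_sq_le_sqrtMajorant (x : ℝ) : (1 + x ^ 2)⁻¹ ≤ sqrtMajorant x := by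
  refine le_add_of_nonneg_left (indicator_nonneg (fun x hx => ?_) _)
  exact Real.rpow_nonneg hx.1.le _

theorem rpow_mul_inv_one_add_sq_le_sqrtMajorant {x : ℝ} (hx : 0 < x) :
    x ^ (-1 / 2 : ℝ) * (1 + x ^ 2)⁻¹ ≤ sqrtMajorant x := by
  have h0 : 0 < x ^ (-1 / 2 : ℝ) := Real.rpow_pos_of_pos hx _
  have h1 : 0 ≤ (1 + x ^ 2)⁻¹ := by positivity
  rw [sqrtMajorant]
  rcases le_or_gt x 1 with h | h
  · rw [indicator_of_mem (mem_Ioc.2 ⟨hx, h⟩)]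
    nlinarith [mul_le_of_le_one_right h0.le (inv_one_add_sq_le_one x)]
  · rw [indicator_of_notMem (fun h' => not_le.2 h h'.2), zero_add]
    refine mul_le_of_le_one_left h1 ?_
    exact Real.rpow_le_one_of_one_le_of_nonpos h.le (by norm_num)

theorem inv_one_add_sq_le_rpow {a : ℝ} (ha : 0 < a) : (1 + a ^ 2)⁻¹ ≤ a ^ (-1 / 2 : ℝ) := by
  have e : (-1 / 2 : ℝ) = -(1 / 2) := by norm_num
  rw [e, Real.rpow_neg ha.le, ← Real.sqrt_eq_rpow]
  refine inv_anti₀ (Real.sqrt_pos.2 ha) ?_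
  rw [Real.sqrt_le_left (by positivity)]
  nlinarith [sq_nonneg (a - 1), sq_nonneg a, sq_nonneg (a ^ 2)]

/-- The bound to be used for large `w`. Weakening `(1 + (xw)²)⁻¹` to `(xw)^{-1/2}` separates the
variables: `w^{-3/2}` is integrable at infinity, and `x^{-1/2}` at `0`. -/
theorem exists_norm_crossQuot_le_of_one_lt (σ : ℝ) (f g : 𝓢(ℝ, ℂ)) : ∃ C, 0 ≤ C ∧
    ∀ x w : ℝ, 0 < x → 0 < w →
      ‖crossQuot σ f g x w‖ ≤ C * (sqrtMajorant x * w ^ (-3 / 2 : ℝ)) := by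
  obtain ⟨B, hB, h2⟩ := exists_norm_cross_le f g
  refine ⟨2 * B, by positivity, fun x w hx hw => ?_⟩
  rw [crossQuot, norm_div, Complex.norm_real, Real.norm_of_nonneg hw.le, div_le_iff₀ hw]
  refine (norm_sub_le _ _).trans ?_
  rw [norm_mul, norm_mul, ← neg_mul, ← Complex.ofReal_neg, Complex.norm_exp_ofReal_mul_I,
    Complex.norm_exp_ofReal_mul_I, one_mul, one_mul]
  have e1 := (h2 x (x * w)).2
  have e2 := (h2 x (x * -w)).2
  rw [show (x * -w) ^ 2 = (x * w) ^ 2 by ring] at e2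
  have e3 : (1 + x ^ 2)⁻¹ * (1 + (x * w) ^ 2)⁻¹ ≤ sqrtMajorant x * w ^ (-1 / 2 : ℝ) := by
    calc _ ≤ (1 + x ^ 2)⁻¹ * (x * w) ^ (-1 / 2 : ℝ) := by
          gcongr
          exact inv_one_add_sq_le_rpow (mul_pos hx hw)
      _ = (x ^ (-1 / 2 : ℝ) * (1 + x ^ 2)⁻¹) * w ^ (-1 / 2 : ℝ) := by
          rw [Real.mul_rpow hx.le hw.le]; ring
      _ ≤ _ := mul_le_mul_of_nonneg_right (rpow_mul_inv_one_add_sq_le_sqrtMajorant hx)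
          (Real.rpow_nonneg hw.le _)
  have e4 : w ^ (-3 / 2 : ℝ) * w = w ^ (-1 / 2 : ℝ) := by
    rw [← Real.rpow_add_one hw.ne']
    norm_num
  rw [mul_assoc (2 * B), mul_assoc (sqrtMajorant x), e4]
  calc _ ≤ 2 * B * ((1 + x ^ 2)⁻¹ * (1 + (x * w) ^ 2)⁻¹) := by linarith
    _ ≤ _ := by gcongr

theorem integrable_crossQuot (σ : ℝ) (f g : 𝓢(ℝ, ℂ)) :
    Integrable (fun p : ℝ × ℝ => crossQuot σ f g p.1 p.2)
      ((volume.restrict (Ioi 0)).prod (volume.restrict (Ioi 0))) := by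
  obtain ⟨A, hA, h1⟩ := exists_norm_crossQuot_le_of_le_one σ f g
  obtain ⟨B, hB, h2⟩ := exists_norm_crossQuot_le_of_one_lt σ f g
  have i1 : Integrable (fun w : ℝ => (Ioc (0 : ℝ) 1).indicator (fun _ => (1 : ℝ)) w +
      (Ioi (1 : ℝ)).indicator (fun w => w ^ (-3 / 2 : ℝ)) w) (volume.restrict (Ioi 0)) := by
    refine Integrable.integrableOn (Integrable.add ?_ ?_)
    · exact (integrable_indicator_iff measurableSet_Ioc).2 (integrableOn_const (by simp))
    · exact (integrable_indicator_iff measurableSet_Ioi).2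
        (integrableOn_Ioi_rpow_of_lt (by norm_num) one_pos)
  have i2 := (integrable_sqrtMajorant.integrableOn (s := Ioi 0)).mul_prod i1
  refine (i2.const_mul (A + B)).mono' (measurable_crossQuot σ f g).aestronglyMeasurable ?_
  rw [Measure.prod_restrict]
  filter_upwards [ae_restrict_mem (measurableSet_Ioi.prod measurableSet_Ioi)] with p hp
  have hx : 0 < p.1 := hp.1
  have hw : 0 < p.2 := hp.2
  have hm := inv_one_add_sq_le_sqrtMajorant p.1
  have hm0 : 0 ≤ sqrtMajorant p.1 := le_trans (by positivity) hm
  rcases le_or_gt p.2 1 with h | h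
  · rw [indicator_of_mem (mem_Ioc.2 ⟨hw, h⟩), indicator_of_notMem (mt mem_Ioi.1 (not_lt.2 h)),
      add_zero, mul_one]
    refine (h1 p.1 p.2 hx hw).trans ?_
    exact mul_le_mul (le_add_of_nonneg_right hB) hm (by positivity) (by positivity)
  · rw [indicator_of_notMem (fun h' => not_le.2 h h'.2), indicator_of_mem (mem_Ioi.2 h), zero_add]
    refine (h2 p.1 p.2 hx hw).trans ?_
    exact mul_le_mul_of_nonneg_right (le_add_of_nonneg_left hA)
      (mul_nonneg hm0 (Real.rpow_nonneg hw.le _))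

end CrossQuotient

/-! ### The Weyl form as a double integral over dilations -/

section HalfPlane

open FourierTransform

theorem integral_Ioi_comp_add (f : ℝ → ℂ) (c : ℝ) :
    ∫ x in Ioi (0 : ℝ), f (x + c) = ∫ x in Ioi c, f x := by
  have h := (measurePreserving_add_right volume c).setIntegral_preimage_emb
    (MeasurableEquiv.addRight c).measurableEmbedding f (Ioi c)
  rw [← h]
  simp

theorem continuous_fourier_of_integrable {g : ℝ → ℂ} (hg : Integrable g) : Continuous (𝓕 g) :=
  VectorFourier.fourierIntegral_continuous Real.continuous_fourierChar
    (by fun_prop) hg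

theorem integrable_fourier_cross (f g : 𝓢(ℝ, ℂ)) (x : ℝ) : Integrable (𝓕 (cross f g x)) := by
  obtain ⟨C, hC, h⟩ := exists_norm_fourier_cross_le f g
  refine (integrable_const_mul_inv_one_add_sq (C * (1 + x ^ 2)⁻¹)).mono'
    (continuous_fourier_of_integrable (integrable_cross f g x)).aestronglyMeasurable
    (ae_of_all _ fun ξ => (h x ξ).trans_eq (by ring))

theorem fourier_exp_mul (g : ℝ → ℂ) (c ξ : ℝ) :
    𝓕 (fun z : ℝ => Complex.exp (-((2 * Real.pi * z * c : ℝ) * Complex.I)) * g z) ξ =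
      𝓕 g (ξ + c) := by
  rw [Real.fourier_real_eq_integral_exp_smul, Real.fourier_real_eq_integral_exp_smul]
  refine integral_congr_ae (ae_of_all _ fun z => ?_)
  simp only [smul_eq_mul]
  rw [← mul_assoc, ← Complex.exp_add]
  congr 2
  push_cast
  ring

/-- Translating the half-line to start at `0` modulates the cross function by `e^{-2πizσ/x}`. The
scaling `z = x w` frees this phase from `x` and leaves the measure `dz/z` invariant. -/
theorem integral_Ioi_fourier_cross {σ x : ℝ} (f g : 𝓢(ℝ, ℂ)) (hx : 0 < x)
    (hq : IntegrableOn (crossQuot σ f g x) (Ioi 0)) :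
    ∫ ξ in Ioi (σ / x), 𝓕 (cross f g x) ξ = 1 / 2 * (f x * g x) +
      1 / (2 * Real.pi * Complex.I) * ∫ w in Ioi (0 : ℝ), crossQuot σ f g x w := by
  set G : ℝ → ℂ := fun z => Complex.exp (-((2 * Real.pi * z * (σ / x) : ℝ) * Complex.I)) *
    cross f g x z with hG
  have hcc : Continuous (cross f g x) :=
    (continuous_cross f g).comp (by fun_prop : Continuous fun z : ℝ => (x, z))
  have hc : Continuous G := by fun_prop
  have hi : Integrable G := (integrable_cross f g x).norm.mono' hc.aestronglyMeasurable
    (ae_of_all _ fun z => by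
      rw [hG]
      simp only
      rw [norm_mul, ← neg_mul, ← Complex.ofReal_neg, Complex.norm_exp_ofReal_mul_I, one_mul])
  have hF : 𝓕 G = fun ξ => 𝓕 (cross f g x) (ξ + σ / x) := funext fun ξ => fourier_exp_mul _ _ _
  have hs : ∀ w : ℝ, (G (x * w) - G (-(x * w))) / ((x * w : ℝ) : ℂ) =
      (x : ℂ)⁻¹ * crossQuot σ f g x w := fun w => by
    have e1 : 2 * Real.pi * (x * w) * (σ / x) = 2 * Real.pi * σ * w := by field_simp
    have e2 : 2 * Real.pi * -(x * w) * (σ / x) = -(2 * Real.pi * σ * w) := by field_simp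
    simp only [hG, crossQuot]
    rw [e1, e2]
    push_cast
    rw [neg_mul (2 * (Real.pi : ℂ) * σ * w), neg_neg, mul_neg]
    rw [div_eq_mul_inv, div_eq_mul_inv, mul_inv]
    ring
  have hq' : IntegrableOn (fun z => (G z - G (-z)) / z) (Ioi 0) := by
    have h := (integrableOn_Ioi_comp_mul_left_iff (fun z : ℝ => (G z - G (-z)) / z) 0 hx).1
    rw [mul_zero] at h
    refine h ?_
    simp only [hs]
    exact hq.const_mul _
  have h := integral_Ioi_fourier hc hi (by
    rw [hF]; exact (integrable_fourier_cross f g x).comp_add_right _) hq'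
  rw [hF, integral_Ioi_comp_add (𝓕 (cross f g x))] at h
  rw [h]
  have h0 : G 0 = f x * g x := by simp [hG, cross]
  have h1 := integral_comp_mul_left_Ioi' (fun z : ℝ => (G z - G (-z)) / z) 0 hx
  simp only [hs] at h1
  rw [mul_zero, integral_const_mul, Complex.real_smul, ← mul_assoc, mul_inv_cancel₀
    (by exact_mod_cast hx.ne'), one_mul] at h1
  rw [h0, ← h1]

theorem integrable_mul_schwartz (f g : 𝓢(ℝ, ℂ)) : Integrable fun x => f x * g x := by
  obtain ⟨C, hC, h⟩ := exists_norm_cross_le f g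
  refine (integrable_const_mul_inv_one_add_sq C).mono'
    (f.continuous.mul g.continuous).aestronglyMeasurable (ae_of_all _ fun x => ?_)
  have := (h x 0).2
  simpa [cross] using this

theorem integral_indicator_mul_wigner_eq (σ : ℝ) (u v : 𝓢(ℝ, ℂ)) :
    ∫ p, (hyperbolicRegion σ).indicator (fun _ => (1 : ℂ)) p * wigner u v p =
      1 / 2 * (∫ x in Ioi (0 : ℝ), u x * v.star' x) + 1 / (2 * Real.pi * Complex.I) *
        ∫ w in Ioi (0 : ℝ), ∫ x in Ioi (0 : ℝ), crossQuot σ u v.star' x w := by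
  have hQ := integrable_crossQuot σ u v.star'
  rw [integral_indicator_mul_wigner, ← integral_integral_swap hQ, ← integral_const_mul,
    ← integral_const_mul, ← integral_add ((integrable_mul_schwartz u v.star').integrableOn.const_mul _)
      (hQ.integral_prod_left.const_mul _)]
  refine integral_congr_ae ?_
  filter_upwards [hQ.prod_right_ae, ae_restrict_mem measurableSet_Ioi] with x hx1 hx2
  exact integral_Ioi_fourier_cross u v.star' hx2 hx1

theorem integrableOn_integral_crossQuot (σ : ℝ) (f g : 𝓢(ℝ, ℂ)) :
    IntegrableOn (fun w => ∫ x in Ioi (0 : ℝ), crossQuot σ f g x w) (Ioi 0) :=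
  (integrable_crossQuot σ f g).integral_prod_right

/-- The integral of the product of two dilated functions over a half-line. -/
noncomputable def dilatedIntegral (f g : ℝ → ℂ) (a b : ℝ) : ℂ :=
  ∫ x in Ioi (0 : ℝ), f (x * a) * g (x * b)

/-- At `z = x w` the arguments are `x(1 ± w/2)`, so integration in `x` only sees dilates of `f` and
`g`. -/
theorem integral_crossQuot (σ : ℝ) (f g : 𝓢(ℝ, ℂ)) (w : ℝ) :
    ∫ x in Ioi (0 : ℝ), crossQuot σ f g x w =
      (Complex.exp (-((2 * Real.pi * σ * w : ℝ) * Complex.I)) *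
          dilatedIntegral f g (1 + w / 2) (1 - w / 2) -
        Complex.exp ((2 * Real.pi * σ * w : ℝ) * Complex.I) *
          dilatedIntegral f g (1 - w / 2) (1 + w / 2)) / w := by
  obtain ⟨C, hC, h⟩ := exists_norm_cross_le f g
  have hi : ∀ w : ℝ, IntegrableOn (fun x => cross f g x (x * w)) (Ioi 0) := fun w => by
    refine Integrable.integrableOn ((integrable_const_mul_inv_one_add_sq C).mono' ?_
      (ae_of_all _ fun x => (h x (x * w)).2.trans ?_))
    · exact ((continuous_cross f g).comp
        (by fun_prop : Continuous fun x : ℝ => (x, x * w))).aestronglyMeasurable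
    · exact mul_le_mul_of_nonneg_left (mul_le_of_le_one_right (by positivity)
        (inv_one_add_sq_le_one _)) hC
  have e : ∀ w : ℝ, ∫ x in Ioi (0 : ℝ), cross f g x (x * w) =
      dilatedIntegral f g (1 + w / 2) (1 - w / 2) := fun w => by
    rw [dilatedIntegral]
    refine integral_congr_ae (ae_of_all _ fun x => ?_)
    simp only [cross]
    congr 2 <;> ring
  have e2 : dilatedIntegral f g (1 - w / 2) (1 + w / 2) =
      dilatedIntegral f g (1 + -w / 2) (1 - -w / 2) := by
    congr 1 <;> ring
  rw [e2, ← e w, ← e (-w), ← integral_const_mul, ← integral_const_mul,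
    ← integral_sub ((hi w).const_mul _) ((hi (-w)).const_mul _), ← integral_div]
  rfl

end HalfPlane

/-! ### Hyperbolic substitutions and correlations in logarithmic coordinates -/

section Hyperbolic

/-- The correlation of two functions in logarithmic coordinates. -/
noncomputable def logCorr (c d : ℝ) (f g : ℝ → ℂ) (r : ℝ) : ℂ :=
  ∫ s : ℝ, logPull c f (s + r / 2) * logPull d g (s - r / 2)

theorem integral_Ioi_eq_integral_exp (F : ℝ → ℂ) :
    ∫ x in Ioi (0 : ℝ), F x = ∫ s : ℝ, (Real.exp s : ℂ) * F (Real.exp s) := by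
  have h := integral_image_eq_integral_abs_deriv_smul MeasurableSet.univ
    (fun s _ => (Real.hasDerivAt_exp s).hasDerivWithinAt) Real.exp_injective.injOn F
  rw [image_univ, Real.range_exp, Measure.restrict_univ] at h
  rw [h]
  simp only [abs_of_pos (Real.exp_pos _), Complex.real_smul]

/-- The substitution `x = m e^s` turns dilations into translations by `±r/2`. The scale `m` will be
`cosh(r/2)` or `sinh(r/2)`, and the signs `c`, `d` select the half-lines. -/
theorem dilatedIntegral_eq_logCorr (c d : ℝ) (f g : ℝ → ℂ) (r : ℝ) {m : ℝ} (hm : 0 < m) :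
    dilatedIntegral f g (c * Real.exp (r / 2) / m) (d * Real.exp (-r / 2) / m) =
      m * logCorr c d f g r := by
  have h := integral_comp_mul_left_Ioi' (fun x : ℝ =>
    f (x * (c * Real.exp (r / 2) / m)) * g (x * (d * Real.exp (-r / 2) / m))) 0 hm
  rw [mul_zero] at h
  rw [dilatedIntegral, ← h, Complex.real_smul, integral_Ioi_eq_integral_exp, logCorr]
  congr 1
  refine integral_congr_ae (ae_of_all _ fun s => ?_)
  have e1 : m * Real.exp s * (c * Real.exp (r / 2) / m) = c * Real.exp (s + r / 2) := by
    rw [Real.exp_add]; field_simp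
  have e2 : m * Real.exp s * (d * Real.exp (-r / 2) / m) = d * Real.exp (s - r / 2) := by
    rw [sub_eq_add_neg, Real.exp_add, neg_div]; field_simp
  have e3 : Real.exp s = Real.exp ((s + r / 2) / 2) * Real.exp ((s - r / 2) / 2) := by
    rw [← Real.exp_add]; congr 1; ring
  simp only [logPull]
  rw [e1, e2, e3]
  push_cast
  ring

theorem cosh_add_sinh_half (r : ℝ) : Real.cosh (r / 2) + Real.sinh (r / 2) = Real.exp (r / 2) :=
  Real.cosh_add_sinh _

theorem cosh_sub_sinh_half (r : ℝ) : Real.cosh (r / 2) - Real.sinh (r / 2) = Real.exp (-r / 2) := by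
  rw [Real.cosh_sub_sinh, neg_div]

theorem tanh_half_pos {r : ℝ} (hr : 0 < r) : 0 < Real.tanh (r / 2) := by
  rw [Real.tanh_eq_sinh_div_cosh]
  exact div_pos (Real.sinh_pos_iff.2 (half_pos hr)) (Real.cosh_pos _)

theorem injOn_two_mul_tanh_half : InjOn (fun r => 2 * Real.tanh (r / 2)) (Ioi 0) := by
  intro x _ y _ h
  have h1 : Real.tanh (x / 2) = Real.tanh (y / 2) := by simpa using h
  have := congrArg Real.artanh h1
  rw [Real.artanh_tanh, Real.artanh_tanh] at this
  linarith

theorem image_two_mul_tanh_half : (fun r => 2 * Real.tanh (r / 2)) '' Ioi 0 = Ioo 0 2 := by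
  ext w
  constructor
  · rintro ⟨r, hr, rfl⟩
    have hr : 0 < r := hr
    exact ⟨by have := tanh_half_pos hr; simp only; linarith, by
      have := Real.tanh_lt_one (r / 2); simp only; linarith⟩
  · rintro ⟨h0, h2⟩
    have hw : w / 2 ∈ Ioo (0 : ℝ) 1 := ⟨by linarith, by linarith⟩
    refine ⟨2 * Real.artanh (w / 2), ?_, ?_⟩
    · have := Real.artanh_pos hw
      exact mem_Ioi.2 (by linarith)
    · simp only
      rw [mul_div_cancel_left₀ _ two_ne_zero, Real.tanh_artanh ⟨by linarith [hw.1], hw.2⟩]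
      ring

theorem image_two_div_tanh_half : (fun r => 2 / Real.tanh (r / 2)) '' Ioi 0 = Ioi 2 := by
  ext w
  constructor
  · rintro ⟨r, hr, rfl⟩
    have hr : 0 < r := hr
    have h0 := tanh_half_pos hr
    have h1 := Real.tanh_lt_one (r / 2)
    simp only [mem_Ioi]
    rw [lt_div_iff₀ h0]
    linarith
  · intro hw
    have hw : 2 < w := hw
    have hw' : 2 / w ∈ Ioo (0 : ℝ) 1 := ⟨by positivity, by rw [div_lt_one (by linarith)]; exact hw⟩
    refine ⟨2 * Real.artanh (2 / w), ?_, ?_⟩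
    · have := Real.artanh_pos hw'
      exact mem_Ioi.2 (by linarith)
    · simp only
      rw [mul_div_cancel_left₀ _ two_ne_zero, Real.tanh_artanh ⟨by linarith [hw'.1], hw'.2⟩]
      field_simp

theorem hasDerivAt_tanh_half (r : ℝ) :
    HasDerivAt (fun r => Real.tanh (r / 2)) (1 / 2 * (1 / Real.cosh (r / 2) ^ 2)) r := by
  have hc := (Real.cosh_pos (r / 2)).ne'
  have h2 : HasDerivAt (fun r : ℝ => r / 2) (1 / 2) r := (hasDerivAt_id r).div_const 2
  have h := (h2.sinh).div (h2.cosh) hc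
  have e : (fun r : ℝ => Real.tanh (r / 2)) = fun r => Real.sinh (r / 2) / Real.cosh (r / 2) :=
    funext fun r => Real.tanh_eq_sinh_div_cosh _
  rw [e]
  convert! h using 1
  have := Real.cosh_sq (r / 2)
  field_simp
  linarith

theorem hasDerivAt_two_mul_tanh_half (r : ℝ) :
    HasDerivAt (fun r => 2 * Real.tanh (r / 2)) (1 / Real.cosh (r / 2) ^ 2) r := by
  convert! (hasDerivAt_tanh_half r).const_mul 2 using 1
  ring

theorem hasDerivAt_two_div_tanh_half {r : ℝ} (hr : 0 < r) :
    HasDerivAt (fun r => 2 / Real.tanh (r / 2)) (-(1 / Real.sinh (r / 2) ^ 2)) r := by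
  have h0 := (tanh_half_pos hr).ne'
  have hs := (Real.sinh_pos_iff.2 (half_pos hr)).ne'
  have hc := (Real.cosh_pos (r / 2)).ne'
  convert! ((hasDerivAt_tanh_half r).inv h0).const_mul 2 using 1
  rw [Real.tanh_eq_sinh_div_cosh]
  field_simp

theorem integral_Ioo_two_eq (J : ℝ → ℂ) : ∫ w in Ioo (0 : ℝ) 2, J w =
    ∫ r in Ioi (0 : ℝ), ((1 / Real.cosh (r / 2) ^ 2 : ℝ) : ℂ) * J (2 * Real.tanh (r / 2)) := by
  rw [← image_two_mul_tanh_half, integral_image_eq_integral_abs_deriv_smul measurableSet_Ioi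
    (fun r _ => (hasDerivAt_two_mul_tanh_half r).hasDerivWithinAt) injOn_two_mul_tanh_half]
  refine integral_congr_ae (ae_of_all _ fun r => ?_)
  simp only
  rw [abs_of_pos (by have := Real.cosh_pos (r / 2); positivity), Complex.real_smul]

theorem integral_Ioi_two_eq (J : ℝ → ℂ) : ∫ w in Ioi (2 : ℝ), J w =
    ∫ r in Ioi (0 : ℝ), ((1 / Real.sinh (r / 2) ^ 2 : ℝ) : ℂ) * J (2 / Real.tanh (r / 2)) := by
  have hinj : InjOn (fun r => 2 / Real.tanh (r / 2)) (Ioi 0) := by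
    intro x hx y hy h
    refine injOn_two_mul_tanh_half hx hy ?_
    have h1 := (tanh_half_pos hx).ne'
    have h2 := (tanh_half_pos hy).ne'
    simp only at h ⊢
    field_simp at h
    rw [h]
  rw [← image_two_div_tanh_half, integral_image_eq_integral_abs_deriv_smul measurableSet_Ioi
    (fun r hr => (hasDerivAt_two_div_tanh_half hr).hasDerivWithinAt) hinj]
  refine integral_congr_ae (ae_of_all _ fun r => ?_)
  simp only
  rw [abs_neg, abs_of_nonneg (by positivity), Complex.real_smul]

/-- The break at `w = 2` is where `1 - w/2` changes sign. -/
theorem integral_Ioi_eq_hyperbolic {J : ℝ → ℂ} (hJ : IntegrableOn J (Ioi 0)) :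
    ∫ w in Ioi (0 : ℝ), J w =
      (∫ r in Ioi (0 : ℝ), ((1 / Real.cosh (r / 2) ^ 2 : ℝ) : ℂ) * J (2 * Real.tanh (r / 2))) +
        ∫ r in Ioi (0 : ℝ), ((1 / Real.sinh (r / 2) ^ 2 : ℝ) : ℂ) * J (2 / Real.tanh (r / 2)) := by
  have hsplit : Ioi (0 : ℝ) = Ioc 0 2 ∪ Ioi 2 := (Ioc_union_Ioi_eq_Ioi (by norm_num)).symm
  rw [← integral_Ioo_two_eq, ← integral_Ioi_two_eq, ← integral_Ioc_eq_integral_Ioo]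
  rw [hsplit] at hJ ⊢
  exact setIntegral_union (Ioc_disjoint_Ioi le_rfl) measurableSet_Ioi hJ.left_of_union
    hJ.right_of_union

/-- Rests on `1 ± tanh(r/2) = e^{±r/2} / cosh(r/2)`: both functions are seen on the positive
half-line. -/
theorem integral_crossQuot_two_mul_tanh (σ : ℝ) (f g : 𝓢(ℝ, ℂ)) {r : ℝ} (hr : 0 < r) :
    ((1 / Real.cosh (r / 2) ^ 2 : ℝ) : ℂ) *
        (∫ x in Ioi (0 : ℝ), crossQuot σ f g x (2 * Real.tanh (r / 2))) =
      (Complex.exp (-((diagPhase σ r : ℝ) * Complex.I)) * logCorr 1 1 f g r -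
        Complex.exp ((diagPhase σ r : ℝ) * Complex.I) * logCorr 1 1 f g (-r)) /
          ((2 * Real.sinh (r / 2) : ℝ) : ℂ) := by
  have hs := (Real.sinh_pos_iff.2 (half_pos hr)).ne'
  have hc := Real.cosh_pos (r / 2)
  have hc' := hc.ne'
  have e1 : 1 + 2 * Real.tanh (r / 2) / 2 = 1 * Real.exp (r / 2) / Real.cosh (r / 2) := by
    rw [← cosh_add_sinh_half, Real.tanh_eq_sinh_div_cosh]; field_simp
  have e2 : 1 - 2 * Real.tanh (r / 2) / 2 = 1 * Real.exp (-r / 2) / Real.cosh (r / 2) := by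
    rw [← cosh_sub_sinh_half, Real.tanh_eq_sinh_div_cosh]; field_simp
  have e3 : 2 * Real.pi * σ * (2 * Real.tanh (r / 2)) = diagPhase σ r := by rw [diagPhase]; ring
  have h1 := dilatedIntegral_eq_logCorr 1 1 f g r hc
  have h2 := dilatedIntegral_eq_logCorr 1 1 f g (-r) hc
  rw [neg_neg] at h2
  rw [integral_crossQuot, e1, e2, e3, h1, h2, Real.tanh_eq_sinh_div_cosh]
  have hs' : (Real.sinh (r / 2) : ℂ) ≠ 0 := by exact_mod_cast hs
  have hc'' : (Real.cosh (r / 2) : ℂ) ≠ 0 := by exact_mod_cast hc'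
  push_cast at hs' hc'' ⊢
  field_simp

/-- Rests on `1 ± coth(r/2) = ±e^{±r/2} / sinh(r/2)`: the two functions are seen on opposite
half-lines, which is the off-diagonal interaction. -/
theorem integral_crossQuot_two_div_tanh (σ : ℝ) (f g : 𝓢(ℝ, ℂ)) {r : ℝ} (hr : 0 < r) :
    ((1 / Real.sinh (r / 2) ^ 2 : ℝ) : ℂ) *
        (∫ x in Ioi (0 : ℝ), crossQuot σ f g x (2 / Real.tanh (r / 2))) =
      1 / 2 * (conj (offKernel σ r) * logCorr 1 (-1) f g r -
        offKernel σ r * logCorr (-1) 1 f g (-r)) := by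
  have hs := Real.sinh_pos_iff.2 (half_pos hr)
  have hs0 := hs.ne'
  have hc := Real.cosh_pos (r / 2)
  have hc' := hc.ne'
  have e1 : 1 + 2 / Real.tanh (r / 2) / 2 = 1 * Real.exp (r / 2) / Real.sinh (r / 2) := by
    rw [← cosh_add_sinh_half, Real.tanh_eq_sinh_div_cosh]; field_simp; ring
  have e2 : 1 - 2 / Real.tanh (r / 2) / 2 = -1 * Real.exp (-r / 2) / Real.sinh (r / 2) := by
    rw [← cosh_sub_sinh_half, Real.tanh_eq_sinh_div_cosh]; field_simp; ring
  have e3 : 2 * Real.pi * σ * (2 / Real.tanh (r / 2)) = 4 * Real.pi * σ / Real.tanh (r / 2) := by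
    ring
  have h1 := dilatedIntegral_eq_logCorr 1 (-1) f g r hs
  have h2 := dilatedIntegral_eq_logCorr (-1) 1 f g (-r) hs
  rw [neg_neg] at h2
  have e4 : conj (offKernel σ r) = Complex.exp (-((4 * Real.pi * σ / Real.tanh (r / 2) : ℝ) *
      Complex.I)) / (Real.cosh (r / 2) : ℂ) := by
    rw [offKernel, map_div₀, ← Complex.exp_conj, map_mul, Complex.conj_ofReal, Complex.conj_I,
      Complex.conj_ofReal, mul_neg]
  rw [integral_crossQuot, e1, e2, e3, h1, h2, e4, offKernel]
  have e5 : ((2 / Real.tanh (r / 2) : ℝ) : ℂ) =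
      2 * (Real.cosh (r / 2) : ℂ) / (Real.sinh (r / 2) : ℂ) := by
    rw [Real.tanh_eq_sinh_div_cosh]
    push_cast
    rw [div_div_eq_mul_div]
  rw [e5]
  have hs' : (Real.sinh (r / 2) : ℂ) ≠ 0 := by exact_mod_cast hs0
  have hc'' : (Real.cosh (r / 2) : ℂ) ≠ 0 := by exact_mod_cast hc'
  generalize Complex.exp _ = a
  generalize Complex.exp _ = b
  rw [Complex.ofReal_div, Complex.ofReal_pow, Complex.ofReal_one]
  field_simp

/-- The Weyl form of the hyperbolic region in logarithmic coordinates. -/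
theorem integral_indicator_mul_wigner_eq_logCorr (σ : ℝ) (u v : 𝓢(ℝ, ℂ)) :
    ∫ p, (hyperbolicRegion σ).indicator (fun _ => (1 : ℂ)) p * wigner u v p =
      1 / 2 * logCorr 1 1 u v.star' 0 + 1 / (2 * Real.pi * Complex.I) *
        ((∫ r in Ioi (0 : ℝ), (Complex.exp (-((diagPhase σ r : ℝ) * Complex.I)) *
            logCorr 1 1 u v.star' r - Complex.exp ((diagPhase σ r : ℝ) * Complex.I) *
              logCorr 1 1 u v.star' (-r)) / ((2 * Real.sinh (r / 2) : ℝ) : ℂ)) +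
          ∫ r in Ioi (0 : ℝ), 1 / 2 * (conj (offKernel σ r) * logCorr 1 (-1) u v.star' r -
            offKernel σ r * logCorr (-1) 1 u v.star' (-r))) := by
  have h0 : ∫ x in Ioi (0 : ℝ), u x * v.star' x = logCorr 1 1 u v.star' 0 := by
    have := dilatedIntegral_eq_logCorr 1 1 u v.star' 0 one_pos
    simpa [dilatedIntegral] using this
  rw [integral_indicator_mul_wigner_eq, h0]
  rw [integral_Ioi_eq_hyperbolic (integrableOn_integral_crossQuot σ u v.star')]
  congr 2
  congr 1
  · exact setIntegral_congr_fun measurableSet_Ioi fun r hr =>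
      integral_crossQuot_two_mul_tanh σ u v.star' hr
  · exact setIntegral_congr_fun measurableSet_Ioi fun r hr =>
      integral_crossQuot_two_div_tanh σ u v.star' hr

end Hyperbolic

/-! ### Fourier transforms in logarithmic coordinates -/

section LogFourier

open FourierTransform

theorem exp_half_mul_le {c : ℝ} (hc : c ^ 2 = 1) (t : ℝ) :
    (1 + (c * Real.exp t) ^ 2)⁻¹ * Real.exp (t / 2) ≤ Real.exp (-|t| / 4) := by
  rw [inv_mul_le_iff₀ (by positivity), mul_pow, hc, one_mul, ← Real.exp_nat_mul]
  rcases le_or_gt 0 t with ht | ht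
  · rw [abs_of_nonneg ht, add_mul, ← Real.exp_add, one_mul]
    refine le_add_of_nonneg_of_le (Real.exp_pos _).le (Real.exp_le_exp.2 ?_)
    push_cast
    linarith
  · rw [abs_of_neg ht, add_mul, ← Real.exp_add, one_mul]
    refine le_add_of_le_of_nonneg (Real.exp_le_exp.2 ?_) (Real.exp_pos _).le
    linarith

theorem norm_logPull_le {c C : ℝ} (hc : c ^ 2 = 1) {h : ℝ → ℂ} (hC : 0 ≤ C)
    (hh : ∀ x, ‖h x‖ ≤ C * (1 + x ^ 2)⁻¹) (t : ℝ) : ‖logPull c h t‖ ≤ C * Real.exp (-|t| / 4) := by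
  rw [logPull, norm_mul, Complex.norm_real, Real.norm_of_nonneg (Real.exp_pos _).le]
  calc _ ≤ C * (1 + (c * Real.exp t) ^ 2)⁻¹ * Real.exp (t / 2) := by gcongr; exact hh _
    _ = C * ((1 + (c * Real.exp t) ^ 2)⁻¹ * Real.exp (t / 2)) := by ring
    _ ≤ _ := mul_le_mul_of_nonneg_left (exp_half_mul_le hc t) hC

theorem continuous_logPull (c : ℝ) {h : ℝ → ℂ} (hh : Continuous h) : Continuous (logPull c h) := by
  unfold logPull
  fun_prop

theorem memLp_two_of_norm_le {f : ℝ → ℂ} (hf : Integrable f) {C : ℝ} (h : ∀ t, ‖f t‖ ≤ C) :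
    MemLp f 2 volume := by
  rw [memLp_two_iff_integrable_sq_norm hf.aestronglyMeasurable]
  refine (hf.norm.const_mul C).mono' (hf.aestronglyMeasurable.norm.pow 2) (ae_of_all _ fun t => ?_)
  rw [Real.norm_of_nonneg (by positivity), sq]
  exact mul_le_mul_of_nonneg_right (h t) (norm_nonneg _)

theorem integrable_memLp_logPull {c : ℝ} (hc : c ^ 2 = 1) {h : ℝ → ℂ} (hcont : Continuous h)
    (hh : ∃ C, 0 ≤ C ∧ ∀ x, ‖h x‖ ≤ C * (1 + x ^ 2)⁻¹) :
    Integrable (logPull c h) ∧ MemLp (logPull c h) 2 volume := by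
  obtain ⟨C, hC, hh⟩ := hh
  have hi : Integrable (logPull c h) :=
    (integrable_exp_neg_abs_quarter.const_mul C).mono'
      (continuous_logPull c hcont).aestronglyMeasurable
      (ae_of_all _ (norm_logPull_le hc hC hh))
  refine ⟨hi, memLp_two_of_norm_le hi (C := C) fun t => ?_⟩
  refine (norm_logPull_le hc hC hh t).trans (mul_le_of_le_one_right hC ?_)
  rw [Real.exp_le_one_iff]
  linarith [abs_nonneg t]

theorem SchwartzMap.exists_norm_le_inv (f : 𝓢(ℝ, ℂ)) :
    ∃ C, 0 ≤ C ∧ ∀ x : ℝ, ‖f x‖ ≤ C * (1 + x ^ 2)⁻¹ := by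
  obtain ⟨C, hC, h⟩ := f.exists_norm_le_inv_sq
  refine ⟨C, hC, fun x => (h x).trans (mul_le_mul_of_nonneg_left ?_ hC)⟩
  exact inv_anti₀ (by positivity) (by nlinarith [sq_nonneg x])

theorem integrable_logPull {c : ℝ} (hc : c ^ 2 = 1) (f : 𝓢(ℝ, ℂ)) : Integrable (logPull c f) :=
  (integrable_memLp_logPull hc f.continuous f.exists_norm_le_inv).1

theorem memLp_logPull {c : ℝ} (hc : c ^ 2 = 1) (f : 𝓢(ℝ, ℂ)) : MemLp (logPull c f) 2 volume :=
  (integrable_memLp_logPull hc f.continuous f.exists_norm_le_inv).2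

/-- The dilation generator applied to a Schwartz function. -/
noncomputable def dilationDeriv (f : 𝓢(ℝ, ℂ)) (x : ℝ) : ℂ := x * f.der x + 1 / 2 * f x

theorem continuous_dilationDeriv (f : 𝓢(ℝ, ℂ)) : Continuous (dilationDeriv f) := by
  have h1 := f.continuous
  have h2 := f.der.continuous
  unfold dilationDeriv
  fun_prop

theorem exists_norm_dilationDeriv_le (f : 𝓢(ℝ, ℂ)) :
    ∃ C, 0 ≤ C ∧ ∀ x, ‖dilationDeriv f x‖ ≤ C * (1 + x ^ 2)⁻¹ := by
  obtain ⟨A, hA, h1⟩ := f.der.exists_norm_le_inv_sq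
  obtain ⟨B, hB, h2⟩ := f.exists_norm_le_inv
  refine ⟨A + B, by positivity, fun x => ?_⟩
  have e : |x| * ((1 + x ^ 2) ^ 2)⁻¹ ≤ (1 + x ^ 2)⁻¹ := by
    rw [sq (1 + x ^ 2), mul_inv, ← mul_assoc]
    refine mul_le_of_le_one_left (by positivity) ?_
    rw [← div_eq_mul_inv, div_le_one (by positivity), ← sq_abs]
    nlinarith [sq_nonneg (|x| - 1)]
  have e3 : ‖(1 / 2 : ℂ)‖ = 1 / 2 := by norm_num
  refine (norm_add_le _ _).trans ?_
  rw [norm_mul, norm_mul, Complex.norm_real, Real.norm_eq_abs, e3]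
  have h4 : |x| * ‖f.der x‖ ≤ A * (1 + x ^ 2)⁻¹ := by
    calc _ ≤ |x| * (A * ((1 + x ^ 2) ^ 2)⁻¹) := by gcongr; exact h1 x
      _ = A * (|x| * ((1 + x ^ 2) ^ 2)⁻¹) := by ring
      _ ≤ _ := mul_le_mul_of_nonneg_left e hA
  linarith [h2 x, norm_nonneg (f x)]

theorem hasDerivAt_logPull (c : ℝ) (f : 𝓢(ℝ, ℂ)) (t : ℝ) :
    HasDerivAt (logPull c f) (logPull c (dilationDeriv f) t) t := by
  have h1 := (f.hasDerivAt_der (c * Real.exp t)).scomp t (hasDerivAt_const_mul_exp c t)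
  have h2 : HasDerivAt (fun t : ℝ => Real.exp (t / 2)) (Real.exp (t / 2) * (1 / 2)) t :=
    ((hasDerivAt_id t).div_const 2).exp
  convert! h1.mul h2.ofReal_comp using 1
  simp only [logPull, dilationDeriv, Function.comp_apply, Complex.real_smul]
  push_cast
  ring

theorem fourier_logPull_dilationDeriv {c : ℝ} (hc : c ^ 2 = 1) (f : 𝓢(ℝ, ℂ)) (τ : ℝ) :
    𝓕 (logPull c (dilationDeriv f)) τ = 2 * Real.pi * Complex.I * τ * 𝓕 (logPull c f) τ := by
  have e1 : deriv (logPull c f) = logPull c (dilationDeriv f) :=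
    funext fun x => (hasDerivAt_logPull c f x).deriv
  have h := congrFun (Real.fourier_deriv (integrable_logPull hc f)
    (fun x => (hasDerivAt_logPull c f x).differentiableAt) (by
      rw [e1]
      exact (integrable_memLp_logPull hc (continuous_dilationDeriv f)
        (exists_norm_dilationDeriv_le f)).1)) τ
  rw [e1] at h
  rw [h, smul_eq_mul]

theorem memLp_fourier {f : ℝ → ℂ} (h1 : Integrable f) (h2 : MemLp f 2 volume) :
    MemLp (𝓕 f) 2 volume :=
  (Lp.memLp _).ae_eq (fourierTransform_toLp_ae h1 h2)

/-- Parseval's identity for integrable, square integrable functions. -/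
theorem integral_mul_conj_eq_fourier {f g : ℝ → ℂ} (f1 : Integrable f) (f2 : MemLp f 2 volume)
    (g1 : Integrable g) (g2 : MemLp g 2 volume) :
    ∫ t, f t * conj (g t) = ∫ τ, 𝓕 f τ * conj (𝓕 g τ) := by
  have h := (Lp.fourierTransformₗᵢ ℝ ℂ).inner_map_map (g2.toLp g) (f2.toLp f)
  rw [L2.inner_def, L2.inner_def] at h
  calc _ = ∫ t, inner ℂ (g2.toLp g t) (f2.toLp f t) := by
        refine integral_congr_ae ?_
        filter_upwards [f2.coeFn_toLp, g2.coeFn_toLp] with t h1 h2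
        rw [h1, h2, RCLike.inner_apply]
    _ = _ := h.symm
    _ = _ := by
        refine integral_congr_ae ?_
        filter_upwards [fourierTransform_toLp_ae f1 f2, fourierTransform_toLp_ae g1 g2] with t h1 h2
        rw [h1, h2, RCLike.inner_apply]

/-- The product of the Mellin-type transforms of two Schwartz functions. -/
noncomputable def logFourierProd (c d : ℝ) (u v : 𝓢(ℝ, ℂ)) (τ : ℝ) : ℂ :=
  𝓕 (logPull c u) τ * conj (𝓕 (logPull d v) τ)

theorem integrable_logFourierProd {c d : ℝ} (hc : c ^ 2 = 1) (hd : d ^ 2 = 1) (u v : 𝓢(ℝ, ℂ)) :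
    Integrable (logFourierProd c d u v) :=
  MemLp.integrable_mul (memLp_fourier (integrable_logPull hc u) (memLp_logPull hc u))
    (memLp_fourier (integrable_logPull hd v) (memLp_logPull hd v)).star

/-- Logarithmic coordinates turn the dilation generator `x d/dx + 1/2` into `d/dt`, so
multiplication by `τ` corresponds to applying it to `u`. This extra moment pays for the singularity
of the diagonal kernel in Fubini. -/
theorem integrable_id_mul_logFourierProd {c d : ℝ} (hc : c ^ 2 = 1) (hd : d ^ 2 = 1)
    (u v : 𝓢(ℝ, ℂ)) : Integrable fun τ : ℝ => (τ : ℂ) * logFourierProd c d u v τ := by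
  obtain ⟨h1, h2⟩ := integrable_memLp_logPull hc (continuous_dilationDeriv u)
    (exists_norm_dilationDeriv_le u)
  have h : Integrable fun τ => 𝓕 (logPull c (dilationDeriv u)) τ * conj (𝓕 (logPull d v) τ) :=
    MemLp.integrable_mul (memLp_fourier h1 h2)
      (memLp_fourier (integrable_logPull hd v) (memLp_logPull hd v)).star
  refine (h.const_mul (2 * Real.pi * Complex.I)⁻¹).congr (ae_of_all _ fun τ => ?_)
  have hp : (Real.pi : ℂ) ≠ 0 := by exact_mod_cast Real.pi_ne_zero
  simp only [fourier_logPull_dilationDeriv hc, logFourierProd]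
  field_simp

/-- Parseval, with the translation by `r` becoming the character `e^{2πirτ}`. -/
theorem logCorr_eq_fourier {c d : ℝ} (hc : c ^ 2 = 1) (hd : d ^ 2 = 1) (u v : 𝓢(ℝ, ℂ)) (r : ℝ) :
    logCorr c d u v.star' r = 𝓕 (logFourierProd c d u v) (-r) := by
  have e1 : logCorr c d u v.star' r = ∫ s, logPull c u (s + r) * conj (logPull d v s) := by
    rw [logCorr, ← integral_sub_right_eq_self
      (fun s => logPull c u (s + r) * conj (logPull d v s)) (r / 2)]
    refine integral_congr_ae (ae_of_all _ fun s => ?_)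
    simp only
    rw [show s - r / 2 + r = s + r / 2 by ring]
    simp only [logPull, SchwartzMap.star'_apply, map_mul, Complex.conj_ofReal]
  have hi := integrable_logPull hc u
  have hm := memLp_logPull hc u
  have e2 : ∀ τ, 𝓕 (fun s => logPull c u (s + r)) τ =
      Complex.exp ((2 * Real.pi * (r * τ) : ℝ) * Complex.I) * 𝓕 (logPull c u) τ := fun τ => by
    have := congrFun (VectorFourier.fourierIntegral_comp_add_right Real.fourierChar volume
      (innerₗ ℝ) (logPull c u) r) τ
    refine this.trans ?_
    rw [Circle.smul_def, smul_eq_mul, Real.fourierChar_apply]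
    congr 3
    simp [mul_comm]
  rw [e1, integral_mul_conj_eq_fourier (hi.comp_add_right r)
    (hm.comp_measurePreserving (measurePreserving_add_right volume r))
    (integrable_logPull hd v) (memLp_logPull hd v), Real.fourier_real_eq_integral_exp_smul]
  refine integral_congr_ae (ae_of_all _ fun τ => ?_)
  simp only
  rw [e2, logFourierProd, smul_eq_mul, mul_assoc]
  congr 3
  push_cast
  ring

end LogFourier

/-! ### The Weyl form in terms of the matrix symbol -/

section WeylForm

open FourierTransform

theorem conj_fourier (f : ℝ → ℂ) (ξ : ℝ) : conj (𝓕 f ξ) = 𝓕 (fun x => conj (f x)) (-ξ) := by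
  rw [Real.fourier_real_eq_integral_exp_smul, Real.fourier_real_eq_integral_exp_smul,
    ← integral_conj]
  refine integral_congr_ae (ae_of_all _ fun z => ?_)
  simp only [smul_eq_mul, map_mul, ← Complex.exp_conj, Complex.conj_ofReal, Complex.conj_I]
  congr 2
  push_cast
  ring

theorem integral_mul_fourier {f g : ℝ → ℂ} (hf : Integrable f) (hg : Integrable g) :
    ∫ x, f x * 𝓕 g x = ∫ ξ, 𝓕 f ξ * g ξ := by
  have h := VectorFourier.integral_fourierIntegral_smul_eq_flip (μ := volume) (ν := volume)
    (L := innerₗ ℝ) Real.continuous_fourierChar (by fun_prop) hf hg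
  rw [flip_innerₗ] at h
  exact h.symm

theorem integral_offKernel_mul_fourier (σ : ℝ) {Φ : ℝ → ℂ} (hΦ : Integrable Φ) :
    1 / (2 * Real.pi * Complex.I) * ∫ r in Ioi (0 : ℝ), 1 / 2 * (offKernel σ r * 𝓕 Φ r) =
      -∫ τ, coeffOffDiag σ τ * Φ τ := by
  have h := integral_mul_fourier (integrable_offKernelExt σ) hΦ
  have e : ∫ r, offKernelExt σ r * 𝓕 Φ r = ∫ r in Ioi (0 : ℝ), offKernel σ r * 𝓕 Φ r := by
    rw [← integral_indicator measurableSet_Ioi]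
    refine integral_congr_ae (ae_of_all _ fun r => ?_)
    by_cases hr : r ∈ Ioi (0 : ℝ) <;> simp [offKernelExt, hr]
  have hp : (Real.pi : ℂ) ≠ 0 := by exact_mod_cast Real.pi_ne_zero
  rw [integral_const_mul, ← e, h, ← mul_assoc, ← integral_const_mul, ← integral_neg]
  refine integral_congr_ae (ae_of_all _ fun τ => ?_)
  simp only [coeffOffDiag_eq]
  field_simp
  rw [Complex.I_sq]
  ring

/-- The complex conjugate of `integral_offKernel_mul_fourier` for `conj Φ`; the sign flips because
the prefactor is purely imaginary. -/
theorem integral_conj_offKernel_mul_fourier (σ : ℝ) {Φ : ℝ → ℂ} (hΦ : Integrable Φ) :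
    1 / (2 * Real.pi * Complex.I) * ∫ r in Ioi (0 : ℝ), 1 / 2 * (conj (offKernel σ r) * 𝓕 Φ (-r)) =
      ∫ τ, conj (coeffOffDiag σ τ) * Φ τ := by
  have hΦ' : Integrable fun τ => conj (Φ τ) :=
    hΦ.norm.mono' (Complex.continuous_conj.comp_aestronglyMeasurable hΦ.aestronglyMeasurable)
      (ae_of_all _ fun τ => (RCLike.norm_conj _).le)
  have h := congrArg conj (integral_offKernel_mul_fourier σ hΦ')
  rw [map_neg, ← integral_conj, map_mul, ← integral_conj] at h
  have hc : conj (1 / (2 * Real.pi * Complex.I) : ℂ) = -(1 / (2 * Real.pi * Complex.I)) := by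
    rw [map_div₀, map_mul, map_mul, Complex.conj_ofReal, Complex.conj_I, map_ofNat, map_one,
      mul_neg, div_neg]
  rw [hc, neg_mul, neg_inj] at h
  simp only [map_mul, conj_fourier, Complex.conj_conj, map_div₀, map_one, map_ofNat] at h
  exact h

theorem norm_sin_div_sinh_mul_le {σ r τ : ℝ} (hr : 0 < r) (z : ℂ) :
    ‖((Real.sin (2 * Real.pi * r * τ - diagPhase σ r) / Real.sinh (r / 2) : ℝ) : ℂ) * z‖ ≤
      r / Real.sinh (r / 2) * (2 * Real.pi * ‖(τ : ℂ) * z‖) +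
        1 / Real.cosh (r / 2) * (4 * Real.pi * |σ| * ‖z‖) := by
  have hs : 0 < Real.sinh (r / 2) := Real.sinh_pos_iff.2 (half_pos hr)
  rw [norm_mul, norm_mul, Complex.norm_real, Complex.norm_real, norm_div, Real.norm_of_nonneg hs.le,
    Real.norm_eq_abs, Real.norm_eq_abs]
  have h1 : |Real.sin (2 * Real.pi * r * τ - diagPhase σ r)| ≤
      2 * Real.pi * r * |τ| + |diagPhase σ r| := by
    refine Real.abs_sin_le_abs.trans ((norm_sub_le (E := ℝ) _ _).trans_eq ?_)
    rw [Real.norm_eq_abs, Real.norm_eq_abs, abs_mul, abs_of_pos (by have := Real.pi_pos; positivity)]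
  have h2 := div_le_div_of_nonneg_right h1 hs.le
  rw [add_div, abs_diagPhase_div_sinh hr] at h2
  refine (mul_le_mul_of_nonneg_right h2 (norm_nonneg z)).trans_eq ?_
  ring

/-- Since `1 / sinh(r/2)` is not integrable at `0`, the sine is bounded by its argument; the term in
`r|τ|` uses the moment `hΦ1`. -/
theorem integrable_sin_div_sinh_mul (σ : ℝ) {Φ : ℝ → ℂ} (hΦ : Integrable Φ)
    (hΦ1 : Integrable fun τ : ℝ => (τ : ℂ) * Φ τ) :
    Integrable (fun p : ℝ × ℝ =>
      ((Real.sin (2 * Real.pi * p.1 * p.2 - diagPhase σ p.1) / Real.sinh (p.1 / 2) : ℝ) : ℂ) * Φ p.2)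
      ((volume.restrict (Ioi 0)).prod volume) := by
  have hm := measurable_diagPhase σ
  have i1 := integrableOn_div_sinh_half.mul_prod (hΦ1.norm.const_mul (2 * Real.pi))
  have i2 := integrableOn_one_div_cosh_half.mul_prod (hΦ.norm.const_mul (4 * Real.pi * |σ|))
  refine (i1.add i2).mono' (AEStronglyMeasurable.mul ?_ ?_) ?_
  · have : Measurable fun p : ℝ × ℝ =>
        Real.sin (2 * Real.pi * p.1 * p.2 - diagPhase σ p.1) / Real.sinh (p.1 / 2) := by fun_prop
    exact (Complex.measurable_ofReal.comp this).aestronglyMeasurable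
  · exact hΦ.aestronglyMeasurable.comp_snd
  · have h : ∀ᵐ p : ℝ × ℝ ∂((volume.restrict (Ioi 0)).prod volume), p.1 ∈ Ioi (0 : ℝ) :=
      Measure.quasiMeasurePreserving_fst.ae (ae_restrict_mem measurableSet_Ioi)
    filter_upwards [h] with p hp
    exact norm_sin_div_sinh_mul_le hp _

theorem integral_diag_fourier (σ : ℝ) {Φ : ℝ → ℂ} (hΦ : Integrable Φ)
    (hΦ1 : Integrable fun τ : ℝ => (τ : ℂ) * Φ τ) :
    ∫ r in Ioi (0 : ℝ), (Complex.exp (-((diagPhase σ r : ℝ) * Complex.I)) * 𝓕 Φ (-r) -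
        Complex.exp ((diagPhase σ r : ℝ) * Complex.I) * 𝓕 Φ r) /
          ((2 * Real.sinh (r / 2) : ℝ) : ℂ) =
      Complex.I * ∫ τ, (diagIntegral σ τ : ℂ) * Φ τ := by
  have hint : ∀ r : ℝ, Integrable fun τ : ℝ =>
      Complex.exp (↑(-2 * Real.pi * τ * r) * Complex.I) • Φ τ := fun r => by
    have hcont : Continuous fun τ : ℝ => Complex.exp (↑(-2 * Real.pi * τ * r) * Complex.I) := by
      fun_prop
    refine hΦ.norm.mono' (hcont.aestronglyMeasurable.smul hΦ.aestronglyMeasurable)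
      (ae_of_all _ fun z => ?_)
    rw [norm_smul, Complex.norm_exp_ofReal_mul_I, one_mul]
  have h1 : ∀ r : ℝ, (Complex.exp (-((diagPhase σ r : ℝ) * Complex.I)) * 𝓕 Φ (-r) -
        Complex.exp ((diagPhase σ r : ℝ) * Complex.I) * 𝓕 Φ r) /
          ((2 * Real.sinh (r / 2) : ℝ) : ℂ) = Complex.I * ∫ τ,
      ((Real.sin (2 * Real.pi * r * τ - diagPhase σ r) / Real.sinh (r / 2) : ℝ) : ℂ) * Φ τ := by
    intro r
    rw [Real.fourier_real_eq_integral_exp_smul, Real.fourier_real_eq_integral_exp_smul,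
      ← integral_const_mul, ← integral_const_mul,
      ← integral_sub ((hint (-r)).const_mul _) ((hint r).const_mul _), ← integral_div,
      ← integral_const_mul]
    refine integral_congr_ae (ae_of_all _ fun τ => ?_)
    simp only [smul_eq_mul]
    rw [← mul_assoc, ← mul_assoc, ← Complex.exp_add, ← Complex.exp_add]
    set θ : ℝ := 2 * Real.pi * r * τ - diagPhase σ r with hθ
    have e1 : -((diagPhase σ r : ℝ) * Complex.I) + ((-2 * Real.pi * τ * -r : ℝ) : ℂ) * Complex.I =
        (θ : ℂ) * Complex.I := by rw [hθ]; push_cast; ring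
    have e2 : ((diagPhase σ r : ℝ) * Complex.I) + ((-2 * Real.pi * τ * r : ℝ) : ℂ) * Complex.I =
        -(θ : ℂ) * Complex.I := by rw [hθ]; push_cast; ring
    rw [e1, e2, Complex.exp_mul_I, Complex.exp_mul_I, Complex.cos_neg, Complex.sin_neg]
    push_cast
    rw [div_eq_mul_inv, div_eq_mul_inv, mul_inv]
    ring
  simp only [h1]
  rw [integral_const_mul, integral_integral_swap (integrable_sin_div_sinh_mul σ hΦ hΦ1)]
  congr 1
  refine integral_congr_ae (ae_of_all _ fun τ => ?_)
  simp only
  rw [integral_mul_const, integral_complex_ofReal, diagIntegral]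

theorem integrable_bounded_mul {a : ℝ → ℂ} (ha : Continuous a) {C : ℝ} (hC : ∀ τ, ‖a τ‖ ≤ C)
    {Φ : ℝ → ℂ} (hΦ : Integrable Φ) : Integrable fun τ => a τ * Φ τ :=
  hΦ.bdd_mul ha.aestronglyMeasurable (ae_of_all _ hC)

theorem integrable_coeffDiag_mul (σ : ℝ) {Φ : ℝ → ℂ} (hΦ : Integrable Φ) :
    Integrable fun τ => (coeffDiag σ τ : ℂ) * Φ τ := by
  obtain ⟨C, hC⟩ := exists_abs_coeffDiag_le σ
  exact integrable_bounded_mul (Complex.continuous_ofReal.comp (continuous_coeffDiag σ))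
    (fun τ => (Complex.norm_real _).trans_le (hC τ)) hΦ

theorem integrable_coeffOffDiag_mul (σ : ℝ) {Φ : ℝ → ℂ} (hΦ : Integrable Φ) :
    Integrable fun τ => coeffOffDiag σ τ * Φ τ := by
  obtain ⟨C, hC⟩ := exists_norm_coeffOffDiag_le σ
  exact integrable_bounded_mul (continuous_coeffOffDiag σ) hC hΦ

theorem integrable_conj_coeffOffDiag_mul (σ : ℝ) {Φ : ℝ → ℂ} (hΦ : Integrable Φ) :
    Integrable fun τ => conj (coeffOffDiag σ τ) * Φ τ := by
  obtain ⟨C, hC⟩ := exists_norm_coeffOffDiag_le σ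
  exact integrable_bounded_mul (Complex.continuous_conj.comp (continuous_coeffOffDiag σ))
    (fun τ => (RCLike.norm_conj _).trans_le (hC τ)) hΦ

/-- The value at `0` left over by the principal value formula supplies the constant `1/2` of the
diagonal coefficient. -/
theorem coeffDiag_mul_integral (σ : ℝ) {Φ : ℝ → ℂ} (hΦ : Integrable Φ) :
    1 / 2 * 𝓕 Φ 0 + 1 / (2 * Real.pi * Complex.I) *
      (Complex.I * ∫ τ, (diagIntegral σ τ : ℂ) * Φ τ) = ∫ τ, (coeffDiag σ τ : ℂ) * Φ τ := by
  have hp : (Real.pi : ℂ) ≠ 0 := by exact_mod_cast Real.pi_ne_zero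
  have hd : ∀ τ, (diagIntegral σ τ : ℂ) * Φ τ =
      2 * Real.pi * ((coeffDiag σ τ : ℂ) * Φ τ) - Real.pi * Φ τ := fun τ => by
    rw [coeffDiag_eq]
    push_cast
    field_simp
    ring
  have h0 : 𝓕 Φ 0 = ∫ τ, Φ τ := by
    rw [Real.fourier_real_eq_integral_exp_smul]
    simp
  simp only [hd]
  rw [integral_sub ((integrable_coeffDiag_mul σ hΦ).const_mul _) (hΦ.const_mul _),
    integral_const_mul, integral_const_mul, h0]
  field_simp
  ring

/-- The Weyl form of the hyperbolic region, in terms of the matrix symbol. -/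
theorem integral_indicator_mul_wigner_eq_symbol (σ : ℝ) (u v : 𝓢(ℝ, ℂ)) :
    ∫ p, (hyperbolicRegion σ).indicator (fun _ => (1 : ℂ)) p * wigner u v p =
      ∫ τ, (((coeffDiag σ τ : ℂ) * logFourierProd 1 1 u v τ +
        coeffOffDiag σ τ * logFourierProd (-1) 1 u v τ) +
          conj (coeffOffDiag σ τ) * logFourierProd 1 (-1) u v τ) := by
  have h1 : (1 : ℝ) ^ 2 = 1 := one_pow 2
  have h2 : (-1 : ℝ) ^ 2 = 1 := by norm_num
  have i11 := integrable_logFourierProd h1 h1 u v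
  have i12 := integrable_logFourierProd h1 h2 u v
  have i21 := integrable_logFourierProd h2 h1 u v
  rw [integral_indicator_mul_wigner_eq_logCorr]
  simp only [logCorr_eq_fourier h1 h1, logCorr_eq_fourier h1 h2, logCorr_eq_fourier h2 h1, neg_neg,
    neg_zero]
  rw [integral_diag_fourier σ i11 (integrable_id_mul_logFourierProd h1 h1 u v)]
  have j : ∀ (k : ℝ → ℂ) (Ψ : ℝ → ℂ), IntegrableOn k (Ioi 0) → (∃ C, ∀ r, ‖Ψ r‖ ≤ C) →
      Continuous Ψ → IntegrableOn (fun r => 1 / 2 * (k r * Ψ r)) (Ioi 0) := by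
    rintro k Ψ hk ⟨C, hC⟩ hΨ
    exact (hk.mul_bdd hΨ.aestronglyMeasurable (ae_of_all _ hC)).const_mul _
  have hb : ∀ Φ : ℝ → ℂ, ∀ r, ‖𝓕 Φ r‖ ≤ ∫ τ, ‖Φ τ‖ := fun Φ r =>
    VectorFourier.norm_fourierIntegral_le_integral_norm _ _ _ _ _
  have hk := integrableOn_offKernel σ
  have hk' : IntegrableOn (fun r => conj (offKernel σ r)) (Ioi 0) :=
    hk.norm.mono' (Complex.continuous_conj.comp_aestronglyMeasurable hk.aestronglyMeasurable)
      (ae_of_all _ fun τ => (RCLike.norm_conj _).le)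
  have j1 := j _ (fun r => 𝓕 (logFourierProd 1 (-1) u v) (-r)) hk' ⟨_, fun r => hb _ (-r)⟩
    ((continuous_fourier_of_integrable i12).comp continuous_neg)
  have j2 := j _ (𝓕 (logFourierProd (-1) 1 u v)) hk ⟨_, hb _⟩ (continuous_fourier_of_integrable i21)
  have e := integral_sub j1 j2
  simp only [mul_sub (1 / 2 : ℂ)]
  rw [e, mul_add, mul_sub, integral_conj_offKernel_mul_fourier σ i12,
    integral_offKernel_mul_fourier σ i21, ← add_assoc, coeffDiag_mul_integral σ i11, sub_neg_eq_add]
  refine Eq.trans ?_ (integral_add ((integrable_coeffDiag_mul σ i11).add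
    (integrable_coeffOffDiag_mul σ i21)) (integrable_conj_coeffOffDiag_mul σ i12)).symm
  have e3 := integral_add (integrable_coeffDiag_mul σ i11) (integrable_coeffOffDiag_mul σ i21)
  refine Eq.trans ?_ (congrArg (· + _) e3.symm)
  ring

end WeylForm

/-! ### The operator, its uniqueness and the extremes of its spectrum -/

section WeylOperator

open FourierTransform

theorem continuous_multiplierMatrix (σ : ℝ) : Continuous (multiplierMatrix σ) := by
  have h1 := continuous_coeffDiag σ
  have h2 := continuous_coeffOffDiag σ
  refine continuous_matrix fun i j => ?_
  fin_cases i <;> fin_cases j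
  · exact Complex.continuous_ofReal.comp h1
  · exact h2
  · exact Complex.continuous_conj.comp h2
  · exact continuous_const

theorem exists_norm_multiplierMatrix_le (σ : ℝ) :
    ∃ C : ℝ, ∀ τ i j, ‖multiplierMatrix σ τ i j‖ ≤ C := by
  obtain ⟨A, hA⟩ := exists_abs_coeffDiag_le σ
  obtain ⟨B, hB⟩ := exists_norm_coeffOffDiag_le σ
  have hA0 : 0 ≤ A := (abs_nonneg _).trans (hA 0)
  have hB0 : 0 ≤ B := (norm_nonneg _).trans (hB 0)
  refine ⟨A + B, fun τ i j => ?_⟩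
  fin_cases i <;> fin_cases j
  · exact ((Complex.norm_real _).trans_le (hA τ)).trans (le_add_of_nonneg_right hB0)
  · exact (hB τ).trans (le_add_of_nonneg_left hA0)
  · exact ((RCLike.norm_conj _).trans_le (hB τ)).trans (le_add_of_nonneg_left hA0)
  · simpa [multiplierMatrix] using add_nonneg hA0 hB0

theorem isHermitian_multiplierMatrix (σ τ : ℝ) : (multiplierMatrix σ τ).IsHermitian := by
  ext i j
  fin_cases i <;> fin_cases j <;> simp [multiplierMatrix]

/-- Multiplication by the matrix symbol on `L²(ℝ; ℂ²)`. -/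
noncomputable def symbolOp (σ : ℝ) : L2Pair →L[ℂ] L2Pair :=
  mulOp (bcfMatrix _ (continuous_multiplierMatrix σ) (exists_norm_multiplierMatrix_le σ))

theorem symbolOp_ae (σ : ℝ) (Φ : L2Pair) :
    symbolOp σ Φ =ᵐ[volume] fun τ => Matrix.toEuclideanLin (multiplierMatrix σ τ) (Φ τ) :=
  mulOp_ae _ Φ

/-- Logarithmic coordinates followed by the Fourier transform. -/
noncomputable def mellinUnitary : L2Line ≃ₗᵢ[ℂ] L2Pair :=
  logUnitary.trans (Lp.fourierTransformₗᵢ ℝ (EuclideanSpace ℂ (Fin 2)))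

/-- The bounded operator on `L²(ℝ)` with the matrix symbol `multiplierMatrix σ`. -/
noncomputable def weylOp (σ : ℝ) : L2Line →L[ℂ] L2Line :=
  mellinUnitary.symm.conjStarAlgEquiv (symbolOp σ)

theorem weylOp_apply (σ : ℝ) (u : L2Line) :
    weylOp σ u = mellinUnitary.symm (symbolOp σ (mellinUnitary u)) := rfl

theorem isSelfAdjoint_weylOp (σ : ℝ) : IsSelfAdjoint (weylOp σ) :=
  (isSelfAdjoint_mulOp_bcfMatrix _ _ (isHermitian_multiplierMatrix σ)).map
    mellinUnitary.symm.conjStarAlgEquiv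

theorem isMatrixFourierMultiplier_weylOp (σ : ℝ) : IsMatrixFourierMultiplier (multiplierMatrix σ)
    (fun Φ => logUnitary (weylOp σ (logUnitary.symm Φ))) := by
  intro Φ
  have e : Lp.fourierTransformₗᵢ ℝ (EuclideanSpace ℂ (Fin 2))
      (logUnitary (weylOp σ (logUnitary.symm Φ))) =
        symbolOp σ (Lp.fourierTransformₗᵢ ℝ (EuclideanSpace ℂ (Fin 2)) Φ) := by
    simp [weylOp_apply, mellinUnitary]
  rw [e]
  exact symbolOp_ae σ _

theorem spectrum_weylOp (σ : ℝ) : spectrum ℂ (weylOp σ) =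
    closure {μ : ℂ | ∃ τ : ℝ,
      Module.End.HasEigenvalue (Matrix.toLin' (multiplierMatrix σ τ)) μ} := by
  rw [weylOp, AlgEquiv.spectrum_eq]
  exact spectrum_mulOp_hermitianPair (continuous_coeffDiag σ) (continuous_coeffOffDiag σ) _ _

theorem integrable_logPair (u : 𝓢(ℝ, ℂ)) : Integrable (logPair u) := by
  refine Integrable.of_eval_piLp fun i => ?_
  fin_cases i
  · exact integrable_logPull (one_pow 2) u
  · exact integrable_logPull (by norm_num) u

theorem fourier_logPair (u : 𝓢(ℝ, ℂ)) (τ : ℝ) :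
    𝓕 (logPair u) τ = !₂[𝓕 (logPull 1 u) τ, 𝓕 (logPull (-1) u) τ] := by
  have hi := (integrable_logPair u)
  have h := Real.fourierIntegral_convergent_iff (μ := volume) (f := logPair u) τ
  ext i
  have e : (𝓕 (logPair u) τ) i = 𝓕 (fun t => logPair u t i) τ := by
    rw [Real.fourier_eq, Real.fourier_eq, eval_integral_piLp]
    · rfl
    · exact fun i => (h.2 hi).eval_piLp i
  rw [e]
  fin_cases i <;> rfl

theorem mellinUnitary_toLp (u : 𝓢(ℝ, ℂ)) : mellinUnitary (u.toLp 2 volume) =ᵐ[volume]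
    fun τ => !₂[𝓕 (logPull 1 u) τ, 𝓕 (logPull (-1) u) τ] := by
  have h1 : logUnitary (u.toLp 2 volume) =ᵐ[volume] logPair u := logIsometry_toLp (u.memLp 2 volume)
  have hm : MemLp (logPair u) 2 volume := (Lp.memLp _).ae_eq h1
  have h2 : logUnitary (u.toLp 2 volume) = hm.toLp (logPair u) :=
    Lp.ext (h1.trans hm.coeFn_toLp.symm)
  have h3 := fourierTransform_toLp_ae (integrable_logPair u) hm
  rw [← h2] at h3
  filter_upwards [h3] with τ hτ
  rw [← fourier_logPair, ← hτ]
  rfl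

theorem inner_toEuclideanLin_multiplierMatrix (σ τ : ℝ) (a b c d : ℂ) :
    inner ℂ !₂[c, d] (Matrix.toEuclideanLin (multiplierMatrix σ τ) !₂[a, b]) =
      ((coeffDiag σ τ : ℂ) * (a * conj c) + coeffOffDiag σ τ * (b * conj c)) +
        conj (coeffOffDiag σ τ) * (a * conj d) := by
  simp [multiplierMatrix, PiLp.inner_apply, Matrix.toLpLin_apply,
    Fin.sum_univ_two]
  ring

/-- Transported by `mellinUnitary`, the inner product becomes the integral over `τ` already computed
for the Weyl form. -/
theorem isWeylQuantization_weylOp (σ : ℝ) :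
    IsWeylQuantization ((hyperbolicRegion σ).indicator (fun _ => (1 : ℂ))) (weylOp σ) := by
  intro u v
  refine ⟨integrable_indicator_mul_wigner σ u v, ?_⟩
  rw [integral_indicator_mul_wigner_eq_symbol, weylOp_apply,
    ← mellinUnitary.inner_map_map, LinearIsometryEquiv.apply_symm_apply, L2.inner_def]
  refine integral_congr_ae ?_
  filter_upwards [mellinUnitary_toLp u, mellinUnitary_toLp v,
    symbolOp_ae σ (mellinUnitary (u.toLp 2 volume))] with τ h1 h2 h3
  rw [h3, h1, h2, inner_toEuclideanLin_multiplierMatrix]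
  rfl

/-- Density of Schwartz functions in `L²` is used twice, once for each argument of the form. -/
theorem IsWeylQuantization.unique {a : ℝ × ℝ → ℂ} {A B : L2Line →L[ℂ] L2Line}
    (hA : IsWeylQuantization a A) (hB : IsWeylQuantization a B) : A = B := by
  have hd : DenseRange fun u : 𝓢(ℝ, ℂ) => u.toLp 2 volume :=
    SchwartzMap.denseRange_toLpCLM (F := ℂ) (μ := (volume : Measure ℝ)) ENNReal.ofNat_ne_top
  have h1 : ∀ (u : 𝓢(ℝ, ℂ)), A (u.toLp 2 volume) = B (u.toLp 2 volume) := fun u => by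
    have h2 : (fun w : L2Line => inner ℂ w (A (u.toLp 2 volume))) =
        fun w => inner ℂ w (B (u.toLp 2 volume)) :=
      hd.equalizer (by fun_prop) (by fun_prop)
        (funext fun v => (hA u v).2.trans (hB u v).2.symm)
    exact ext_inner_left ℂ (congrFun h2)
  exact DFunLike.coe_injective (hd.equalizer A.continuous B.continuous (funext h1))

theorem mem_spectrum_weylOp {σ τ μ : ℝ}
    (h : μ ^ 2 - coeffDiag σ τ * μ - ‖coeffOffDiag σ τ‖ ^ 2 = 0) :
    μ ∈ spectrum ℝ (weylOp σ) := by
  rw [← spectrum.algebraMap_mem_iff ℂ, spectrum_weylOp]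
  refine subset_closure ⟨τ, (hasEigenvalue_hermitianPair_iff _ _ _).2 ?_⟩
  rw [Complex.mul_conj, Complex.normSq_eq_norm_sq, Complex.coe_algebraMap]
  exact_mod_cast h

theorem isBounded_spectrum_weylOp (σ : ℝ) : Bornology.IsBounded (spectrum ℝ (weylOp σ)) :=
  spectrum.isBounded (𝕜 := ℝ) (weylOp σ)

/-- Where `a₁₂ ≠ 0` the matrix has determinant `-|a₁₂|² < 0`, so its smaller eigenvalue is negative.
-/
theorem sInf_spectrum_weylOp_neg (σ : ℝ) : sInf (spectrum ℝ (weylOp σ)) < 0 := by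
  obtain ⟨τ, hτ⟩ := exists_coeffOffDiag_ne_zero σ
  set a := coeffDiag σ τ
  set b := ‖coeffOffDiag σ τ‖ with hb
  have hb0 : 0 < b := norm_pos_iff.2 hτ
  set s := Real.sqrt (a ^ 2 + 4 * b ^ 2) with hs
  have hs2 : s ^ 2 = a ^ 2 + 4 * b ^ 2 := Real.sq_sqrt (by positivity)
  have hsa : a < s := (le_abs_self a).trans_lt (Real.lt_sqrt_of_sq_lt (by
    rw [sq_abs]; nlinarith [sq_pos_of_pos hb0]))
  refine (csInf_le (isBounded_spectrum_weylOp σ).bddBelow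
    (mem_spectrum_weylOp (τ := τ) (μ := (a - s) / 2) ?_)).trans_lt (by linarith)
  linear_combination (1 / 4 : ℝ) * hs2

theorem one_lt_sSup_spectrum_weylOp (σ : ℝ) : 1 < sSup (spectrum ℝ (weylOp σ)) := by
  obtain ⟨τ, hτ⟩ := exists_one_lt_coeffDiag_add σ
  set a := coeffDiag σ τ
  set b := ‖coeffOffDiag σ τ‖ with hb
  set s := Real.sqrt (a ^ 2 + 4 * b ^ 2) with hs
  have hs2 : s ^ 2 = a ^ 2 + 4 * b ^ 2 := Real.sq_sqrt (by positivity)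
  -- `(2 - a)² = a² + 4(1 - a)`, and `1 - a < b²`. This says that the larger root `(a + s)/2`
  -- exceeds `1`.
  have hsa : 2 - a < s := Real.lt_sqrt_of_sq_lt (by nlinarith)
  refine lt_of_lt_of_le (by linarith : 1 < (a + s) / 2)
    (le_csSup (isBounded_spectrum_weylOp σ).bddAbove (mem_spectrum_weylOp (τ := τ) ?_))
  linear_combination (1 / 4 : ℝ) * hs2

end WeylOperator

theorem mainTheorem3 (σ : ℝ) (hσ : 0 ≤ σ) :
    (∃! A : L2Line →L[ℂ] L2Line,
      IsWeylQuantization ((hyperbolicRegion σ).indicator (fun _ => (1 : ℂ))) A) ∧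
    ∀ A : L2Line →L[ℂ] L2Line,
      IsWeylQuantization ((hyperbolicRegion σ).indicator (fun _ => (1 : ℂ))) A →
      IsSelfAdjoint A ∧
      (∃ Ψ : L2Line ≃ₗᵢ[ℂ] L2Pair, IsLogCoordinates Ψ ∧
        IsMatrixFourierMultiplier (multiplierMatrix σ) (fun Φ => Ψ (A (Ψ.symm Φ)))) ∧
      spectrum ℂ A =
        closure {μ : ℂ | ∃ τ : ℝ,
          Module.End.HasEigenvalue (Matrix.toLin' (multiplierMatrix σ τ)) μ} ∧
      sInf (spectrum ℝ A) < 0 ∧ 1 < sSup (spectrum ℝ A) := by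
  have hW := isWeylQuantization_weylOp σ
  refine ⟨⟨weylOp σ, hW, fun B hB => hB.unique hW⟩, fun A hA => ?_⟩
  obtain rfl := hA.unique hW
  exact ⟨isSelfAdjoint_weylOp σ, ⟨logUnitary, isLogCoordinates_logUnitary,
    isMatrixFourierMultiplier_weylOp σ⟩, spectrum_weylOp σ, sInf_spectrum_weylOp_neg σ,
    one_lt_sSup_spectrum_weylOp σ⟩
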